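/- Let $p>q\ge 1$ be integers (not necessarily coprime), $\beta=p/q$, and for $c\in\mathbb C$ let $\mathbf f_c(z)=z^{\beta}+c$ be the multifunction $z\mapsto \mathbf f_c(z)=\{w\in\mathbb C : (w-c)^q=z^p\}$. Definitions. A forward orbit is a sequence in $\mathbb C$ with $z_{i+1}\in\mathbf f_c(z_i)$. The filled Julia set $K_c$ is the set of points from which at least one bounded forward orbit starts; $\mathbf g_c(z)=\mathbf f_c(z)\cap K_c$; and $M_{\beta,0}=\{c: 0\in K_c\}$. A univalent branch of $\mathbf f_c$ is an injective holomorphic map $\varphi$ on a region with $\varphi(z)\in\mathbf f_c(z)$. A cycle is a periodic forward orbit with minimal period $n$; its multiplier is $0$ if it contains $0$, and otherwise $\prod_{i<n}\varphi_i'(z_i)$, with $\varphi_i$ the univalent branch taking $z_i$ to $z_{i+1}$. The cycle is repelling (attracting) if the multiplier has modulus $>1$ ($<1$). The Julia set $\mathcal J_c$ (dual Julia set $\mathcal J_c^*$) is the closure of the union of all repelling (finite attracting) cycles; $\mathcal J_c^{e*}=\mathcal J_c^*\cup\{\infty\}$. For $z\in\widehat{\mathbb C}$, $\omega(z)$ is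 the set of limits of convergent subsequences of bounded forward orbits starting at $z$ (so $\omega(\infty)=\emptyset$), and the basin of $\mathcal J_c^{e*}$ is $\{z\in\widehat{\mathbb C}:\omega(z)\subset\mathcal J_c^{e*}\}$. Consider the conditions 1. $0\notin\mathcal J_c^*$; 2. $\mathbf g_c(z)\subset\mathcal J_c^*$ for every $z\in\mathcal J_c^*$; 3. there are a smooth conformal metric $\rho(z)|dz|$, $\rho>0$, on an open neighbourhood of $\mathcal J_c^*$ and $\kappa<1$ such that $\rho(\varphi(z))|\varphi'(z)|/\rho(z)\le\kappa$ for all $z\in\mathcal J_c^*$ and all univalent branches $\varphi$ of $\mathbf f_c$ at $z$ with $\varphi(z)\in\mathcal J_c^*$; 4. the basin of $\mathcal J_c^{e*}$ is $\widehat{\mathbb C}\setminus\mathcal J_c$. $\mathbf f_c$ is hyperbolic if 1–4 hold. A center is a parameter $a$ with $\mathbf g_a^n(0)=\{0\}$ for some $n>0$; it is simple if there is exactly one orbit of $0$ under $\mathbf g_a$. Theorem (Hyperbolicity). (i) If $c\notin M_{\beta,0}$, then $\mathbf f_c$ is hyperbolic. (ii) If $a$ is a simple center, then $\mathbf f_c$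 is hyperbolic for all $c\ne a$ sufficiently close to $a$; at $c=a$ itself, where $0\in\mathcal J_a^*$, conditions 2–4 hold. -/

import Mathlib

namespace PowerCorr

open Filter Topology
open scoped ContDiff

/-- The multifunction `z^(p/q) + c`: the set of all `w` with `(w - c)^q = z^p`.
The pair `(p, q)` is not required to be in lowest terms. -/
def image (p q : ℕ) (c z : ℂ) : Set ℂ := {w | (w - c) ^ q = z ^ p}

/-- Iterates of a multifunction. -/
def iter (F : ℂ → Set ℂ) : ℕ → ℂ → Set ℂ
  | 0, z => {z}
  | n + 1, z => ⋃ w ∈ F z, iter F n w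

/-- Forward orbits of a multifunction. -/
def IsForwardOrbit (F : ℂ → Set ℂ) (z : ℕ → ℂ) : Prop := ∀ i, z (i + 1) ∈ F (z i)

/-- `φ` is a univalent branch of `z^(p/q) + c` on the region `U`. -/
def IsUnivalentBranch (p q : ℕ) (c : ℂ) (U : Set ℂ) (φ : ℂ → ℂ) : Prop :=
  IsOpen U ∧ IsConnected U ∧ DifferentiableOn ℂ φ U ∧ Set.InjOn φ U ∧
    ∀ z ∈ U, φ z ∈ image p q c z

/-- `z` is a cycle of minimal period `n`: a periodic forward orbit in `ℂ`. -/
def IsCycle (p q : ℕ) (c : ℂ) (n : ℕ) (z : ℕ → ℂ) : Prop :=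
  IsForwardOrbit (image p q c) z ∧ 0 < n ∧ Function.Periodic z n ∧
    ∀ m, 0 < m → Function.Periodic z m → n ≤ m

/-- `μ` is the multiplier of the cycle `z` of period `n`: it is `0` if the cycle contains `0`, and
otherwise the product of the derivatives of the univalent branches taking `z i` to `z (i + 1)`. -/
def HasMultiplier (p q : ℕ) (c : ℂ) (n : ℕ) (z : ℕ → ℂ) (μ : ℂ) : Prop :=
  ((∃ i < n, z i = 0) ∧ μ = 0) ∨
  ((∀ i < n, z i ≠ 0) ∧ ∃ (U : ℕ → Set ℂ) (φ : ℕ → ℂ → ℂ),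
    (∀ i < n, IsUnivalentBranch p q c (U i) (φ i) ∧ z i ∈ U i ∧ φ i (z i) = z (i + 1)) ∧
    μ = ∏ i ∈ Finset.range n, deriv (φ i) (z i))

/-- The Julia set: closure of the union of all repelling cycles. -/
def julia (p q : ℕ) (c : ℂ) : Set ℂ :=
  closure {x | ∃ n z μ, IsCycle p q c n z ∧ HasMultiplier p q c n z μ ∧ 1 < ‖μ‖ ∧ ∃ i, z i = x}

/-- The dual Julia set: closure of the union of all finite attracting cycles. -/
def dualJulia (p q : ℕ) (c : ℂ) : Set ℂ :=
  closure {x | ∃ n z μ, IsCycle p q c n z ∧ HasMultiplier p q c n z μ ∧ ‖μ‖ < 1 ∧ ∃ i, z i = x}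

/-- The dual Julia set together with the point `∞` of the Riemann sphere. -/
def extDualJulia (p q : ℕ) (c : ℂ) : Set (OnePoint ℂ) :=
  (fun x : ℂ => (x : OnePoint ℂ)) '' dualJulia p q c ∪ {OnePoint.infty}

/-- The filled Julia set: points with at least one bounded forward orbit. By
`filledJulia_eq_iInter` below it is the intersection of the preimages of an escape disk. -/
def filledJulia (p q : ℕ) (c : ℂ) : Set ℂ :=
  {x | ∃ z : ℕ → ℂ, z 0 = x ∧ IsForwardOrbit (image p q c) z ∧
    Bornology.IsBounded (Set.range z)}

/-- The restriction of the multifunction to the filled Julia set. -/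
def restr (p q : ℕ) (c z : ℂ) : Set ℂ := image p q c z ∩ filledJulia p q c

/-- The set `M_{β,0}` of parameters for which `0` lies in the filled Julia set. -/
def M0 (p q : ℕ) : Set ℂ := {c | (0 : ℂ) ∈ filledJulia p q c}

/-- The `ω`-limit set of a point of the Riemann sphere: all limits of subsequences of bounded
forward orbits starting there. (The only orbit of `∞` is constant, hence not bounded in `ℂ`.) -/
def omegaLim (p q : ℕ) (c : ℂ) (x : OnePoint ℂ) : Set (OnePoint ℂ) :=
  {ζ | ∃ z : ℕ → ℂ, (z 0 : OnePoint ℂ) = x ∧ IsForwardOrbit (image p q c) z ∧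
    Bornology.IsBounded (Set.range z) ∧
    ∃ k : ℕ → ℕ, StrictMono k ∧ Tendsto (fun i => (z (k i) : OnePoint ℂ)) atTop (𝓝 ζ)}

/-- The basin of attraction of the extended dual Julia set. -/
def basin (p q : ℕ) (c : ℂ) : Set (OnePoint ℂ) :=
  {x | omegaLim p q c x ⊆ extDualJulia p q c}

/-- The dual Julia set supports an attracting conformal metric `ρ(z)|dz|`, that is, the supremum of
`ρ(φ z) |φ' z| / ρ(z)` over all points `z` of the dual Julia set and all univalent branches `φ` at
`z` with `φ z` in the dual Julia set is less than `1`. -/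
def SupportsAttractingMetric (p q : ℕ) (c : ℂ) : Prop :=
  ∃ (V : Set ℂ) (ρ : ℂ → ℝ), IsOpen V ∧ dualJulia p q c ⊆ V ∧ ContDiffOn ℝ ∞ ρ V ∧
    (∀ z ∈ V, 0 < ρ z) ∧
    ∃ κ < 1, ∀ z ∈ dualJulia p q c, ∀ (U : Set ℂ) (φ : ℂ → ℂ), IsUnivalentBranch p q c U φ →
      z ∈ U → φ z ∈ dualJulia p q c → ρ (φ z) * ‖deriv φ z‖ / ρ z ≤ κ

/-- Invariance and metric contraction on the dual Julia set, together with the description of the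
basin, without the requirement that the critical point `0` be outside the dual Julia set. -/
def IsHyperbolicOffCritical (p q : ℕ) (c : ℂ) : Prop :=
  (∀ z ∈ dualJulia p q c, restr p q c z ⊆ dualJulia p q c) ∧
  SupportsAttractingMetric p q c ∧
  basin p q c = ((fun x : ℂ => (x : OnePoint ℂ)) '' julia p q c)ᶜ

/-- The dual Julia set is a hyperbolic attractor for the restriction to the filled Julia set. The
critical point is required to lie outside the dual Julia set, as no univalent branch is defined
there. -/
def IsHyperbolicAttractor (p q : ℕ) (c : ℂ) : Prop :=
  (0 : ℂ) ∉ dualJulia p q c ∧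
  (∀ z ∈ dualJulia p q c, restr p q c z ⊆ dualJulia p q c) ∧
  SupportsAttractingMetric p q c

/-- Hyperbolicity of `z^(p/q) + c`: the dual Julia set is a hyperbolic attractor, and the basin of
attraction of the extended dual Julia set is the complement of the Julia set in the sphere. -/
def IsHyperbolic (p q : ℕ) (c : ℂ) : Prop :=
  IsHyperbolicAttractor p q c ∧
  basin p q c = ((fun x : ℂ => (x : OnePoint ℂ)) '' julia p q c)ᶜ

/-- Centers: some iterate of the restricted multifunction maps `0` to `{0}`. -/
def IsCenter (p q : ℕ) (c : ℂ) : Prop := ∃ n, 0 < n ∧ iter (restr p q c) n 0 = {0}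

/-- Simple centers: `0` has only one orbit under the restricted multifunction. -/
def IsSimpleCenter (p q : ℕ) (c : ℂ) : Prop :=
  IsCenter p q c ∧ ∃! z : ℕ → ℂ, z 0 = 0 ∧ IsForwardOrbit (restr p q c) z

/-- `R` is an escape radius: outside the disk of radius `R` about `0`, the multifunction expands the
modulus by a definite factor. -/
def IsEscapeRadius (p q : ℕ) (c : ℂ) (R : ℝ) : Prop :=
  0 < R ∧ ∃ κ : ℝ, 1 < κ ∧ ∀ z w, R ≤ ‖z‖ → w ∈ image p q c z → κ * ‖z‖ ≤ ‖w‖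

theorem exists_isEscapeRadius (p q : ℕ) (hq : 0 < q) (hpq : q < p) (c : ℂ) :
    ∃ R, IsEscapeRadius p q c R := by
  have h2 : 1 ≤ 2 + ‖c‖ := by linarith [norm_nonneg c]
  have h1 : 1 ≤ (2 + ‖c‖) ^ q := one_le_pow₀ h2
  refine ⟨(2 + ‖c‖) ^ q, by linarith, 2, by norm_num, fun z w hz hw => ?_⟩
  have hz1 : 1 ≤ ‖z‖ := h1.trans hz
  have e : ‖w - c‖ ^ q = ‖z‖ ^ p := by
    have : (w - c) ^ q = z ^ p := hw
    rw [← norm_pow, this, norm_pow]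
  have h3 : ((2 + ‖c‖) * ‖z‖) ^ q ≤ ‖w - c‖ ^ q := by
    rw [e, mul_pow]
    calc (2 + ‖c‖) ^ q * ‖z‖ ^ q ≤ ‖z‖ * ‖z‖ ^ q := by gcongr
      _ = ‖z‖ ^ (q + 1) := by ring
      _ ≤ ‖z‖ ^ p := pow_le_pow_right₀ hz1 hpq
  have h4 : (2 + ‖c‖) * ‖z‖ ≤ ‖w - c‖ :=
    le_of_pow_le_pow_left₀ hq.ne' (norm_nonneg _) h3
  have h5 := norm_sub_le w c
  nlinarith [norm_nonneg c]

theorem image_finite (p q : ℕ) (hq : 0 < q) (c z : ℂ) : (image p q c z).Finite := by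
  classical
  have h : ((fun w => w - c) ⁻¹' {x : ℂ | x ^ q = z ^ p}).Finite := by
    refine Set.Finite.preimage (fun a _ b _ h => by simpa using h) ?_
    refine (Polynomial.nthRoots q (z ^ p)).toFinset.finite_toSet.subset fun x hx => ?_
    simpa [Polynomial.mem_nthRoots hq] using hx
  exact h

theorem IsForwardOrbit.mem_iter {F : ℂ → Set ℂ} {z : ℕ → ℂ} (hz : IsForwardOrbit F z) (n : ℕ) :
    ∀ i, z (i + n) ∈ iter F n (z i) := by
  induction n with
  | zero => intro i; simp [iter]
  | succ n ih =>
    intro i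
    simp only [iter, Set.mem_iUnion]
    refine ⟨z (i + 1), hz i, ?_⟩
    have := ih (i + 1)
    rwa [show i + 1 + n = i + (n + 1) by ring] at this

/-- The filled Julia set is the intersection of the preimages of any escape disk. -/
theorem filledJulia_eq_iInter (p q : ℕ) (hq : 0 < q) (c : ℂ) (R : ℝ)
    (hR : IsEscapeRadius p q c R) :
    filledJulia p q c =
      ⋂ n : ℕ, ⋂ _ : 0 < n, {x | (iter (image p q c) n x ∩ Metric.ball 0 R).Nonempty} := by
  obtain ⟨hR0, κ, hκ, hesc⟩ := hR
  have out : ∀ z w, R ≤ ‖z‖ → w ∈ image p q c z → R ≤ ‖w‖ := fun z w hz hw => by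
    have := hesc z w hz hw
    nlinarith [norm_nonneg z]
  have outn : ∀ n z w, R ≤ ‖z‖ → w ∈ iter (image p q c) n z → R ≤ ‖w‖ := by
    intro n
    induction n with
    | zero => intro z w hz hw; simp only [iter, Set.mem_singleton_iff] at hw; rwa [hw]
    | succ n ih =>
      intro z w hz hw
      simp only [iter, Set.mem_iUnion] at hw
      obtain ⟨y, hy, hw⟩ := hw
      exact ih y w (out z y hz hy) hw
  ext x
  simp only [Set.mem_iInter, Set.mem_ofPred_eq]
  constructor
  · rintro ⟨z, rfl, ho, hb⟩ n _
    obtain ⟨C, hC⟩ := hb.exists_norm_le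
    refine ⟨z n, by simpa using ho.mem_iter n 0, ?_⟩
    by_contra hn
    have hn : R ≤ ‖z n‖ := by simpa using hn
    have grow : ∀ k, R ≤ ‖z (n + k)‖ ∧ κ ^ k * R ≤ ‖z (n + k)‖ := by
      intro k
      induction k with
      | zero => simpa using hn
      | succ k ih =>
        have hm := ho (n + k)
        refine ⟨out _ _ ih.1 hm, ?_⟩
        have := hesc _ _ ih.1 hm
        calc κ ^ (k + 1) * R = κ * (κ ^ k * R) := by ring
          _ ≤ κ * ‖z (n + k)‖ := by have := ih.2; gcongr
          _ ≤ _ := this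
    obtain ⟨k, hk⟩ := pow_unbounded_of_one_lt (C / R) hκ
    have h1 := (grow k).2
    have h2 := hC _ ⟨n + k, rfl⟩
    rw [div_lt_iff₀ hR0] at hk
    linarith
  · intro h
    let G : Set ℂ := {x | ∀ n, (iter (image p q c) n x ∩ Metric.ball 0 R).Nonempty}
    have mono : ∀ n x, (iter (image p q c) (n + 1) x ∩ Metric.ball 0 R).Nonempty →
        (iter (image p q c) n x ∩ Metric.ball 0 R).Nonempty := by
      intro n
      induction n with
      | zero =>
        rintro x ⟨w, hw, hwR⟩
        refine ⟨x, by simp [iter], ?_⟩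
        by_contra hx
        have := outn 1 x w (by simpa using hx) hw
        simp at hwR
        linarith
      | succ n ih =>
        rintro x ⟨w, hw, hwR⟩
        rw [iter] at hw
        simp only [Set.mem_iUnion] at hw
        obtain ⟨y, hy, hw⟩ := hw
        obtain ⟨v, hv, hvR⟩ := ih y ⟨w, hw, hwR⟩
        refine ⟨v, ?_, hvR⟩
        simp only [iter, Set.mem_iUnion]
        exact ⟨y, hy, hv⟩
    have mono' : ∀ x m n, n ≤ m → (iter (image p q c) m x ∩ Metric.ball 0 R).Nonempty →
        (iter (image p q c) n x ∩ Metric.ball 0 R).Nonempty := by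
      intro x m n hnm
      induction hnm with
      | refl => exact id
      | step _ ih => exact fun h => ih (mono _ _ h)
    have hxG : x ∈ G := fun n => mono n x (h (n + 1) n.succ_pos)
    have step : ∀ y : G, ∃ w : G, (w : ℂ) ∈ image p q c y := by
      rintro ⟨y, hy⟩
      by_contra! hbad
      have hb : ∀ w ∈ image p q c y, ∃ n, ¬ (iter (image p q c) n w ∩ Metric.ball 0 R).Nonempty := by
        intro w hw
        by_contra! hG
        exact hbad ⟨w, hG⟩ hw
      choose! N hN using hb
      obtain ⟨m, hm⟩ := ((image_finite p q hq c y).image N).bddAbove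
      obtain ⟨v, hv, hvR⟩ := hy (m + 1)
      simp only [iter, Set.mem_iUnion] at hv
      obtain ⟨w, hw, hv⟩ := hv
      exact hN w hw (mono' w m (N w) (hm ⟨w, hw, rfl⟩) ⟨v, hv, hvR⟩)
    choose s hs using step
    let o : ℕ → G := fun n => s^[n] ⟨x, hxG⟩
    refine ⟨fun n => o n, rfl, fun i => ?_, ?_⟩
    · have := hs (o i)
      simpa only [o, Function.iterate_succ_apply'] using this
    · refine Metric.isBounded_ball.subset (?_ : _ ⊆ Metric.ball (0 : ℂ) R)
      rintro _ ⟨n, rfl⟩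
      obtain ⟨v, hv, hvR⟩ := (o n).2 0
      simp only [iter, Set.mem_singleton_iff] at hv
      rwa [hv] at hvR

end PowerCorr

namespace PowerCorr

open Filter Topology
open scoped ContDiff
open Metric Set

/-! Write `β = p / q`. Every branch at `z` has derivative of modulus `dil p q z = β |z|^(β - 1)`, so
whether a cycle attracts or repels depends on its points alone.

Expansion. Let `U` be a bounded open set that omits `c` and contains the `η`-neighbourhood of its
own preimage. Holomorphic disks in `U` lift through the multifunction, since `U` misses the critical
value, and a lifted disk can be perturbed by `η` inside `U`. Hence the Kobayashi metric of `U` is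
expanded by a definite factor at each step (`IsExpandingDomain.kob_step`), and cycles in `U` are
repelling. If `U` is connected, long pullbacks are uniformly contracting and can be closed up to
repelling cycles, so every point with an orbit in `U` is in the Julia set
(`IsExpandingDomain.mem_julia`).

Traps. Such a `U` is a connected difference `lev k \ A` of a preimage of an escape disk and a closed
set `A` that absorbs a neighbourhood of itself. If `A` contains no repelling cycle, the Julia set is
the set of starting points of bounded orbits avoiding `A`. The description of the basin follows once
limits of orbits in `A` lie in the dual Julia set (`IsTrap.basin_eq`). For `c` outside `M0` the
empty trap works, with `k` the first level that `c` leaves.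

Simple centers. At each nonzero point `v j` of the cycle of `0` all images but one leave the filled
Julia set. One finite level `k` detects this, also for nearby `c` and `z`, so a single branch
survives near each such `v j`. Near `0` all images remain, but they are close to `c` because `β >
1`. Disks about the orbit of the critical value form a trap, on which a density that is constant on
each disk makes every step contract by `1 / 2`. Let `b = cent c φ N` be the end of that orbit, near
`0`. If `b = 0`, the traps shrink to the cycle of `0`. If `b ≠ 0`, the trap can be taken of size
comparable to `|b|`. Its last disk misses `0`, the branches between its disks form a system of
contractions, and long orbit segments end near attracting cycles
(`LocalModel.exists_dualJulia_near`).

Finally `b ≠ 0` for `c ≠ a` near `a`. It is analytic in `c`, and if it vanished identically, `0`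
would be periodic for a transcendental parameter. A field automorphism would move this parameter to
a large one, for which `0` never returns. -/

/-! ### Derivatives of branches and multipliers of cycles -/

theorem norm_sub_of_mem_image {p q : ℕ} (hq : 0 < q) {c z w : ℂ} (h : w ∈ image p q c z) :
    ‖w - c‖ = ‖z‖ ^ ((p : ℝ) / q) := by
  have h1 : ‖w - c‖ ^ q = ‖z‖ ^ p := by rw [← norm_pow, ← norm_pow]; exact congrArg norm h
  have h2 : (‖w - c‖ ^ q) ^ ((q : ℝ)⁻¹) = ‖w - c‖ := Real.pow_rpow_inv_natCast (norm_nonneg _) hq.ne'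
  rw [← h2, h1, ← Real.rpow_natCast, ← Real.rpow_mul (norm_nonneg _), div_eq_mul_inv]

theorem ratio_gt_one {p q : ℕ} (hq : 0 < q) (hpq : q < p) : 1 < (p : ℝ) / q := by
  rw [lt_div_iff₀ (by exact_mod_cast hq)]; simpa using hpq

/-- The modulus of the derivative of every branch of `z^(p/q) + c` at `z`. -/
noncomputable def dil (p q : ℕ) (z : ℂ) : ℝ := (p : ℝ) / q * ‖z‖ ^ ((p : ℝ) / q - 1)

theorem dil_nonneg (p q : ℕ) (z : ℂ) : 0 ≤ dil p q z := by unfold dil; positivity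

theorem dil_pos {p q : ℕ} (hq : 0 < q) (hpq : q < p) {z : ℂ} (hz : z ≠ 0) : 0 < dil p q z := by
  have : 0 < (p : ℝ) / q := by linarith [ratio_gt_one hq hpq]
  have : 0 < ‖z‖ := norm_pos_iff.2 hz
  unfold dil; positivity

theorem dil_zero {p q : ℕ} (hq : 0 < q) (hpq : q < p) : dil p q 0 = 0 := by
  have := ratio_gt_one hq hpq
  rw [dil, norm_zero, Real.zero_rpow (by linarith), mul_zero]

/-- Implicit differentiation of `(f - c)^q = g^p`. -/
theorem norm_deriv_eq_dil_mul {p q : ℕ} (hq : 0 < q) (hpq : q < p) {c x : ℂ} {f g : ℂ → ℂ}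
    (hf : DifferentiableAt ℂ f x) (hg : DifferentiableAt ℂ g x)
    (h : ∀ᶠ y in 𝓝 x, f y ∈ image p q c (g y)) (hx : g x ≠ 0) :
    ‖deriv f x‖ = dil p q (g x) * ‖deriv g x‖ := by
  have h1 : HasDerivAt (fun y => (f y - c) ^ q) (q * (f x - c) ^ (q - 1) * deriv f x) x :=
    (hf.hasDerivAt.sub_const c).pow q
  have h2 : HasDerivAt (fun y => g y ^ p) (p * g x ^ (p - 1) * deriv g x) x := hg.hasDerivAt.pow p
  have h3 := h1.unique (h2.congr_of_eventuallyEq h)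
  have h4 := congrArg norm h3
  have h5 := norm_sub_of_mem_image hq h.self_of_nhds
  simp only [norm_mul, norm_pow, Complex.norm_natCast, h5] at h4
  have hg0 : 0 < ‖g x‖ := norm_pos_iff.2 hx
  have hq' : (0 : ℝ) < q := by exact_mod_cast hq
  rw [← Real.rpow_natCast, ← Real.rpow_natCast ‖g x‖, ← Real.rpow_mul hg0.le,
    Nat.cast_sub (by omega), Nat.cast_sub (by omega)] at h4
  have h6 : (p : ℝ) - (1 : ℕ) = (p : ℝ) / q * ((q : ℝ) - (1 : ℕ)) + ((p : ℝ) / q - 1) := by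
    field_simp
    push_cast
    ring
  rw [h6, Real.rpow_add hg0] at h4
  set A := ‖g x‖ ^ ((p : ℝ) / q * ((q : ℝ) - (1 : ℕ)))
  have hA : A ≠ 0 := (Real.rpow_pos_of_pos hg0 _).ne'
  unfold dil
  generalize ‖g x‖ ^ ((p : ℝ) / q - 1) = X at h4 ⊢
  field_simp
  apply mul_left_cancel₀ hA
  linear_combination h4

/-- At `z = 0` implicit differentiation gives nothing, but `|φ y - c| = |y|^β` with `β > 1` forces
the derivative to vanish there, in agreement with `dil_zero`. -/
theorem norm_deriv_branch {p q : ℕ} (hq : 0 < q) (hpq : q < p) {c z : ℂ} {U : Set ℂ} {φ : ℂ → ℂ}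
    (hU : IsOpen U) (hd : DifferentiableOn ℂ φ U) (h : ∀ z ∈ U, φ z ∈ image p q c z)
    (hz : z ∈ U) : ‖deriv φ z‖ = dil p q z := by
  have hUz := hU.mem_nhds hz
  by_cases h0 : z = 0
  · subst h0
    have hb := ratio_gt_one hq hpq
    have hc : φ 0 = c := by
      have := norm_sub_of_mem_image hq (h 0 hz)
      rw [norm_zero, Real.zero_rpow (by linarith), norm_eq_zero, sub_eq_zero] at this
      exact this
    have hder : HasDerivAt φ 0 0 := by
      rw [hasDerivAt_iff_tendsto, tendsto_zero_iff_norm_tendsto_zero]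
      have ht : Tendsto (fun y : ℂ => ‖y‖ ^ ((p : ℝ) / q - 1)) (𝓝 0) (𝓝 0) := by
        have : Continuous (fun y : ℂ => ‖y‖ ^ ((p : ℝ) / q - 1)) :=
          continuous_norm.rpow_const fun _ => Or.inr (by linarith)
        have h := this.tendsto 0
        rwa [norm_zero, Real.zero_rpow (by linarith)] at h
      refine squeeze_zero' (Eventually.of_forall fun _ => norm_nonneg _) ?_ ht
      filter_upwards [hUz] with y hy
      have := norm_sub_of_mem_image hq (h y hy)
      rw [hc, sub_zero, smul_zero, sub_zero, this, norm_mul, norm_inv, norm_norm, Real.norm_eq_abs,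
        abs_of_nonneg (by positivity)]
      by_cases hy0 : y = 0
      · simp only [hy0, norm_zero, inv_zero, zero_mul]; positivity
      · rw [Real.rpow_sub_one (norm_ne_zero_iff.2 hy0), inv_mul_eq_div]
    rw [hder.deriv, norm_zero, dil_zero hq hpq]
  · have := norm_deriv_eq_dil_mul hq hpq (c := c) (f := φ) (g := id) (hd.differentiableAt hUz)
      differentiableAt_id (by filter_upwards [hUz] with y hy using h y hy) h0
    simpa using this

/-- The branch of `z^(p/q) + c` through `(z₀, w₀)`. -/
noncomputable def branch (p q : ℕ) (z₀ u₀ c z : ℂ) : ℂ :=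
  c + u₀ * (z / z₀) ^ ((p : ℂ) / q)

theorem branch_self (p q : ℕ) {z₀ : ℂ} (hz : z₀ ≠ 0) (u₀ c : ℂ) :
    branch p q z₀ u₀ c z₀ = c + u₀ := by
  simp [branch, div_self hz]

theorem branch_mem {p q : ℕ} (hq : 0 < q) {z₀ u₀ : ℂ} (hz₀ : z₀ ≠ 0) (h : u₀ ^ q = z₀ ^ p)
    (c z : ℂ) : branch p q z₀ u₀ c z ∈ image p q c z := by
  have hq' : (q : ℂ) ≠ 0 := by exact_mod_cast hq.ne'
  change (c + u₀ * (z / z₀) ^ ((p : ℂ) / q) - c) ^ q = z ^ p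
  rw [add_sub_cancel_left, mul_pow, h, ← Complex.cpow_nat_mul, mul_div_cancel₀ _ hq',
    Complex.cpow_natCast, div_pow, mul_div_cancel₀ _ (pow_ne_zero _ hz₀)]

theorem div_mem_slitPlane {z₀ z : ℂ} (hz₀ : z₀ ≠ 0) (hz : z ∈ ball z₀ ‖z₀‖) :
    z / z₀ ∈ Complex.slitPlane := by
  refine Complex.mem_slitPlane_of_norm_lt_one (z := z / z₀ - 1) ?_ |> fun h => by simpa using h
  have : z / z₀ - 1 = (z - z₀) / z₀ := by field_simp
  rw [this, norm_div, div_lt_one (norm_pos_iff.2 hz₀)]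
  simpa [dist_eq_norm] using hz

theorem differentiableOn_branch (p q : ℕ) {z₀ : ℂ} (hz₀ : z₀ ≠ 0) (u₀ c : ℂ) :
    DifferentiableOn ℂ (branch p q z₀ u₀ c) (ball z₀ ‖z₀‖) := by
  intro z hz
  have := div_mem_slitPlane hz₀ hz
  refine DifferentiableAt.differentiableWithinAt ?_
  unfold branch
  exact (((differentiableAt_id.div_const z₀).cpow_const this).const_mul u₀).const_add c

/-- The principal power in `branch` is holomorphic on the disk about `z` of radius `‖z‖`. Its
derivative at `z` is nonzero, so it is injective on a smaller disk. -/
theorem exists_univalentBranch {p q : ℕ} (hq : 0 < q) (hpq : q < p) {c z w : ℂ} (hz : z ≠ 0)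
    (hw : w ∈ image p q c z) :
    ∃ U φ, IsUnivalentBranch p q c U φ ∧ z ∈ U ∧ φ z = w := by
  have hu : (w - c) ^ q = z ^ p := hw
  set φ := branch p q z (w - c) c
  have hd : DifferentiableOn ℂ φ (ball z ‖z‖) := differentiableOn_branch p q hz _ _
  have hm : ∀ y, φ y ∈ image p q c y := branch_mem hq hz hu c
  have hzb : z ∈ ball z ‖z‖ := mem_ball_self (norm_pos_iff.2 hz)
  have hder : deriv φ z ≠ 0 := by
    rw [← norm_ne_zero_iff, norm_deriv_branch hq hpq isOpen_ball hd (fun y _ => hm y) hzb]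
    exact (dil_pos hq hpq hz).ne'
  have hs : HasStrictDerivAt φ (deriv φ z) z :=
    (hd.analyticAt (isOpen_ball.mem_nhds hzb)).hasStrictDerivAt
  have hleft := hs.eventually_left_inverse hder
  obtain ⟨ε, hε, hb⟩ := Metric.eventually_nhds_iff_ball.1
    (hleft.and (isOpen_ball.mem_nhds hzb))
  refine ⟨ball z ε, φ, ⟨isOpen_ball, (convex_ball z ε).isConnected ⟨z, mem_ball_self hε⟩,
    hd.mono fun y hy => (hb y hy).2, ?_, fun y _ => hm y⟩, mem_ball_self hε, ?_⟩
  · intro x hx y hy hxy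
    rw [← (hb x hx).1, ← (hb y hy).1, hxy]
  · simp [φ, branch_self p q hz]

theorem HasMultiplier.norm_eq {p q : ℕ} (hq : 0 < q) (hpq : q < p) {c μ : ℂ} {n : ℕ} {z : ℕ → ℂ}
    (h : HasMultiplier p q c n z μ) : ‖μ‖ = ∏ i ∈ Finset.range n, dil p q (z i) := by
  rcases h with ⟨⟨i, hi, h0⟩, rfl⟩ | ⟨_, U, φ, hφ, rfl⟩
  · rw [norm_zero, eq_comm]
    exact Finset.prod_eq_zero (Finset.mem_range.2 hi) (by rw [h0, dil_zero hq hpq])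
  · rw [norm_prod]
    refine Finset.prod_congr rfl fun i hi => ?_
    obtain ⟨⟨ho, _, hd, _, hm⟩, hz, _⟩ := hφ i (Finset.mem_range.1 hi)
    exact norm_deriv_branch hq hpq ho hd hm hz

theorem exists_hasMultiplier {p q : ℕ} (hq : 0 < q) (hpq : q < p) {c : ℂ} {n : ℕ} {z : ℕ → ℂ}
    (h : IsForwardOrbit (image p q c) z) : ∃ μ, HasMultiplier p q c n z μ := by
  by_cases h0 : ∃ i < n, z i = 0
  · exact ⟨0, Or.inl ⟨h0, rfl⟩⟩
  · push Not at h0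
    have : ∀ i, ∃ (U : Set ℂ) (φ : ℂ → ℂ), i < n →
        IsUnivalentBranch p q c U φ ∧ z i ∈ U ∧ φ (z i) = z (i + 1) := by
      intro i
      by_cases hi : i < n
      · obtain ⟨U, φ, hh⟩ := exists_univalentBranch hq hpq (h0 i hi) (h i)
        exact ⟨U, φ, fun _ => hh⟩
      · exact ⟨∅, id, fun h => absurd h hi⟩
    choose U φ hφ using this
    exact ⟨_, Or.inr ⟨h0, U, φ, hφ, rfl⟩⟩

/-- The modulus of the multiplier is the product of `dil` over a period, also for cycles through
`0`. From here on branches drop out of the definitions of both Julia sets. -/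
theorem julia_eq {p q : ℕ} (hq : 0 < q) (hpq : q < p) (c : ℂ) :
    julia p q c = closure {x | ∃ n z, IsCycle p q c n z ∧
      1 < ∏ i ∈ Finset.range n, dil p q (z i) ∧ ∃ i, z i = x} := by
  unfold julia
  congr 1
  ext x
  constructor
  · rintro ⟨n, z, μ, hz, hμ, h1, hi⟩
    exact ⟨n, z, hz, hμ.norm_eq hq hpq ▸ h1, hi⟩
  · rintro ⟨n, z, hz, h1, hi⟩
    obtain ⟨μ, hμ⟩ := exists_hasMultiplier hq hpq (n := n) hz.1
    exact ⟨n, z, μ, hz, hμ, hμ.norm_eq hq hpq ▸ h1, hi⟩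

theorem dualJulia_eq {p q : ℕ} (hq : 0 < q) (hpq : q < p) (c : ℂ) :
    dualJulia p q c = closure {x | ∃ n z, IsCycle p q c n z ∧
      ∏ i ∈ Finset.range n, dil p q (z i) < 1 ∧ ∃ i, z i = x} := by
  unfold dualJulia
  congr 1
  ext x
  constructor
  · rintro ⟨n, z, μ, hz, hμ, h1, hi⟩
    exact ⟨n, z, hz, hμ.norm_eq hq hpq ▸ h1, hi⟩
  · rintro ⟨n, z, hz, h1, hi⟩
    obtain ⟨μ, hμ⟩ := exists_hasMultiplier hq hpq (n := n) hz.1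
    exact ⟨n, z, μ, hz, hμ, hμ.norm_eq hq hpq ▸ h1, hi⟩

theorem exists_isCycle {p q : ℕ} {c : ℂ} {m : ℕ} {z : ℕ → ℂ}
    (h : IsForwardOrbit (image p q c) z) (hm : 0 < m) (hp : Function.Periodic z m) :
    ∃ n, IsCycle p q c n z := by
  classical
  have hex : ∃ m, 0 < m ∧ Function.Periodic z m := ⟨m, hm, hp⟩
  exact ⟨Nat.find hex, h, (Nat.find_spec hex).1, (Nat.find_spec hex).2,
    fun k hk hkp => Nat.find_min' hex ⟨hk, hkp⟩⟩

theorem IsCycle.shift {p q : ℕ} {c : ℂ} {n : ℕ} {z : ℕ → ℂ} (h : IsCycle p q c n z) (k : ℕ) :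
    IsForwardOrbit (image p q c) (fun i => z (i + k)) ∧ Function.Periodic (fun i => z (i + k)) n :=
  ⟨fun i => by simpa [add_right_comm] using h.1 (i + k),
    fun i => by simpa [add_right_comm] using h.2.2.1 (i + k)⟩

theorem IsCycle.isBounded {p q : ℕ} {c : ℂ} {n : ℕ} {z : ℕ → ℂ} (h : IsCycle p q c n z) :
    Bornology.IsBounded (range z) := by
  refine ((finite_Iio n).image z).isBounded.subset ?_
  rintro _ ⟨i, rfl⟩
  exact ⟨i % n, Nat.mod_lt _ h.2.1, h.2.2.1.map_mod_nat i⟩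

/-! ### Lifting disks and expansion of the Kobayashi metric -/

/-- Since `f - c` has no zeros, `f' / (f - c)` has a primitive `l` on the disk, and `z * exp (q / p
* l)` is the lift. -/
theorem exists_lift_ball {p q : ℕ} (hp : 0 < p) {c x z : ℂ} {δ : ℝ} {f : ℂ → ℂ}
    (hδ : 0 < δ) (hf : DifferentiableOn ℂ f (ball x δ)) (hc : ∀ ζ ∈ ball x δ, f ζ ≠ c)
    (hz : f x ∈ image p q c z) :
    ∃ g : ℂ → ℂ, DifferentiableOn ℂ g (ball x δ) ∧ g x = z ∧
      ∀ ζ ∈ ball x δ, f ζ ∈ image p q c (g ζ) := by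
  have hx : x ∈ ball x δ := mem_ball_self hδ
  have hF : DifferentiableOn ℂ (fun ζ => deriv f ζ / (f ζ - c)) (ball x δ) :=
    (hf.deriv isOpen_ball).div (hf.sub_const c) fun ζ hζ => sub_ne_zero.2 (hc ζ hζ)
  obtain ⟨l, hl0, hl⟩ := hF.isExactOn_ball.with_val_at x 0
  have hconst : ∀ ζ ∈ ball x δ, Complex.exp (-l ζ) * (f ζ - c) = f x - c := by
    intro ζ hζ
    have hd : ∀ y ∈ ball x δ, HasDerivAt (fun y => Complex.exp (-l y) * (f y - c)) 0 y := by
      intro y hy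
      have h1 := ((hl y hy).neg.cexp).mul
        (((hf.differentiableAt (isOpen_ball.mem_nhds hy)).hasDerivAt).sub_const c)
      refine h1.congr_deriv ?_
      have := sub_ne_zero.2 (hc y hy)
      field_simp
      ring
    have := (convex_ball x δ).norm_image_sub_le_of_norm_hasDerivWithin_le (C := 0)
      (fun y hy => (hd y hy).hasDerivWithinAt) (fun y _ => by simp) hx hζ
    rw [zero_mul, norm_le_zero_iff, sub_eq_zero] at this
    simpa [hl0] using this
  refine ⟨fun ζ => z * Complex.exp ((q : ℂ) / p * l ζ), ?_, by simp [hl0], ?_⟩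
  · intro ζ hζ
    exact (((hl ζ hζ).const_mul _).cexp.const_mul z).differentiableAt.differentiableWithinAt
  · intro ζ hζ
    have hp' : (p : ℂ) ≠ 0 := by exact_mod_cast hp.ne'
    have h1 : f ζ - c = (f x - c) * Complex.exp (l ζ) := by
      rw [← hconst ζ hζ, mul_right_comm, ← Complex.exp_add]; simp
    have hz' : (f x - c) ^ q = z ^ p := hz
    change (f ζ - c) ^ q = (z * Complex.exp ((q : ℂ) / p * l ζ)) ^ p
    rw [h1, mul_pow, mul_pow, hz', ← Complex.exp_nat_mul, ← Complex.exp_nat_mul]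
    congr 2
    field_simp

/-- A bounded open set containing a uniform neighbourhood of its preimage and omitting `c`. -/
structure IsExpandingDomain (p q : ℕ) (c : ℂ) (U : Set ℂ) (R η : ℝ) : Prop where
  isOpen : IsOpen U
  subset : U ⊆ ball 0 R
  notMem : c ∉ U
  pos : 0 < η
  ball_subset : ∀ z w, w ∈ image p q c z → w ∈ U → ball z η ⊆ U

/-- Derivatives at the centre of holomorphic disks in `U` centred at `x`. -/
def diskDerivs (U : Set ℂ) (x : ℂ) : Set ℝ :=
  {r | ∃ f : ℂ → ℂ, DifferentiableOn ℂ f (ball 0 1) ∧ MapsTo f (ball 0 1) U ∧ f 0 = x ∧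
    r = ‖deriv f 0‖}

/-- The reciprocal of the Kobayashi metric of `U`. -/
noncomputable def kob (U : Set ℂ) (x : ℂ) : ℝ := sSup (diskDerivs U x)

theorem diskDerivs_le {U : Set ℂ} {R : ℝ} (hU : U ⊆ ball 0 R) {y : ℂ} {s : ℝ}
    (h : s ∈ diskDerivs U y) : s ≤ 2 * R := by
  obtain ⟨f, hf, hm, rfl, rfl⟩ := h
  have := Complex.norm_deriv_le_div_of_mapsTo_ball (R₂ := 2 * R) hf (fun ζ hζ => ?_) one_pos
  · simpa using this
  · have h1 : ‖f ζ‖ < R := by simpa using hU (hm hζ)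
    have h2 : ‖f 0‖ < R := by simpa using hU (hm (mem_ball_self one_pos))
    rw [mem_closedBall, dist_eq_norm]
    linarith [norm_sub_le (f ζ) (f 0)]

theorem bddAbove_diskDerivs {U : Set ℂ} {R : ℝ} (hU : U ⊆ ball 0 R) (y : ℂ) :
    BddAbove (diskDerivs U y) := ⟨2 * R, fun _ h => diskDerivs_le hU h⟩

theorem mem_diskDerivs {U : Set ℂ} {x : ℂ} {δ : ℝ} (hδ : 0 < δ) (h : ball x δ ⊆ U) :
    δ ∈ diskDerivs U x := by
  have hd : ∀ ζ, HasDerivAt (fun ζ : ℂ => x + δ * ζ) δ ζ := fun ζ => by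
    simpa using ((hasDerivAt_id ζ).const_mul (δ : ℂ)).const_add x
  refine ⟨fun ζ => x + δ * ζ, fun ζ _ => (hd ζ).differentiableAt.differentiableWithinAt,
    fun ζ hζ => h ?_, by simp, ?_⟩
  · rw [mem_ball_zero_iff] at hζ
    simp only [mem_ball, dist_eq_norm, add_sub_cancel_left, norm_mul, Complex.norm_real,
      Real.norm_eq_abs, abs_of_pos hδ]
    nlinarith
  · rw [(hd 0).deriv, Complex.norm_real, Real.norm_eq_abs, abs_of_pos hδ]

theorem le_kob {U : Set ℂ} {R : ℝ} (hU : U ⊆ ball 0 R) {x : ℂ} {δ : ℝ} (hδ : 0 < δ)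
    (h : ball x δ ⊆ U) : δ ≤ kob U x :=
  le_csSup (bddAbove_diskDerivs hU x) (mem_diskDerivs hδ h)

theorem kob_pos {U : Set ℂ} {R : ℝ} (hU : U ⊆ ball 0 R) (ho : IsOpen U) {x : ℂ} (hx : x ∈ U) :
    0 < kob U x := by
  obtain ⟨δ, hδ, h⟩ := Metric.isOpen_iff.1 ho x hx
  exact hδ.trans_le (le_kob hU hδ h)

theorem kob_le {U : Set ℂ} {R : ℝ} (hU : U ⊆ ball 0 R) (ho : IsOpen U) {x : ℂ} (hx : x ∈ U) :
    kob U x ≤ 2 * R := by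
  obtain ⟨δ, hδ, h⟩ := Metric.isOpen_iff.1 ho x hx
  exact csSup_le ⟨δ, mem_diskDerivs hδ h⟩ fun _ h => diskDerivs_le hU h

theorem exists_unit_norm_add (d : ℂ) {η : ℝ} (hη : 0 < η) :
    ∃ u : ℂ, ‖u‖ = 1 ∧ ‖d + η * u‖ = ‖d‖ + η := by
  by_cases hd : d = 0
  · exact ⟨1, by simp, by simp [hd, abs_of_pos hη]⟩
  · have h0 : (‖d‖ : ℂ) ≠ 0 := by exact_mod_cast norm_ne_zero_iff.2 hd
    have h1 : ‖d / ‖d‖‖ = 1 := by simp [hd]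
    refine ⟨d / ‖d‖, h1, ?_⟩
    have : d + η * (d / ‖d‖) = ((‖d‖ + η : ℝ) : ℂ) * (d / ‖d‖) := by
      push_cast; field_simp
    rw [this, norm_mul, h1, mul_one, Complex.norm_real, Real.norm_eq_abs,
      abs_of_nonneg (by positivity)]

namespace IsExpandingDomain

variable {p q : ℕ} {c : ℂ} {U : Set ℂ} {R η : ℝ}

theorem mem_of_image (h : IsExpandingDomain p q c U R η) {z w : ℂ} (hw : w ∈ image p q c z)
    (hwU : w ∈ U) : z ∈ U := h.ball_subset z w hw hwU (mem_ball_self h.pos)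

theorem ne_zero (h : IsExpandingDomain p q c U R η) (hq : 0 < q) (hp : 0 < p) {z w : ℂ}
    (hw : w ∈ image p q c z) (hwU : w ∈ U) : z ≠ 0 := by
  rintro rfl
  have : (w - c) ^ q = 0 ^ p := hw
  rw [zero_pow hp.ne', pow_eq_zero_iff hq.ne', sub_eq_zero] at this
  exact h.notMem (this ▸ hwU)

theorem R_pos (h : IsExpandingDomain p q c U R η) {x : ℂ} (hx : x ∈ U) : 0 < R := by
  have := h.subset hx
  rw [mem_ball_zero_iff] at this
  exact (norm_nonneg x).trans_lt this

/-- A disk in `U` centred at `w` lifts to a disk `g` centred at `z`. Adding a linear term of slope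
`η` to `g` keeps it in `U`. As `‖g' 0‖ ≤ 2 * R`, gaining `η` in the derivative is a gain by the
factor `1 + η / (2 * R)` at least. -/
theorem kob_step (h : IsExpandingDomain p q c U R η) (hq : 0 < q) (hpq : q < p) {z w : ℂ}
    (hw : w ∈ image p q c z) (hwU : w ∈ U) :
    (1 + η / (2 * R)) * kob U w ≤ dil p q z * kob U z := by
  have hR := h.R_pos hwU
  have hη := h.pos
  have hl : 0 < 1 + η / (2 * R) := by positivity
  have hp : 0 < p := by omega
  rw [mul_comm, ← le_div_iff₀ hl]
  obtain ⟨δ, hδ, hδU⟩ := Metric.isOpen_iff.1 h.isOpen w hwU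
  refine csSup_le ⟨δ, mem_diskDerivs hδ hδU⟩ ?_
  rintro _ ⟨f, hf, hm, rfl, rfl⟩
  rw [le_div_iff₀ hl]
  obtain ⟨g, hg, rfl, hgf⟩ := exists_lift_ball hp one_pos hf
    (fun ζ hζ he => h.notMem (by rw [← he]; exact hm hζ)) hw
  have hnh : ball (0 : ℂ) 1 ∈ 𝓝 0 := ball_mem_nhds _ one_pos
  have hder := norm_deriv_eq_dil_mul hq hpq (hf.differentiableAt hnh) (hg.differentiableAt hnh)
    (by filter_upwards [hnh] with ζ hζ using hgf ζ hζ) (h.ne_zero hq hp hw hwU)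
  have hgb : ‖deriv g 0‖ ≤ 2 * R := diskDerivs_le h.subset (y := g 0)
    ⟨g, hg, fun ζ hζ => h.mem_of_image (hgf ζ hζ) (hm hζ), rfl, rfl⟩
  -- The slope points in the direction of `g' 0`, so the moduli add up.
  obtain ⟨u, hu, hud⟩ := exists_unit_norm_add (deriv g 0) hη
  have hmem : ‖deriv g 0‖ + η ∈ diskDerivs U (g 0) := by
    refine ⟨fun ζ => g ζ + η * u * ζ, hg.add (by fun_prop), fun ζ hζ => ?_, by simp, ?_⟩
    · refine h.ball_subset _ _ (hgf ζ hζ) (hm hζ) ?_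
      rw [mem_ball_zero_iff] at hζ
      simp only [mem_ball, dist_eq_norm, add_sub_cancel_left, norm_mul, Complex.norm_real,
        Real.norm_eq_abs, abs_of_pos hη, hu]
      nlinarith
    · have h1 := (hg.differentiableAt hnh).hasDerivAt.add
        ((hasDerivAt_id (0 : ℂ)).const_mul (η * u))
      have h2 : deriv (fun ζ => g ζ + η * u * ζ) 0 = deriv g 0 + η * u := by
        simpa using! h1.deriv
      rw [h2, hud]
  have h3 := le_csSup (bddAbove_diskDerivs h.subset _) hmem
  rw [hder]
  have h4 : ‖deriv g 0‖ * (1 + η / (2 * R)) ≤ ‖deriv g 0‖ + η := by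
    have : ‖deriv g 0‖ * (η / (2 * R)) ≤ η := by
      rw [mul_div_assoc', div_le_iff₀ (by positivity)]; nlinarith
    linarith
  calc dil p q (g 0) * ‖deriv g 0‖ * (1 + η / (2 * R))
      = dil p q (g 0) * (‖deriv g 0‖ * (1 + η / (2 * R))) := by ring
    _ ≤ dil p q (g 0) * kob U (g 0) :=
      mul_le_mul_of_nonneg_left (h4.trans h3) (dil_nonneg _ _ _)

theorem pow_le_prod (h : IsExpandingDomain p q c U R η) (hq : 0 < q) (hpq : q < p) {z : ℕ → ℂ}
    (hz : IsForwardOrbit (image p q c) z) (hU : ∀ i, z i ∈ U) (n : ℕ) :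
    (1 + η / (2 * R)) ^ n * kob U (z n) ≤ (∏ i ∈ Finset.range n, dil p q (z i)) * kob U (z 0) := by
  induction n with
  | zero => simp
  | succ n ih =>
    have hR := h.R_pos (hU 0)
    have hη := h.pos
    have hl : 0 < 1 + η / (2 * R) := by positivity
    have := h.kob_step hq hpq (hz n) (hU (n + 1))
    rw [Finset.prod_range_succ]
    calc _ = (1 + η / (2 * R)) ^ n * ((1 + η / (2 * R)) * kob U (z (n + 1))) := by ring
      _ ≤ (1 + η / (2 * R)) ^ n * (dil p q (z n) * kob U (z n)) := by gcongr
      _ = dil p q (z n) * ((1 + η / (2 * R)) ^ n * kob U (z n)) := by ring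
      _ ≤ dil p q (z n) * ((∏ i ∈ Finset.range n, dil p q (z i)) * kob U (z 0)) :=
        mul_le_mul_of_nonneg_left ih (dil_nonneg _ _ _)
      _ = _ := by ring

/-- Around a cycle the two values of `kob` in `pow_le_prod` cancel. -/
theorem one_lt_prod (h : IsExpandingDomain p q c U R η) (hq : 0 < q) (hpq : q < p) {z : ℕ → ℂ}
    {n : ℕ} (hz : IsCycle p q c n z) (hU : ∀ i, z i ∈ U) :
    1 < ∏ i ∈ Finset.range n, dil p q (z i) := by
  have h1 := h.pow_le_prod hq hpq hz.1 hU n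
  have h2 : z n = z 0 := by simpa using hz.2.2.1 0
  rw [h2] at h1
  have h3 := le_of_mul_le_mul_right h1 (kob_pos h.subset h.isOpen (hU 0))
  have hR := h.R_pos (hU 0)
  have hη := h.pos
  refine lt_of_lt_of_le (one_lt_pow₀ ?_ hz.2.1.ne') h3
  have : 0 < η / (2 * R) := by positivity
  linarith

end IsExpandingDomain

/-! ### Pullbacks along orbits and density of repelling cycles -/

/-- `y` is reached from `x` by an orbit of length `n` inside `U`. -/
def Reach (F : ℂ → Set ℂ) (U : Set ℂ) : ℕ → ℂ → ℂ → Prop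
  | 0, x, y => x = y ∧ x ∈ U
  | n + 1, x, y => x ∈ U ∧ ∃ w ∈ F x, Reach F U n w y

theorem Reach.left_mem {F : ℂ → Set ℂ} {U : Set ℂ} {n : ℕ} {x y : ℂ} (h : Reach F U n x y) :
    x ∈ U := by
  cases n with
  | zero => exact h.2
  | succ n => exact h.1

theorem reach_of_orbit {F : ℂ → Set ℂ} {U : Set ℂ} {z : ℕ → ℂ} (hz : IsForwardOrbit F z)
    (hU : ∀ i, z i ∈ U) (n i : ℕ) : Reach F U n (z i) (z (i + n)) := by
  induction n generalizing i with
  | zero => exact ⟨rfl, hU i⟩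
  | succ n ih =>
    have := ih (i + 1)
    rw [show i + 1 + n = i + (n + 1) by ring] at this
    exact ⟨hU i, z (i + 1), hz i, this⟩

theorem Reach.exists_seq {F : ℂ → Set ℂ} {U : Set ℂ} {n : ℕ} {x y : ℂ} (h : Reach F U n x y) :
    ∃ u : ℕ → ℂ, u 0 = x ∧ u n = y ∧ (∀ i, i < n → u (i + 1) ∈ F (u i)) ∧ ∀ i, i ≤ n → u i ∈ U := by
  induction n generalizing x with
  | zero => exact ⟨fun _ => x, rfl, h.1, fun i hi => absurd hi (by omega), fun i _ => h.2⟩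
  | succ n ih =>
    obtain ⟨hx, w, hw, hr⟩ := h
    obtain ⟨u, h0, hn, hF, hU⟩ := ih hr
    refine ⟨fun i => Nat.casesOn i x u, rfl, hn, fun i hi => ?_, fun i hi => ?_⟩
    · cases i with
      | zero => change u 0 ∈ F x; rwa [h0]
      | succ i => exact hF i (by omega)
    · cases i with
      | zero => exact hx
      | succ i => exact hU i (by omega)

/-- A closed orbit segment extends to a periodic orbit. -/
theorem Reach.exists_periodic {F : ℂ → Set ℂ} {U : Set ℂ} {n : ℕ} {x : ℂ} (h : Reach F U n x x)
    (hn : 0 < n) : ∃ u : ℕ → ℂ, u 0 = x ∧ IsForwardOrbit F u ∧ Function.Periodic u n ∧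
      ∀ i, u i ∈ U := by
  obtain ⟨u, h0, hl, hF, hU⟩ := h.exists_seq
  refine ⟨fun i => u (i % n), by simpa using h0, fun i => ?_, fun i => by simp, fun i =>
    hU _ (Nat.mod_lt _ hn).le⟩
  have hlt := Nat.mod_lt i hn
  have h1 := hF (i % n) hlt
  change u ((i + 1) % n) ∈ F (u (i % n))
  rcases Nat.lt_or_ge (i % n + 1) n with h2 | h2
  · rwa [Nat.add_mod, Nat.mod_eq_of_lt (a := 1) (by omega), Nat.mod_eq_of_lt h2]
  · have h3 : i % n + 1 = n := by omega
    rw [h3, hl] at h1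
    have h4 : (i + 1) % n = 0 := by
      rw [← Nat.mod_add_div i n, add_right_comm, h3]; simp
    rwa [h4, h0]

namespace IsExpandingDomain

variable {p q : ℕ} {c : ℂ} {U : Set ℂ} {R η : ℝ}

theorem exists_pullback (h : IsExpandingDomain p q c U R η) (hq : 0 < q) (hpq : q < p) {n : ℕ}
    {x y : ℂ} {δ : ℝ} (hδ : 0 < δ) (hy : ball y δ ⊆ U) (hr : Reach (image p q c) U n x y) :
    ∃ G : ℂ → ℂ, DifferentiableOn ℂ G (ball y δ) ∧ G y = x ∧
      ∀ ζ ∈ ball y δ, Reach (image p q c) U n (G ζ) ζ ∧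
        (1 + η / (2 * R)) ^ n * kob U ζ * ‖deriv G ζ‖ ≤ kob U (G ζ) := by
  induction n generalizing x with
  | zero => exact ⟨id, differentiableOn_id, hr.1.symm, fun ζ hζ => ⟨⟨rfl, hy hζ⟩, by simp⟩⟩
  | succ n ih =>
    obtain ⟨hx, w, hw, hr⟩ := hr
    obtain ⟨G, hG, rfl, hGr⟩ := ih hr
    have hp : 0 < p := by omega
    have hGU : ∀ ζ ∈ ball y δ, G ζ ∈ U := fun ζ hζ => (hGr ζ hζ).1.left_mem
    obtain ⟨g, hg, hgx, hgG⟩ := exists_lift_ball hp hδ hG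
      (fun ζ hζ he => h.notMem (by rw [← he]; exact hGU ζ hζ)) hw
    refine ⟨g, hg, hgx, fun ζ hζ => ⟨⟨h.mem_of_image (hgG ζ hζ) (hGU ζ hζ), _, hgG ζ hζ,
      (hGr ζ hζ).1⟩, ?_⟩⟩
    have hnh := isOpen_ball.mem_nhds hζ
    have hg0 := h.ne_zero hq hp (hgG ζ hζ) (hGU ζ hζ)
    have hder := norm_deriv_eq_dil_mul hq hpq (hG.differentiableAt hnh) (hg.differentiableAt hnh)
      (by filter_upwards [hnh] with ζ hζ using hgG ζ hζ) hg0
    have h1 := (hGr ζ hζ).2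
    have h2 := h.kob_step hq hpq (hgG ζ hζ) (hGU ζ hζ)
    have hR := h.R_pos hx
    have hη := h.pos
    have hl : 0 < 1 + η / (2 * R) := by positivity
    refine le_of_mul_le_mul_left ?_ (dil_pos hq hpq hg0)
    calc _ = (1 + η / (2 * R)) * ((1 + η / (2 * R)) ^ n * kob U ζ * (dil p q (g ζ) * ‖deriv g ζ‖)) := by
          ring
      _ ≤ (1 + η / (2 * R)) * kob U (G ζ) := by rw [← hder]; gcongr
      _ ≤ _ := h2

/-- Over the ball of radius `δ` the value of `kob` is at least `δ`, and everywhere in `U` it is at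
most `2 * R`. The contraction of `exists_pullback` therefore becomes a Euclidean one, at the cost of
the constant `2 * R / δ`. -/
theorem exists_contracting_pullback (h : IsExpandingDomain p q c U R η) (hq : 0 < q)
    (hpq : q < p) {n : ℕ} {x y : ℂ} {δ : ℝ} (hδ : 0 < δ) (hy : ball y (2 * δ) ⊆ U)
    (hr : Reach (image p q c) U n x y) :
    ∃ G : ℂ → ℂ, G y = x ∧ (∀ ζ ∈ ball y δ, Reach (image p q c) U n (G ζ) ζ) ∧
      ∀ ζ ∈ ball y δ, ∀ ξ ∈ ball y δ,
        ‖G ζ - G ξ‖ ≤ 2 * R / δ * (1 + η / (2 * R))⁻¹ ^ n * ‖ζ - ξ‖ := by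
  obtain ⟨G, hG, hGy, hGr⟩ := h.exists_pullback hq hpq hδ
    ((ball_subset_ball (by linarith)).trans hy) hr
  refine ⟨G, hGy, fun ζ hζ => (hGr ζ hζ).1, fun ζ hζ ξ hξ => ?_⟩
  refine Convex.norm_image_sub_le_of_norm_deriv_le (s := ball y δ)
    (fun z hz => hG.differentiableAt (isOpen_ball.mem_nhds hz)) (fun z hz => ?_)
    (convex_ball _ _) hξ hζ
  have hR := h.R_pos hr.left_mem
  have hη := h.pos
  have hl : 0 < 1 + η / (2 * R) := by positivity
  have h1 : δ ≤ kob U z := le_kob h.subset hδ fun v hv => hy (by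
    rw [mem_ball] at *
    linarith [dist_triangle v z y])
  have h2 : kob U (G z) ≤ 2 * R := kob_le h.subset h.isOpen (hGr z hz).1.left_mem
  have h3 := (hGr z hz).2
  rw [inv_pow, ← div_eq_mul_inv, div_div, le_div_iff₀ (by positivity)]
  calc ‖deriv G z‖ * (δ * (1 + η / (2 * R)) ^ n)
      = (1 + η / (2 * R)) ^ n * δ * ‖deriv G z‖ := by ring
    _ ≤ (1 + η / (2 * R)) ^ n * kob U z * ‖deriv G z‖ := by gcongr
    _ ≤ 2 * R := h3.trans h2

theorem inv_mem (h : IsExpandingDomain p q c U R η) {x : ℂ} (hx : x ∈ U) :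
    0 < (1 + η / (2 * R))⁻¹ ∧ (1 + η / (2 * R))⁻¹ < 1 := by
  have hR := h.R_pos hx
  have hη := h.pos
  have : 0 < η / (2 * R) := by positivity
  exact ⟨by positivity, inv_lt_one_of_one_lt₀ (by linarith)⟩

/-- Pullbacks of two points of a connected expanding domain along suitable orbits approach each
other exponentially fast. -/
theorem exists_close_pullback (h : IsExpandingDomain p q c U R η) (hq : 0 < q)
    (hpq : q < p) (hU : IsPreconnected U) {a b : ℂ} (ha : a ∈ U) (hb : b ∈ U) :
    ∃ C : ℝ, ∀ n x, Reach (image p q c) U n x a → ∃ x', Reach (image p q c) U n x' b ∧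
      ‖x - x'‖ ≤ C * (1 + η / (2 * R))⁻¹ ^ n := by
  have key : ∀ a b δ, 0 < δ → ball a (2 * δ) ⊆ U → b ∈ ball a δ →
      ∃ C : ℝ, ∀ n x, Reach (image p q c) U n x a → ∃ x', Reach (image p q c) U n x' b ∧
      ‖x - x'‖ ≤ C * (1 + η / (2 * R))⁻¹ ^ n := by
    intro a b δ hδ hs hb
    refine ⟨2 * R / δ * ‖a - b‖, fun n x hx => ?_⟩
    obtain ⟨G, rfl, hG, hGl⟩ := h.exists_contracting_pullback hq hpq hδ hs hx
    refine ⟨G b, hG b hb, ?_⟩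
    have := hGl a (mem_ball_self hδ) b hb
    calc _ ≤ _ := this
      _ = _ := by ring
  -- The relation holds in both directions between nearby points, and it is transitive, with the
  -- constants adding up. Connectedness of `U` then gives it for all pairs.
  refine hU.induction₂' (fun a b => ∃ C : ℝ, ∀ n x, Reach (image p q c) U n x a →
    ∃ x', Reach (image p q c) U n x' b ∧ ‖x - x'‖ ≤ C * (1 + η / (2 * R))⁻¹ ^ n)
    (fun x hx => ?_) ?_ ha hb
  · obtain ⟨δ, hδ, hs⟩ := Metric.isOpen_iff.1 h.isOpen x hx
    refine eventually_nhdsWithin_of_eventually_nhds ?_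
    filter_upwards [ball_mem_nhds x (ε := δ / 4) (by positivity)] with y hy
    refine ⟨key x y (δ / 2) (by positivity) (by rwa [mul_div_cancel₀ _ two_ne_zero])
      (ball_subset_ball (by linarith) hy), key y x (δ / 4) (by positivity) (fun v hv => hs ?_)
      (by rwa [mem_ball_comm])⟩
    rw [mem_ball] at *
    linarith [dist_triangle v y x]
  · rintro x y z hx hy hz ⟨C, hC⟩ ⟨C', hC'⟩
    refine ⟨C + C', fun n v hv => ?_⟩
    obtain ⟨v', hv', h1⟩ := hC n v hv
    obtain ⟨v'', hv'', h2⟩ := hC' n v' hv'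
    refine ⟨v'', hv'', ?_⟩
    rw [add_mul]
    exact (norm_sub_le_norm_sub_add_norm_sub v v' v'').trans (add_le_add h1 h2)

end IsExpandingDomain

theorem exists_fixedPoint_of_contraction {G : ℂ → ℂ} {x : ℂ} {ε : ℝ} (hε : 0 ≤ ε)
    (hm : MapsTo G (closedBall x ε) (closedBall x ε))
    (hG : ∀ y ∈ closedBall x ε, ∀ z ∈ closedBall x ε, ‖G y - G z‖ ≤ 1 / 2 * ‖y - z‖) :
    ∃ y ∈ closedBall x ε, G y = y := by
  have hc : ContractingWith (1 / 2) (hm.restrict G _ _) := by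
    refine ⟨by norm_num, LipschitzWith.of_dist_le_mul fun y z => ?_⟩
    rw [Subtype.dist_eq, Subtype.dist_eq, dist_eq_norm, dist_eq_norm]
    simpa using hG y y.2 z z.2
  obtain ⟨y, hy, hf, -⟩ := hc.exists_fixedPoint' isClosed_closedBall.isComplete hm
    (mem_closedBall_self hε) (edist_ne_top _ _)
  exact ⟨y, hy, hf⟩

namespace IsExpandingDomain

variable {p q : ℕ} {c : ℂ} {U : Set ℂ} {R η : ℝ}

/-- Every point with a forward orbit in a connected expanding domain is in the Julia set. -/
theorem mem_julia (h : IsExpandingDomain p q c U R η) (hq : 0 < q)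
    (hpq : q < p) (hU : IsPreconnected U) {z : ℕ → ℂ} (hz : IsForwardOrbit (image p q c) z)
    (hzU : ∀ i, z i ∈ U) : z 0 ∈ julia p q c := by
  have hη := h.pos
  have hR := h.R_pos (hzU 0)
  have hη' : ∀ i, ball (z i) η ⊆ U := fun i => h.ball_subset _ _ (hz i) (hzU _)
  obtain ⟨hs0, hs1⟩ := h.inv_mem (hzU 0)
  set s := (1 + η / (2 * R))⁻¹
  -- The orbit need not return to `z 0`, but it accumulates at some `x`. Pulling `x` back gives a
  -- point near `z 0` that reaches `x` in `k i` steps. Moving the endpoint from `x` to `z 0` gives a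
  -- point `v` near `z 0` that reaches `z 0` itself. The inverse branch along this almost closed
  -- orbit has a fixed point.
  obtain ⟨x, -, k, hk, hlim⟩ := tendsto_subseq_of_bounded (isBounded_ball (x := (0 : ℂ)) (r := R))
    (x := z) fun i => h.subset (hzU i)
  have hev : ∀ᶠ i in atTop, x ∈ ball (z (k i)) (η / 2) := by
    filter_upwards [hlim (ball_mem_nhds x (half_pos hη))] with i hi
    rwa [mem_ball_comm]
  obtain ⟨i₀, hi₀⟩ := hev.exists
  have hxU : x ∈ U := hη' _ (ball_subset_ball (by linarith) hi₀)
  obtain ⟨C, hC⟩ := h.exists_close_pullback hq hpq hU hxU (hzU 0)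
  rw [julia_eq hq hpq, Metric.mem_closure_iff]
  intro ε' hε'
  obtain ⟨ε, hε, hεε, hεη⟩ : ∃ ε, 0 < ε ∧ ε < ε' ∧ ε < η / 2 :=
    ⟨min (ε' / 2) (η / 4), by positivity, by linarith [min_le_left (ε' / 2) (η / 4)],
      by linarith [min_le_right (ε' / 2) (η / 4)]⟩
  have hpow : Tendsto (fun i => s ^ k i) atTop (𝓝 0) :=
    (tendsto_pow_atTop_nhds_zero_of_lt_one hs0.le hs1).comp hk.tendsto_atTop
  -- The first condition puts `v` within `ε / 2` of `z 0`, the second makes the pullback `H`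
  -- contract by `1 / 2`. Together they make `H` map the closed `ε`-ball about `z 0` into itself.
  have e1 : ∀ᶠ i in atTop, (2 * R / (η / 2) * (η / 2) + C) * s ^ k i < ε / 2 := by
    have := hpow.const_mul (2 * R / (η / 2) * (η / 2) + C)
    rw [mul_zero] at this
    exact this.eventually (gt_mem_nhds (half_pos hε))
  have e2 : ∀ᶠ i in atTop, 2 * R / (η / 2) * s ^ k i < 1 / 2 := by
    have := hpow.const_mul (2 * R / (η / 2))
    rw [mul_zero] at this
    exact this.eventually (gt_mem_nhds one_half_pos)
  obtain ⟨i, hi, h1, h2, hi1⟩ := (hev.and (e1.and (e2.and (eventually_ge_atTop 1)))).exists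
  have hki : 0 < k i := lt_of_lt_of_le (by omega) hk.le_apply
  have hr := reach_of_orbit hz hzU (k i) 0
  rw [zero_add] at hr
  have h2η : 2 * (η / 2) = η := by ring
  obtain ⟨G, hG0, hGr, hGl⟩ := h.exists_contracting_pullback hq hpq (half_pos hη)
    (by rw [h2η]; exact hη' (k i)) hr
  obtain ⟨v, hv, hvd⟩ := hC (k i) (G x) (hGr x hi)
  have hd1 : ‖z 0 - G x‖ ≤ 2 * R / (η / 2) * (η / 2) * s ^ k i := by
    have h3 := hGl (z (k i)) (mem_ball_self (half_pos hη)) x hi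
    rw [hG0] at h3
    have h4 : ‖z (k i) - x‖ ≤ η / 2 := by
      rw [mem_ball, dist_comm, dist_eq_norm] at hi; exact hi.le
    calc _ ≤ _ := h3
      _ ≤ 2 * R / (η / 2) * s ^ k i * (η / 2) := by gcongr
      _ = _ := by ring
  obtain ⟨H, hH0, hHr, hHl⟩ := h.exists_contracting_pullback hq hpq (half_pos hη)
    (by rw [h2η]; exact hη' 0) hv
  have hsub : closedBall (z 0) ε ⊆ ball (z 0) (η / 2) := closedBall_subset_ball hεη
  have hHc : ∀ y ∈ closedBall (z 0) ε, ∀ w ∈ closedBall (z 0) ε, ‖H y - H w‖ ≤ 1 / 2 * ‖y - w‖ :=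
    fun y hy w hw => (hHl y (hsub hy) w (hsub hw)).trans (by gcongr)
  have hH0' : ‖H (z 0) - z 0‖ ≤ ε / 2 := by
    rw [hH0, norm_sub_rev]
    have := norm_sub_le_norm_sub_add_norm_sub (z 0) (G x) v
    linarith
  obtain ⟨y, hy, hHy⟩ := exists_fixedPoint_of_contraction (G := H) hε.le (fun y hy => by
    have h1 := hHc y hy (z 0) (mem_closedBall_self hε.le)
    rw [mem_closedBall, dist_eq_norm] at *
    linarith [norm_sub_le_norm_sub_add_norm_sub (H y) (H (z 0)) (z 0)]) hHc
  have hyr := hHr y (hsub hy)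
  rw [hHy] at hyr
  obtain ⟨u, hu0, huF, huP, huU⟩ := hyr.exists_periodic hki
  obtain ⟨n, hn⟩ := exists_isCycle huF hki huP
  refine ⟨y, ⟨n, u, hn, h.one_lt_prod hq hpq hn huU, 0, hu0⟩, ?_⟩
  rw [mem_closedBall, dist_comm] at hy
  linarith

end IsExpandingDomain

/-! ### Connectedness of the preimages of an escape disk -/

theorem isOpenMap_add_mul_pow (c : ℂ) {θ : ℂ} (hθ : θ ≠ 0) {n : ℕ} (hn : 0 < n) :
    IsOpenMap (fun t : ℂ => c + θ * t ^ n) := by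
  have ha : AnalyticOnNhd ℂ (fun t : ℂ => c + θ * t ^ n) univ :=
    DifferentiableOn.analyticOnNhd (by fun_prop) isOpen_univ
  rcases ha.is_constant_or_isOpen isPreconnected_univ with ⟨w, hw⟩ | h
  · have h0 := hw 0 (mem_univ _)
    have h1 := hw 1 (mem_univ _)
    simp only [zero_pow hn.ne', one_pow, mul_zero, add_zero, mul_one] at h0 h1
    exact absurd (by linear_combination h1 - h0) hθ
  · exact fun s hs => h s (subset_univ _) hs

theorem isClosedMap_add_mul_pow (c : ℂ) {θ : ℂ} (hθ : θ ≠ 0) {n : ℕ} (hn : 0 < n) :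
    IsClosedMap (fun t : ℂ => c + θ * t ^ n) := by
  refine IsProperMap.isClosedMap ?_
  rw [isProperMap_iff_tendsto_cocompact, ← cobounded_eq_cocompact, ← tendsto_norm_atTop_iff_cobounded]
  refine ⟨by fun_prop, ?_⟩
  have h1 : Tendsto (fun t : ℂ => ‖θ‖ * ‖t‖ ^ n + -‖c‖) (Bornology.cobounded ℂ) atTop :=
    tendsto_atTop_add_const_right _ _ (((tendsto_pow_atTop hn.ne').comp
      tendsto_norm_cobounded_atTop).const_mul_atTop (norm_pos_iff.2 hθ))
  refine tendsto_atTop_mono (fun t => ?_) h1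
  have := norm_sub_le (c + θ * t ^ n) c
  rw [add_sub_cancel_left, norm_mul, norm_pow] at this
  linarith

/-- Preimages of connected open sets under an open and closed map are connected if all of their
components meet at the only preimage of some point. -/
theorem isPreconnected_preimage {f : ℂ → ℂ} (hf : Continuous f) (ho : IsOpenMap f)
    (hcl : IsClosedMap f) {V : Set ℂ} (hV : IsOpen V) (hVc : IsPreconnected V) {a : ℂ}
    (ha : f a ∈ V) (huniq : ∀ x, f x = f a → x = a) : IsPreconnected (f ⁻¹' V) := by
  have key : ∀ u v : Set ℂ, IsOpen u → IsOpen v → f ⁻¹' V ⊆ u ∪ v → f ⁻¹' V ∩ (u ∩ v) = ∅ →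
      a ∈ u → f ⁻¹' V ⊆ u := by
    intro u v hu hv huv hd hau
    have hdis : ∀ x, f x ∈ V → x ∈ u → x ∈ v → False := fun x h1 h2 h3 => by
      have : x ∈ f ⁻¹' V ∩ (u ∩ v) := ⟨h1, h2, h3⟩
      rwa [hd] at this
    -- Points with a preimage in the `v`-part form an open set because `f` is open. Points whose
    -- whole fibre lies in `u` form an open set because `f` is closed. These two sets separate `V`.
    have hB : IsOpen (f '' (f ⁻¹' V ∩ v)) := ho _ ((hV.preimage hf).inter hv)
    have hA : IsOpen (f '' uᶜ)ᶜ := (hcl _ hu.isClosed_compl).isOpen_compl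
    have hcov : V ⊆ (f '' uᶜ)ᶜ ∪ f '' (f ⁻¹' V ∩ v) := fun y hy => by
      by_cases hy' : y ∈ f '' uᶜ
      · obtain ⟨x, hx, rfl⟩ := hy'
        exact Or.inr ⟨x, ⟨hy, (huv hy).resolve_left hx⟩, rfl⟩
      · exact Or.inl hy'
    have hemp : V ∩ ((f '' uᶜ)ᶜ ∩ f '' (f ⁻¹' V ∩ v)) = ∅ := by
      rw [eq_empty_iff_forall_notMem]
      rintro y ⟨-, hy1, x, ⟨hxV, hxv⟩, rfl⟩
      exact hy1 ⟨x, fun hxu => hdis x hxV hxu hxv, rfl⟩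
    rcases isPreconnected_iff_subset_of_disjoint.1 hVc _ _ hA hB hcov hemp with h | h
    · intro x hx
      by_contra hxu
      exact h hx ⟨x, hxu, rfl⟩
    · obtain ⟨x, ⟨hxV, hxv⟩, hxa⟩ := h ha
      rw [huniq x hxa] at hxv
      exact (hdis a ha hau hxv).elim
  rw [isPreconnected_iff_subset_of_disjoint]
  intro u v hu hv huv hd
  rcases huv ha with hau | hav
  · exact Or.inl (key u v hu hv huv hd hau)
  · exact Or.inr (key v u hv hu (by rwa [union_comm]) (by rwa [inter_comm v u]) hav)

/-- The preimage of a set under the multifunction. -/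
def pre (p q : ℕ) (c : ℂ) (V : Set ℂ) : Set ℂ := {z | ∃ w ∈ image p q c z, w ∈ V}

/-- Substituting `z = t ^ q` splits the multifunction into the maps `t ↦ c + θ * t ^ p`. A single
root of unity `θ` would not suffice when `p` and `q` have a common factor. -/
theorem pre_eq {p q : ℕ} (hq : 0 < q) (hp : 0 < p) (c : ℂ) (V : Set ℂ) :
    pre p q c V = ⋃ θ ∈ {θ : ℂ | θ ^ q = 1},
      (fun t : ℂ => 0 + 1 * t ^ q) '' ((fun t : ℂ => c + θ * t ^ p) ⁻¹' V) := by
  ext z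
  simp only [pre, mem_ofPred_eq, mem_iUnion, mem_image, mem_preimage, exists_prop, zero_add, one_mul]
  constructor
  · rintro ⟨w, hw, hwV⟩
    have hw' : (w - c) ^ q = z ^ p := hw
    obtain ⟨t, rfl⟩ := IsAlgClosed.exists_pow_nat_eq z hq
    by_cases ht : t = 0
    · subst ht
      rw [zero_pow hq.ne', zero_pow hp.ne', pow_eq_zero_iff hq.ne', sub_eq_zero] at hw'
      exact ⟨1, one_pow _, 0, by simpa [zero_pow hp.ne', ← hw'] using hwV, rfl⟩
    · refine ⟨(w - c) / t ^ p, ?_, t, ?_, rfl⟩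
      · rw [div_pow, hw', ← pow_mul, ← pow_mul, mul_comm q p, div_self (pow_ne_zero _ ht)]
      · rwa [div_mul_cancel₀ _ (pow_ne_zero _ ht), add_sub_cancel]
  · rintro ⟨θ, hθ, t, ht, rfl⟩
    refine ⟨_, ?_, ht⟩
    change (c + θ * t ^ p - c) ^ q = (t ^ q) ^ p
    rw [add_sub_cancel_left, mul_pow, hθ, one_mul, ← pow_mul, ← pow_mul, mul_comm]

theorem ne_zero_of_pow_eq_one {q : ℕ} (hq : 0 < q) {θ : ℂ} (h : θ ^ q = 1) : θ ≠ 0 := by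
  rintro rfl
  simp [zero_pow hq.ne'] at h

theorem isOpen_pre {p q : ℕ} (hq : 0 < q) (hp : 0 < p) (c : ℂ) {V : Set ℂ} (hV : IsOpen V) :
    IsOpen (pre p q c V) := by
  rw [pre_eq hq hp]
  refine isOpen_biUnion fun θ hθ => ?_
  exact isOpenMap_add_mul_pow 0 one_ne_zero hq _ (hV.preimage (by fun_prop))

/-- The only preimage of `c` under `t ↦ c + θ * t ^ p` is `0`, so each piece of `pre_eq` is
connected, and all pieces contain `0`. -/
theorem isPreconnected_pre {p q : ℕ} (hq : 0 < q) (hp : 0 < p) {c : ℂ} {V : Set ℂ} (hV : IsOpen V)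
    (hVc : IsPreconnected V) (hc : c ∈ V) : IsPreconnected (pre p q c V) := by
  rw [pre_eq hq hp]
  have hmem : ∀ θ : ℂ, (0 : ℂ) ∈ (fun t : ℂ => c + θ * t ^ p) ⁻¹' V := fun θ => by
    simpa [zero_pow hp.ne'] using hc
  rw [biUnion_eq_iUnion]
  refine isPreconnected_iUnion ⟨0, ?_⟩ fun ⟨θ, hθ⟩ => ?_
  · exact mem_iInter.2 fun ⟨θ, _⟩ => ⟨0, hmem θ, by simp [zero_pow hq.ne']⟩
  · have hθ0 := ne_zero_of_pow_eq_one hq hθ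
    refine (isPreconnected_preimage (by fun_prop) (isOpenMap_add_mul_pow c hθ0 hp)
      (isClosedMap_add_mul_pow c hθ0 hp) hV hVc (hmem θ) fun x hx => ?_).image _ (by fun_prop)
    simp only [zero_pow hp.ne', mul_zero, add_zero, add_eq_left, mul_eq_zero, hθ0, false_or] at hx
    exact (pow_eq_zero_iff hp.ne').1 hx

/-- The preimages of an escape disk. -/
def lev (p q : ℕ) (c : ℂ) (R : ℝ) : ℕ → Set ℂ
  | 0 => ball 0 R
  | k + 1 => pre p q c (lev p q c R k)

theorem lev_eq_iter (p q : ℕ) (c : ℂ) (R : ℝ) (k : ℕ) :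
    lev p q c R k = {x | (iter (image p q c) k x ∩ ball 0 R).Nonempty} := by
  induction k with
  | zero => ext x; simp [lev, iter]
  | succ k ih =>
    ext x
    simp only [lev, pre, ih, iter, mem_ofPred_eq, Set.Nonempty, mem_inter_iff, mem_iUnion,
      exists_prop]
    constructor
    · rintro ⟨w, hw, y, hy, hyR⟩
      exact ⟨y, ⟨w, hw, hy⟩, hyR⟩
    · rintro ⟨y, ⟨w, hw, hy⟩, hyR⟩
      exact ⟨w, hw, y, hy, hyR⟩

theorem isOpen_lev {p q : ℕ} (hq : 0 < q) (hp : 0 < p) (c : ℂ) (R : ℝ) (k : ℕ) :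
    IsOpen (lev p q c R k) := by
  induction k with
  | zero => exact isOpen_ball
  | succ k ih => exact isOpen_pre hq hp c ih

theorem isPreconnected_lev {p q : ℕ} (hq : 0 < q) (hp : 0 < p) {c : ℂ} {R : ℝ} {k : ℕ}
    (h : ∀ j < k, c ∈ lev p q c R j) : IsPreconnected (lev p q c R k) := by
  induction k with
  | zero => exact (convex_ball _ _).isPreconnected
  | succ k ih =>
    exact isPreconnected_pre hq hp (isOpen_lev hq hp c R k) (ih fun j hj => h j (by omega))
      (h k (by omega))

theorem IsEscapeRadius.lt_norm {p q : ℕ} {c : ℂ} {R : ℝ} (hR : IsEscapeRadius p q c R) {z w : ℂ}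
    (hz : R ≤ ‖z‖) (hw : w ∈ image p q c z) : R < ‖w‖ := by
  obtain ⟨hR0, κ, hκ, h⟩ := hR
  have := h z w hz hw
  nlinarith

theorem lev_succ_subset {p q : ℕ} {c : ℂ} {R : ℝ} (hR : IsEscapeRadius p q c R) (k : ℕ) :
    lev p q c R (k + 1) ⊆ lev p q c R k := by
  induction k with
  | zero =>
    rintro z ⟨w, hw, hwR⟩
    have h1 : ‖w‖ < R := by simpa [lev] using hwR
    by_contra hz
    have h2 : R ≤ ‖z‖ := by simpa [lev] using hz
    exact absurd (hR.lt_norm h2 hw) (by linarith)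
  | succ k ih =>
    rintro z ⟨w, hw, hwR⟩
    exact ⟨w, hw, ih hwR⟩

theorem lev_antitone {p q : ℕ} {c : ℂ} {R : ℝ} (hR : IsEscapeRadius p q c R) :
    Antitone (lev p q c R) := antitone_nat_of_succ_le fun k => lev_succ_subset hR k

theorem lev_subset_ball {p q : ℕ} {c : ℂ} {R : ℝ} (hR : IsEscapeRadius p q c R) (k : ℕ) :
    lev p q c R k ⊆ ball 0 R := lev_antitone hR (Nat.zero_le k)

theorem filledJulia_subset_lev {p q : ℕ} (hq : 0 < q) {c : ℂ} {R : ℝ}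
    (hR : IsEscapeRadius p q c R) (k : ℕ) : filledJulia p q c ⊆ lev p q c R k := by
  refine Subset.trans ?_ (lev_succ_subset hR k)
  rw [filledJulia_eq_iInter p q hq c R hR, lev_eq_iter]
  exact fun x hx => mem_iInter₂.1 hx (k + 1) k.succ_pos

theorem exists_notMem_lev {p q : ℕ} (hq : 0 < q) {c : ℂ} {R : ℝ}
    (hR : IsEscapeRadius p q c R) {x : ℂ} (hx : x ∉ filledJulia p q c) :
    ∃ k, x ∉ lev p q c R k := by
  by_contra! h
  refine hx ?_
  rw [filledJulia_eq_iInter p q hq c R hR]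
  refine mem_iInter₂.2 fun k _ => ?_
  have := h k
  rwa [lev_eq_iter] at this

/-! ### Compactness of levels and of orbits -/

/-- The closed analogue of `lev` over all parameters. -/
def clev (p q : ℕ) (R : ℝ) : ℕ → Set (ℂ × ℂ)
  | 0 => {x | ‖x.2‖ ≤ R}
  | k + 1 => {x | ∃ w ∈ closedBall (0 : ℂ) R, w ∈ image p q x.1 x.2 ∧ (x.1, w) ∈ clev p q R k}

/-- The image point `w` ranges over a compact disk, so it can be projected away without losing
closedness. Closedness jointly in parameter and point is what allows perturbing both. -/
theorem isClosed_clev (p q : ℕ) (R : ℝ) (k : ℕ) : IsClosed (clev p q R k) := by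
  induction k with
  | zero => exact isClosed_le (by fun_prop) continuous_const
  | succ k ih =>
    have : clev p q R (k + 1) = Prod.fst '' {y : (ℂ × ℂ) × closedBall (0 : ℂ) R |
        ((y.2 : ℂ) - y.1.1) ^ q = y.1.2 ^ p ∧ (y.1.1, (y.2 : ℂ)) ∈ clev p q R k} := by
      ext x
      constructor
      · rintro ⟨w, hw, h1, h2⟩
        exact ⟨(x, ⟨w, hw⟩), ⟨h1, h2⟩, rfl⟩
      · rintro ⟨⟨y, w⟩, ⟨h1, h2⟩, rfl⟩
        exact ⟨w, w.2, h1, h2⟩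
    rw [this]
    have : CompactSpace (closedBall (0 : ℂ) R) :=
      isCompact_iff_compactSpace.1 (isCompact_closedBall _ _)
    refine isClosedMap_fst_of_compactSpace _ (IsClosed.inter ?_ ?_)
    · exact isClosed_eq (by fun_prop) (by fun_prop)
    · exact ih.preimage (by fun_prop)

theorem lev_subset_clev {p q : ℕ} {c : ℂ} {R : ℝ} (hR : IsEscapeRadius p q c R) {k : ℕ} {x : ℂ}
    (hx : x ∈ lev p q c R k) : (c, x) ∈ clev p q R k := by
  induction k generalizing x with
  | zero => exact (mem_ball_zero_iff.1 hx).le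
  | succ k ih =>
    obtain ⟨w, hw, hwk⟩ := hx
    exact ⟨w, ball_subset_closedBall (lev_subset_ball hR k hwk), hw, ih hwk⟩

theorem clev_succ_subset_lev {p q : ℕ} {c : ℂ} {R : ℝ} (hR : IsEscapeRadius p q c R) {k : ℕ}
    {x : ℂ} (hx : (c, x) ∈ clev p q R (k + 1)) : x ∈ lev p q c R k := by
  induction k generalizing x with
  | zero =>
    obtain ⟨w, hw, hwx, -⟩ := hx
    rw [mem_closedBall_zero_iff] at hw
    by_contra h
    have h2 : R ≤ ‖x‖ := by simpa [lev] using h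
    exact absurd (hR.lt_norm h2 hwx) (by linarith)
  | succ k ih =>
    obtain ⟨w, hw, hwx, hwk⟩ := hx
    exact ⟨w, hwx, ih hwk⟩

/-- A compact slice of `clev` lies between two consecutive open levels. -/
theorem exists_ball_subset_lev {p q : ℕ} (hq : 0 < q) (hp : 0 < p) {c : ℂ} {R : ℝ}
    (hR : IsEscapeRadius p q c R) (k : ℕ) :
    ∃ η > 0, ∀ z ∈ lev p q c R (k + 1), ball z η ⊆ lev p q c R k := by
  have hcl : IsClosed {x : ℂ | (c, x) ∈ clev p q R (k + 1)} :=
    (isClosed_clev p q R (k + 1)).preimage (by fun_prop)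
  have hsub : {x : ℂ | (c, x) ∈ clev p q R (k + 1)} ⊆ lev p q c R k :=
    fun x hx => clev_succ_subset_lev hR hx
  have hcomp : IsCompact {x : ℂ | (c, x) ∈ clev p q R (k + 1)} :=
    isCompact_of_isClosed_isBounded hcl
      (isBounded_ball.subset (hsub.trans (lev_subset_ball hR k)))
  obtain ⟨η, hη, h⟩ := hcomp.exists_thickening_subset_open (isOpen_lev hq hp c R k) hsub
  refine ⟨η, hη, fun z hz => (ball_subset_thickening ?_ _).trans h⟩
  exact lev_subset_clev hR hz

/-- A common radius makes the levels for different parameters comparable through `clev`. -/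
theorem exists_uniform_escapeRadius {p q : ℕ} (hq : 0 < q) (hpq : q < p) (M : ℝ) :
    ∃ R, ∀ c : ℂ, ‖c‖ ≤ M → IsEscapeRadius p q c R := by
  refine ⟨(2 + |M|) ^ q, fun c hc => ?_⟩
  have hcM : ‖c‖ ≤ |M| := hc.trans (le_abs_self M)
  have h2 : 1 ≤ 2 + |M| := by linarith [abs_nonneg M]
  have h1 : 1 ≤ (2 + |M|) ^ q := one_le_pow₀ h2
  refine ⟨by linarith, 2, by norm_num, fun z w hz hw => ?_⟩
  have hz1 : 1 ≤ ‖z‖ := h1.trans hz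
  have e : ‖w - c‖ ^ q = ‖z‖ ^ p := by
    rw [← norm_pow, ← norm_pow]; exact congrArg norm hw
  have h3 : ((2 + |M|) * ‖z‖) ^ q ≤ ‖w - c‖ ^ q := by
    rw [e, mul_pow]
    calc (2 + |M|) ^ q * ‖z‖ ^ q ≤ ‖z‖ * ‖z‖ ^ q := by gcongr
      _ = ‖z‖ ^ (q + 1) := by ring
      _ ≤ ‖z‖ ^ p := pow_le_pow_right₀ hz1 hpq
  have h4 : (2 + |M|) * ‖z‖ ≤ ‖w - c‖ := le_of_pow_le_pow_left₀ hq.ne' (norm_nonneg _) h3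
  have h5 := norm_sub_le w c
  nlinarith [abs_nonneg M]

/-- The set of starting points of orbits in a compact set is closed. -/
theorem isClosed_orbit_starts (p q : ℕ) (c : ℂ) {S : Set ℂ} (hS : IsCompact S) :
    IsClosed {x | ∃ z : ℕ → ℂ, z 0 = x ∧ IsForwardOrbit (image p q c) z ∧ ∀ i, z i ∈ S} := by
  have hcomp : IsCompact (univ.pi (fun _ : ℕ => S)) := isCompact_univ_pi fun _ => hS
  have hcl : IsClosed {z : ℕ → ℂ | IsForwardOrbit (image p q c) z} := by
    have : {z : ℕ → ℂ | IsForwardOrbit (image p q c) z} =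
        ⋂ i, {z : ℕ → ℂ | (z (i + 1) - c) ^ q = z i ^ p} := by
      ext z; simp [IsForwardOrbit, image]
    rw [this]
    exact isClosed_iInter fun i => isClosed_eq (by fun_prop) (by fun_prop)
  have := ((hcomp.inter_right hcl).image (continuous_apply 0)).isClosed
  convert this using 1
  ext x
  constructor
  · rintro ⟨z, h0, hz, hi⟩
    exact ⟨z, ⟨fun i _ => hi i, hz⟩, h0⟩
  · rintro ⟨z, ⟨hi, hz⟩, h0⟩
    exact ⟨z, h0, hz, fun i => hi i (mem_univ i)⟩

theorem mem_filledJulia_of_orbit {p q : ℕ} {c : ℂ} {z : ℕ → ℂ}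
    (hz : IsForwardOrbit (image p q c) z) (hb : Bornology.IsBounded (range z)) (i : ℕ) :
    z i ∈ filledJulia p q c := by
  refine ⟨fun j => z (i + j), rfl, fun j => hz (i + j), hb.subset ?_⟩
  rintro _ ⟨j, rfl⟩
  exact ⟨i + j, rfl⟩

theorem isClosed_filledJulia {p q : ℕ} (hq : 0 < q) (hpq : q < p) (c : ℂ) :
    IsClosed (filledJulia p q c) := by
  obtain ⟨R, hR⟩ := exists_isEscapeRadius p q hq hpq c
  convert isClosed_orbit_starts p q c (isCompact_closedBall 0 R) using 1
  ext x
  constructor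
  · rintro ⟨z, h0, hz, hb⟩
    exact ⟨z, h0, hz, fun i => ball_subset_closedBall
      (filledJulia_subset_lev hq hR 0 (mem_filledJulia_of_orbit hz hb i))⟩
  · rintro ⟨z, h0, hz, hb⟩
    exact ⟨z, h0, hz, isBounded_closedBall.subset (range_subset_iff.2 hb)⟩

/-! ### Removing disks from connected sets -/

theorem isPreconnected_annulus (x : ℂ) {r r' : ℝ} (hr : 0 ≤ r) :
    IsPreconnected (ball x r' \ closedBall x r) := by
  have : ball x r' \ closedBall x r =
      (fun y : ℝ × ℂ => x + y.1 * y.2) '' (Ioo r r' ×ˢ sphere (0 : ℂ) 1) := by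
    ext z
    simp only [Set.mem_sdiff, mem_ball, mem_closedBall, not_le, mem_image, mem_prod, mem_Ioo,
      Prod.exists, dist_eq_norm, mem_sphere_zero_iff_norm]
    constructor
    · rintro ⟨h1, h2⟩
      have h3 : z - x ≠ 0 := norm_pos_iff.1 (hr.trans_lt h2)
      refine ⟨‖z - x‖, (z - x) / ‖z - x‖, ⟨⟨h2, h1⟩, by simp [h3]⟩, ?_⟩
      rw [mul_div_cancel₀ _ (by simpa using h3)]
      ring
    · rintro ⟨s, u, ⟨⟨h1, h2⟩, hu⟩, rfl⟩
      rw [add_sub_cancel_left, norm_mul, hu, mul_one, Complex.norm_real, Real.norm_eq_abs,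
        abs_of_pos (hr.trans_lt h1)]
      exact ⟨h2, h1⟩
  rw [this]
  refine (isPreconnected_Ioo.prod ?_).image _ (by fun_prop)
  exact (isConnected_sphere (by simp [Complex.rank_real_complex]) _ zero_le_one).isPreconnected

/-- In a separation of the difference, the connected annulus around the removed disk lies on one
side. Adding the disk to that side would separate `V`. -/
theorem IsPreconnected.diff_closedBall {V : Set ℂ} (hV : IsPreconnected V)
    {x : ℂ} {r r' : ℝ} (hr : 0 ≤ r) (hrr : r < r') (hx : ball x r' ⊆ V) :
    IsPreconnected (V \ closedBall x r) := by
  have key : ∀ u v : Set ℂ, IsOpen u → IsOpen v → V \ closedBall x r ⊆ u ∪ v →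
      V \ closedBall x r ∩ (u ∩ v) = ∅ → ball x r' \ closedBall x r ⊆ u →
      V \ closedBall x r ⊆ u := by
    intro u v hu hv huv hd hau
    have hdis : ∀ y ∈ V, y ∉ closedBall x r → y ∈ u → y ∈ v → False := fun y h0 h1 h2 h3 => by
      have : y ∈ V \ closedBall x r ∩ (u ∩ v) := ⟨⟨h0, h1⟩, h2, h3⟩
      rwa [hd] at this
    have hdv : ∀ y ∈ ball x r', y ∉ v \ closedBall x r := fun y hy hyv =>
      hdis y (hx hy) hyv.2 (hau ⟨hy, hyv.2⟩) hyv.1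
    have hcov : V ⊆ (u ∪ ball x r') ∪ (v \ closedBall x r) := fun y hy => by
      by_cases hyb : y ∈ closedBall x r
      · exact Or.inl (Or.inr (closedBall_subset_ball hrr hyb))
      · rcases huv ⟨hy, hyb⟩ with h1 | h1
        · exact Or.inl (Or.inl h1)
        · exact Or.inr ⟨h1, hyb⟩
    have hemp : V ∩ ((u ∪ ball x r') ∩ (v \ closedBall x r)) = ∅ := by
      rw [eq_empty_iff_forall_notMem]
      rintro y ⟨hy, h1 | h1, h2⟩
      · exact hdis y hy h2.2 h1 h2.1
      · exact hdv y h1 h2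
    rcases isPreconnected_iff_subset_of_disjoint.1 hV _ _ (hu.union isOpen_ball)
      (hv.sdiff isClosed_closedBall) hcov hemp with h | h
    · intro y hy
      rcases h hy.1 with h1 | h1
      · exact h1
      · exact hau ⟨h1, hy.2⟩
    · have hxb : x ∈ ball x r' := mem_ball_self (hr.trans_lt hrr)
      exact (hdv x hxb (h (hx hxb))).elim
  rw [isPreconnected_iff_subset_of_disjoint]
  intro u v hu hv huv hd
  have hsub : ball x r' \ closedBall x r ⊆ V \ closedBall x r := sdiff_subset_sdiff_left hx
  rcases isPreconnected_iff_subset_of_disjoint.1 (isPreconnected_annulus x (r' := r') hr) u v hu hv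
    (hsub.trans huv) (subset_eq_empty (inter_subset_inter_left _ hsub) hd) with h | h
  · exact Or.inl (key u v hu hv huv hd h)
  · exact Or.inr (key v u hv hu (by rwa [union_comm]) (by rwa [inter_comm v u]) h)

theorem IsPreconnected.diff_iUnion_closedBall {ι : Type*} {V : Set ℂ} (hV : IsPreconnected V)
    (s : Finset ι) {x : ι → ℂ} {r : ι → ℝ} {η : ℝ} (hη : 0 < η) (hr : ∀ i ∈ s, 0 ≤ r i)
    (hx : ∀ i ∈ s, ball (x i) (r i + η) ⊆ V)
    (hd : ∀ i ∈ s, ∀ j ∈ s, i ≠ j → Disjoint (ball (x i) (r i + η)) (ball (x j) (r j + η))) :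
    IsPreconnected (V \ ⋃ i ∈ s, closedBall (x i) (r i)) := by
  classical
  induction s using Finset.induction_on with
  | empty => simpa using hV
  | insert i s hi ih =>
    have h1 := ih (fun j hj => hr j (Finset.mem_insert_of_mem hj))
      (fun j hj => hx j (Finset.mem_insert_of_mem hj))
      (fun j hj k hk => hd j (Finset.mem_insert_of_mem hj) k (Finset.mem_insert_of_mem hk))
    have h2 := IsPreconnected.diff_closedBall h1 (x := x i) (r := r i) (r' := r i + η)
      (hr i (Finset.mem_insert_self _ _)) (by linarith) (fun y hy =>
        ⟨hx i (Finset.mem_insert_self _ _) hy, fun hy' => by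
          obtain ⟨j, hj, hyj⟩ := mem_iUnion₂.1 hy'
          have hne : i ≠ j := fun h => hi (h ▸ hj)
          exact (Set.disjoint_left.1 (hd i (Finset.mem_insert_self _ _) j
            (Finset.mem_insert_of_mem hj) hne) hy)
              (closedBall_subset_ball (by linarith) hyj)⟩)
    convert h2 using 1
    rw [Finset.set_biUnion_insert, union_comm, sdiff_sdiff]

/-! ### Traps and the basin of attraction -/

/-- `A` is a closed set which absorbs, inside the `k`-th preimage of the escape disk, the images of
a uniform neighbourhood of itself, contains the critical value unless it leaves this preimage,
and whose complement in this preimage is connected. -/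
structure IsTrap (p q : ℕ) (c : ℂ) (R : ℝ) (k : ℕ) (A : Set ℂ) (η : ℝ) : Prop where
  isClosed : IsClosed A
  notMem : c ∉ lev p q c R k \ A
  pos : 0 < η
  absorbs : ∀ z ∈ thickening η A, ∀ w ∈ image p q c z, w ∈ lev p q c R k → w ∈ A
  isPreconnected : IsPreconnected (lev p q c R k \ A)

namespace IsTrap

variable {p q : ℕ} {c : ℂ} {R : ℝ} {k : ℕ} {A : Set ℂ} {η : ℝ}

/-- Preimages of level `k` lie well inside level `k`, and a point close to `A` has no image in level
`k` outside `A`. -/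
theorem exists_isExpandingDomain (h : IsTrap p q c R k A η) (hq : 0 < q) (hp : 0 < p)
    (hR : IsEscapeRadius p q c R) :
    ∃ η', IsExpandingDomain p q c (lev p q c R k \ A) R η' := by
  obtain ⟨η₀, hη₀, hb⟩ := exists_ball_subset_lev hq hp hR k
  have hη := h.pos
  refine ⟨min η₀ η, (isOpen_lev hq hp c R k).sdiff h.isClosed,
    sdiff_subset.trans (lev_subset_ball hR k), h.notMem, lt_min hη₀ hη, fun z w hw hwU y hy => ?_⟩
  refine ⟨hb z ⟨w, hw, hwU.1⟩ (ball_subset_ball (min_le_left _ _) hy), fun hyA => ?_⟩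
  refine hwU.2 (h.absorbs z (mem_thickening_iff.2 ⟨y, hyA, ?_⟩) w hw hwU.1)
  rw [mem_ball, dist_comm] at hy
  exact hy.trans_le (min_le_right _ _)

theorem mem_of_orbit (h : IsTrap p q c R k A η) {z : ℕ → ℂ}
    (hz : IsForwardOrbit (image p q c) z) (hl : ∀ i, z i ∈ lev p q c R k) {i j : ℕ} (hij : i ≤ j)
    (hi : z i ∈ A) : z j ∈ A := by
  induction hij with
  | refl => exact hi
  | step _ ih => exact h.absorbs _ (self_subset_thickening h.pos _ ih) _ (hz _) (hl _)

theorem orbit_mem_lev (hq : 0 < q) (hR : IsEscapeRadius p q c R) {z : ℕ → ℂ}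
    (hz : IsForwardOrbit (image p q c) z) (hb : Bornology.IsBounded (range z)) (k i : ℕ) :
    z i ∈ lev p q c R k :=
  filledJulia_subset_lev hq hR k (mem_filledJulia_of_orbit hz hb i)

/-- A cycle lies in the trap or avoids it. -/
theorem cycle_dichotomy (h : IsTrap p q c R k A η) (hq : 0 < q) (hR : IsEscapeRadius p q c R)
    {z : ℕ → ℂ} {n : ℕ} (hz : IsCycle p q c n z) :
    (∀ i, z i ∈ A) ∨ ∀ i, z i ∈ lev p q c R k \ A := by
  have hl := orbit_mem_lev hq hR hz.1 hz.isBounded k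
  by_cases hA : ∃ i, z i ∈ A
  · obtain ⟨i, hi⟩ := hA
    refine Or.inl fun j => ?_
    have h1 : z (j + i * n) = z j := by
      have := hz.2.2.1.nat_mul i j
      simpa using this
    rw [← h1]
    refine h.mem_of_orbit hz.1 hl ?_ hi
    have := Nat.le_mul_of_pos_right i hz.2.1
    omega
  · push Not at hA
    exact Or.inr fun i => ⟨hl i, hA i⟩

theorem cycle_subset (h : IsTrap p q c R k A η) (hq : 0 < q) (hpq : q < p)
    (hR : IsEscapeRadius p q c R) {z : ℕ → ℂ} {n : ℕ} (hz : IsCycle p q c n z)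
    (h1 : ∏ i ∈ Finset.range n, dil p q (z i) < 1) (i : ℕ) : z i ∈ A := by
  rcases h.cycle_dichotomy hq hR hz with hA | hA
  · exact hA i
  · obtain ⟨η', hE⟩ := h.exists_isExpandingDomain hq (by omega) hR
    exact absurd (hE.one_lt_prod hq hpq hz hA) (by linarith)

theorem dualJulia_subset (h : IsTrap p q c R k A η) (hq : 0 < q) (hpq : q < p)
    (hR : IsEscapeRadius p q c R) : dualJulia p q c ⊆ A := by
  rw [dualJulia_eq hq hpq]
  refine closure_minimal ?_ h.isClosed
  rintro x ⟨n, z, hz, h1, i, rfl⟩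
  exact h.cycle_subset hq hpq hR hz h1 i

/-- The Julia set consists of the starting points of orbits in the compact set `S`, that is, of
bounded orbits that never enter `A`. One inclusion is `mem_julia`. The other holds because `hcyc`
keeps repelling cycles out of `A` and such starting points form a closed set. An orbit in `S`
accumulates away from `A`, hence away from the dual Julia set. Off the Julia set every bounded orbit
enters `A`, where `hlim` applies. -/
theorem basin_eq (h : IsTrap p q c R k A η) (hq : 0 < q) (hpq : q < p)
    (hR : IsEscapeRadius p q c R)
    (hlim : ∀ z : ℕ → ℂ, IsForwardOrbit (image p q c) z → (∀ i, z i ∈ lev p q c R k) → z 0 ∈ A →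
      ∀ (m : ℕ → ℕ) (ζ : ℂ), StrictMono m → Tendsto (fun i => z (m i)) atTop (𝓝 ζ) →
        ζ ∈ dualJulia p q c)
    (hcyc : ∀ n z, IsCycle p q c n z → (∀ i, z i ∈ A) →
      ∏ i ∈ Finset.range n, dil p q (z i) ≤ 1) :
    basin p q c = ((fun x : ℂ => (x : OnePoint ℂ)) '' julia p q c)ᶜ := by
  obtain ⟨η', hE⟩ := h.exists_isExpandingDomain hq (by omega) hR
  set S := closedBall (0 : ℂ) R ∩ (thickening η A)ᶜ with hS
  have hScl : IsClosed S := isClosed_closedBall.inter isOpen_thickening.isClosed_compl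
  have hScomp : IsCompact S := (isCompact_closedBall 0 R).inter_right
    isOpen_thickening.isClosed_compl
  have hSA : ∀ x ∈ S, x ∉ A := fun x hx hxA => hx.2 (self_subset_thickening h.pos _ hxA)
  have hUS : ∀ z : ℕ → ℂ, IsForwardOrbit (image p q c) z → (∀ i, z i ∈ lev p q c R k \ A) →
      ∀ i, z i ∈ S := fun z hz hU i =>
    ⟨ball_subset_closedBall (lev_subset_ball hR k (hU i).1), fun ht =>
      (hU (i + 1)).2 (h.absorbs _ ht _ (hz i) (hU (i + 1)).1)⟩
  have hJ : julia p q c =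
      {x | ∃ z : ℕ → ℂ, z 0 = x ∧ IsForwardOrbit (image p q c) z ∧ ∀ i, z i ∈ S} := by
    apply Subset.antisymm
    · rw [julia_eq hq hpq]
      refine closure_minimal ?_ (isClosed_orbit_starts p q c hScomp)
      rintro x ⟨n, z, hz, h1, i, rfl⟩
      rcases h.cycle_dichotomy hq hR hz with hA | hA
      · exact absurd (hcyc n z hz hA) (by linarith)
      · exact ⟨fun j => z (j + i), by simp, (hz.shift i).1, fun j => hUS z hz.1 hA _⟩
    · rintro x ⟨z, rfl, hz, hzS⟩
      have hb : Bornology.IsBounded (range z) :=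
        hScomp.isBounded.subset (range_subset_iff.2 hzS)
      exact hE.mem_julia hq hpq h.isPreconnected hz fun i =>
        ⟨orbit_mem_lev hq hR hz hb k i, hSA _ (hzS i)⟩
  ext x
  rw [mem_compl_iff, hJ]
  constructor
  · rintro hx ⟨y, ⟨z, rfl, hz, hzS⟩, rfl⟩
    obtain ⟨ζ, hζ, m, hm, hl⟩ := hScomp.tendsto_subseq hzS
    have hb : Bornology.IsBounded (range z) :=
      hScomp.isBounded.subset (range_subset_iff.2 hzS)
    have h1 : (ζ : OnePoint ℂ) ∈ omegaLim p q c (z 0 : OnePoint ℂ) :=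
      ⟨z, rfl, hz, hb, m, hm, (OnePoint.continuous_coe.tendsto ζ).comp hl⟩
    rcases hx h1 with ⟨y, hy, hyζ⟩ | h2
    · rw [OnePoint.coe_eq_coe] at hyζ
      subst hyζ
      exact hSA _ hζ (h.dualJulia_subset hq hpq hR hy)
    · exact OnePoint.coe_ne_infty ζ h2
  · rintro hx ξ ⟨z, rfl, hz, hb, m, hm, hl⟩
    have hlev := orbit_mem_lev hq hR hz hb k
    have hA : ∃ i, z i ∈ A := by
      by_contra! hA
      exact hx ⟨z 0, ⟨z, rfl, hz, hUS z hz fun i => ⟨hlev i, hA i⟩⟩, rfl⟩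
    obtain ⟨i, hi⟩ := hA
    obtain ⟨ζ, -, n, hn, hl'⟩ := tendsto_subseq_of_bounded hb (x := fun j => z (m j))
      fun j => mem_range_self _
    have h1 : Tendsto (fun j => (z (m (n j)) : OnePoint ℂ)) atTop (𝓝 (ζ : OnePoint ℂ)) :=
      (OnePoint.continuous_coe.tendsto ζ).comp hl'
    have h2 : ξ = ζ := tendsto_nhds_unique (hl.comp hn.tendsto_atTop) h1
    refine Or.inl ⟨ζ, ?_, h2.symm⟩
    -- The tail from time `i` on starts in `A`. Passing to the index `j + i` ensures that the
    -- subtraction of `i` is not truncated.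
    have hmn : StrictMono fun j => m (n (j + i)) - i := fun a b hab => by
      have h1 : m (n (a + i)) < m (n (b + i)) := hm (hn (by omega))
      have h2 : a + i ≤ m (n (a + i)) := (hn.le_apply).trans hm.le_apply
      simp only
      omega
    refine hlim (fun j => z (j + i)) (fun j => by simpa [add_right_comm] using hz (j + i))
      (fun j => hlev _) (by simpa using hi) _ ζ hmn ?_
    have h3 := (tendsto_add_atTop_iff_nat i).2 hl'
    refine h3.congr fun j => ?_
    have h2 : j + i ≤ m (n (j + i)) := (hn.le_apply).trans hm.le_apply
    simp only [Function.comp_apply]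
    congr 1
    omega

end IsTrap

/-! ### Parameters outside `M0` -/

theorem critical_value_mem_filledJulia {p q : ℕ} (hq : 0 < q) (hp : 0 < p) {c : ℂ}
    (h : c ∈ filledJulia p q c) : (0 : ℂ) ∈ filledJulia p q c := by
  obtain ⟨z, h0, hz, hb⟩ := h
  refine ⟨fun i => Nat.casesOn i 0 z, rfl, fun i => ?_,
    (hb.union (Bornology.isBounded_singleton (x := (0 : ℂ)))).subset ?_⟩
  · cases i with
    | zero =>
      change (z 0 - c) ^ q = 0 ^ p
      rw [h0, sub_self, zero_pow hq.ne', zero_pow hp.ne']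
    | succ i => exact hz i
  · rintro _ ⟨i, rfl⟩
    cases i with
    | zero => exact Or.inr rfl
    | succ i => exact Or.inl ⟨i, rfl⟩

/-- The first level that omits `c` is connected, as `c` lies in all earlier ones. The empty set is a
trap there, so the dual Julia set is empty. -/
theorem isHyperbolic_of_notMem_M0 {p q : ℕ} (hq : 0 < q) (hpq : q < p) {c : ℂ}
    (hc : c ∉ M0 p q) : IsHyperbolic p q c := by
  classical
  have hp : 0 < p := by omega
  obtain ⟨R, hR⟩ := exists_isEscapeRadius p q hq hpq c
  have hcK : c ∉ filledJulia p q c := fun h => hc (critical_value_mem_filledJulia hq hp h)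
  have hex := exists_notMem_lev hq hR hcK
  have ht : IsTrap p q c R (Nat.find hex) ∅ 1 := by
    refine ⟨isClosed_empty, fun h => Nat.find_spec hex h.1, one_pos, ?_, ?_⟩
    · intro z hz
      simp [thickening_empty] at hz
    · rw [sdiff_empty]
      exact isPreconnected_lev hq hp fun j hj => not_not.1 (Nat.find_min hex hj)
  have hd : dualJulia p q c = ∅ := subset_empty_iff.1 (ht.dualJulia_subset hq hpq hR)
  refine ⟨⟨by simp [hd], by simp [hd], ?_⟩, ht.basin_eq hq hpq hR ?_ ?_⟩
  · refine ⟨∅, fun _ => 1, isOpen_empty, by simp [hd], by simp [ContDiffOn], by simp, 0, by simp, ?_⟩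
    simp [hd]
  · intro z _ _ h
    exact h.elim
  · intro n z _ h
    exact (h 0).elim

/-! ### Periodicity of the critical point is not an open condition -/

/-- Complete `c` to a transcendence basis. Translating the variable `c` by `N` is an automorphism of
the polynomial ring, and it extends to the algebraic closure `ℂ`. -/
theorem exists_ringEquiv_add {c : ℂ} (hc : Transcendental ℚ c) (N : ℕ) :
    ∃ σ : ℂ ≃+* ℂ, σ c = c + N := by
  classical
  have hs : AlgebraicIndepOn ℚ id ({c} : Set ℂ) :=
    (algebraicIndependent_unique_type_iff (ι := ({c} : Set ℂ))).2 hc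
  obtain ⟨t, hst, ht⟩ := exists_isTranscendenceBasis_superset hs
  have hct : c ∈ t := hst rfl
  let i₀ : t := ⟨c, hct⟩
  let v : t → ℂ := fun x => x
  have hv : IsTranscendenceBasis ℚ v := ht
  let shift : ℚ → MvPolynomial t ℚ →ₐ[ℚ] MvPolynomial t ℚ := fun r =>
    MvPolynomial.aeval fun i => if i = i₀ then MvPolynomial.X i + MvPolynomial.C r
      else MvPolynomial.X i
  have hshift : ∀ r, (shift r).comp (shift (-r)) = AlgHom.id _ _ := by
    intro r
    ext i
    by_cases hi : i = i₀ <;> simp [shift, hi]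
  let e₁ : MvPolynomial t ℚ ≃ₐ[ℚ] MvPolynomial t ℚ :=
    AlgEquiv.ofAlgHom (shift N) (shift (-N)) (hshift N) (by simpa using hshift (-N))
  let e : Algebra.adjoin ℚ (range v) ≃+* Algebra.adjoin ℚ (range v) :=
    (hv.1.aevalEquiv.symm.trans (e₁.trans hv.1.aevalEquiv)).toRingEquiv
  have := IsAlgClosed.isAlgClosure_of_transcendence_basis v hv
  let σ : ℂ ≃+* ℂ := IsAlgClosure.equivOfEquiv ℂ ℂ e
  refine ⟨σ, ?_⟩
  let x : Algebra.adjoin ℚ (range v) := hv.1.aevalEquiv (MvPolynomial.X i₀)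
  have hx : algebraMap (Algebra.adjoin ℚ (range v)) ℂ x = c := by
    simp [x, v, i₀]
  have hex : e x = x + N := by
    have : e x = hv.1.aevalEquiv (e₁ (hv.1.aevalEquiv.symm x)) := rfl
    rw [this]
    simp [x, e₁, shift]
  calc σ c = σ (algebraMap _ ℂ x) := by rw [hx]
    _ = algebraMap _ ℂ (e x) := IsAlgClosure.equivOfEquiv_algebraMap ℂ ℂ e x
    _ = c + N := by rw [hex, map_add, hx, map_natCast]

/-- For large parameters the critical point is not periodic. -/
theorem critical_not_periodic {p q : ℕ} (hq : 0 < q) (hpq : q < p) {c : ℂ} (hc : 2 ^ q ≤ ‖c‖)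
    {n : ℕ} (hn : 0 < n) {z : ℕ → ℂ} (h0 : z 0 = 0)
    (hz : ∀ i < n, z (i + 1) ∈ image p q c (z i)) : z n ≠ 0 := by
  have h2 : (1 : ℝ) ≤ 2 ^ q := one_le_pow₀ (by norm_num)
  have key : ∀ i, i + 1 ≤ n → ‖c‖ ≤ ‖z (i + 1)‖ := by
    intro i
    induction i with
    | zero =>
      intro h
      have h1 : (z 1 - c) ^ q = z 0 ^ p := hz 0 (by omega)
      rw [h0, zero_pow (by omega), pow_eq_zero_iff hq.ne', sub_eq_zero] at h1
      rw [zero_add, h1]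
    | succ i ih =>
      intro h
      have h1 := ih (by omega)
      have e : ‖z (i + 1 + 1) - c‖ ^ q = ‖z (i + 1)‖ ^ p := by
        rw [← norm_pow, ← norm_pow]; exact congrArg norm (hz (i + 1) (by omega))
      have h3 : (2 * ‖z (i + 1)‖) ^ q ≤ ‖z (i + 1 + 1) - c‖ ^ q := by
        rw [e, mul_pow]
        calc 2 ^ q * ‖z (i + 1)‖ ^ q ≤ ‖z (i + 1)‖ * ‖z (i + 1)‖ ^ q := by
              gcongr; exact hc.trans h1
          _ = ‖z (i + 1)‖ ^ (q + 1) := by ring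
          _ ≤ ‖z (i + 1)‖ ^ p := pow_le_pow_right₀ (by linarith) hpq
      have h4 := le_of_pow_le_pow_left₀ hq.ne' (norm_nonneg _) h3
      have h5 := norm_sub_le (z (i + 1 + 1)) c
      linarith
  obtain ⟨m, rfl⟩ := Nat.exists_eq_succ_of_ne_zero hn.ne'
  have := key m le_rfl
  rw [← norm_pos_iff]
  exact lt_of_lt_of_le (by linarith) this

/-- Parameters for which the critical point is periodic of period `n` have empty interior. -/
theorem exists_not_periodic {p q : ℕ} (hq : 0 < q) (hpq : q < p) {n : ℕ} (hn : 0 < n) (a : ℂ)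
    {ε : ℝ} (hε : 0 < ε) :
    ∃ c ∈ ball a ε, ∀ z : ℕ → ℂ, z 0 = 0 → (∀ i < n, z (i + 1) ∈ image p q c (z i)) → z n ≠ 0 := by
  have h1 : ¬ (ball a ε).Countable := fun h => by
    have h2 := h.dense_compl ℝ
    obtain ⟨y, hy, hy'⟩ := h2.inter_open_nonempty _ isOpen_ball ⟨a, mem_ball_self hε⟩
    exact hy' hy
  -- Any transcendental `c` works: an automorphism would carry a periodic orbit of `0` for `c` to
  -- one for `c + N`, with `N` as large as desired.
  obtain ⟨c, hcb, hc⟩ : ∃ c ∈ ball a ε, Transcendental ℚ c := by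
    by_contra! h
    exact h1 ((Algebraic.countable ℚ ℂ).mono fun c hc => not_not.1 (h c hc))
  refine ⟨c, hcb, fun z h0 hz hzn => ?_⟩
  obtain ⟨N, hN⟩ := exists_nat_gt (2 ^ q + ‖c‖)
  obtain ⟨σ, hσ⟩ := exists_ringEquiv_add hc N
  refine critical_not_periodic hq hpq (c := c + N) ?_ hn (z := fun i => σ (z i)) ?_
    (fun i hi => ?_) ?_
  · have := norm_sub_le (c + N) c
    rw [add_sub_cancel_left, Complex.norm_natCast] at this
    linarith
  · simp [h0]
  · have h3 : (z (i + 1) - c) ^ q = z i ^ p := hz i hi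
    have h4 := congrArg σ h3
    rw [map_pow, map_pow, map_sub, hσ] at h4
    exact h4
  · simp [hzn]

/-! ### Trapping disks along the orbit of the critical value -/

theorem image_nonempty {p q : ℕ} (hq : 0 < q) (c z : ℂ) : (image p q c z).Nonempty := by
  obtain ⟨u, hu⟩ := IsAlgClosed.exists_pow_nat_eq (z ^ p) hq
  exact ⟨c + u, by change (c + u - c) ^ q = z ^ p; rw [add_sub_cancel_left, hu]⟩

theorem exists_orbit_of_invariant {F : ℂ → Set ℂ} {A : Set ℂ} (h : ∀ x ∈ A, ∃ w ∈ F x, w ∈ A)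
    {x : ℂ} (hx : x ∈ A) : ∃ z : ℕ → ℂ, z 0 = x ∧ IsForwardOrbit F z ∧ ∀ i, z i ∈ A := by
  choose! f hf hfA using h
  have hA : ∀ i, f^[i] x ∈ A := fun i => by
    induction i with
    | zero => exact hx
    | succ i ih => rw [Function.iterate_succ_apply']; exact hfA _ ih
  refine ⟨fun i => f^[i] x, rfl, fun i => ?_, hA⟩
  change f^[i + 1] x ∈ F (f^[i] x)
  rw [Function.iterate_succ_apply']
  exact hf _ (hA i)

theorem subset_filledJulia {p q : ℕ} {c : ℂ} {A : Set ℂ} (hA : Bornology.IsBounded A)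
    (h : ∀ x ∈ A, ∃ w ∈ image p q c x, w ∈ A) : A ⊆ filledJulia p q c := fun x hx => by
  obtain ⟨z, h0, hz, hzA⟩ := exists_orbit_of_invariant h hx
  exact ⟨z, h0, hz, hA.subset (range_subset_iff.2 hzA)⟩

/-- Univalent branches `φ j`, `j < N`, on disks of radius `s` about the points `v j`, `j ≤ N`, of
which the last one is the critical point, such that all other images of these disks leave the `k`-th
preimage of the escape disk. -/
structure LocalModel (p q : ℕ) (c : ℂ) (R : ℝ) (k N : ℕ) (v : ℕ → ℂ) (s L : ℝ)
    (φ : ℕ → ℂ → ℂ) : Prop where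
  hq : 0 < q
  hpq : q < p
  esc : IsEscapeRadius p q c R
  one_le : 1 ≤ L
  last : v N = 0
  disj : ∀ i ≤ N, ∀ j ≤ N, i ≠ j → Disjoint (ball (v i) s) (ball (v j) s)
  lip : ∀ j < N, ∀ x ∈ ball (v j) s, ∀ y ∈ ball (v j) s, ‖φ j x - φ j y‖ ≤ L * ‖x - y‖
  uniq : ∀ j < N, ∀ z ∈ ball (v j) s, ∀ w ∈ image p q c z, w ∈ lev p q c R k → w = φ j z
  mem : ∀ j < N, ∀ z, φ j z ∈ image p q c z
  dil_le : ∀ j < N, ∀ z ∈ ball (v j) s, dil p q z ≤ L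

/-- The images of the critical value under the branches `φ j`. -/
def cent (c : ℂ) (φ : ℕ → ℂ → ℂ) : ℕ → ℂ
  | 0 => c
  | j + 1 => φ j (cent c φ j)

/-- Radii of trapping disks. -/
noncomputable def rad (p q : ℕ) (L t : ℝ) (j : ℕ) : ℝ := (2 * L) ^ j * (2 * t) ^ ((p : ℝ) / q)

/-- Trapping disks. -/
noncomputable def disk (p q : ℕ) (c : ℂ) (φ : ℕ → ℂ → ℂ) (L t : ℝ) (j : ℕ) : Set ℂ :=
  closedBall (cent c φ j) (rad p q L t j)

/-- The union of the trapping disks. -/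
noncomputable def trap (p q : ℕ) (c : ℂ) (φ : ℕ → ℂ → ℂ) (N : ℕ) (L t : ℝ) : Set ℂ :=
  ⋃ j ∈ Finset.range (N + 1), disk p q c φ L t j

/-- Sizes for which the disks form a trap. -/
structure Admissible (p q : ℕ) (c : ℂ) (N : ℕ) (v : ℕ → ℂ) (s L : ℝ) (φ : ℕ → ℂ → ℂ) (t : ℝ) :
    Prop where
  pos : 0 < t
  le : ‖cent c φ N‖ + rad p q L t N ≤ t
  subset : ∀ j ≤ N, ball (cent c φ j) (2 * rad p q L t j) ⊆ ball (v j) s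

theorem mem_trap {p q : ℕ} {c : ℂ} {φ : ℕ → ℂ → ℂ} {N : ℕ} {L t : ℝ} {z : ℂ} :
    z ∈ trap p q c φ N L t ↔ ∃ j ≤ N, z ∈ disk p q c φ L t j := by
  simp [trap]

theorem isClosed_trap (p q : ℕ) (c : ℂ) (φ : ℕ → ℂ → ℂ) (N : ℕ) (L t : ℝ) :
    IsClosed (trap p q c φ N L t) :=
  (Finset.range (N + 1)).finite_toSet.isClosed_biUnion fun _ _ => isClosed_closedBall

theorem isBounded_trap (p q : ℕ) (c : ℂ) (φ : ℕ → ℂ → ℂ) (N : ℕ) (L t : ℝ) :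
    Bornology.IsBounded (trap p q c φ N L t) :=
  (Bornology.isBounded_biUnion_finset _).2 fun _ _ => isBounded_closedBall

namespace LocalModel

variable {p q : ℕ} {c : ℂ} {R : ℝ} {k N : ℕ} {v : ℕ → ℂ} {s L t : ℝ} {φ : ℕ → ℂ → ℂ}

theorem rad_zero_le (h : LocalModel p q c R k N v s L φ) (ht : 0 < t) (j : ℕ) :
    (2 * t) ^ ((p : ℝ) / q) ≤ rad p q L t j := by
  have := h.one_le
  exact le_mul_of_one_le_left (by positivity) (one_le_pow₀ (by linarith))

theorem rad_pos (h : LocalModel p q c R k N v s L φ) (ht : 0 < t) (j : ℕ) :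
    0 < rad p q L t j :=
  lt_of_lt_of_le (by positivity) (h.rad_zero_le ht j)

theorem disk_subset (h : LocalModel p q c R k N v s L φ)
    (ht : Admissible p q c N v s L φ t) {j : ℕ} (hj : j ≤ N) :
    disk p q c φ L t j ⊆ ball (v j) s :=
  (closedBall_subset_ball (by linarith [h.rad_pos ht.pos j])).trans (ht.subset j hj)

theorem disk_last_subset (ht : Admissible p q c N v s L φ t) {z : ℂ}
    (hz : z ∈ disk p q c φ L t N) : ‖z‖ ≤ t := by
  rw [disk, mem_closedBall, dist_eq_norm] at hz
  have := norm_sub_norm_le z (cent c φ N)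
  linarith [ht.le]

theorem index_eq (h : LocalModel p q c R k N v s L φ) {i j : ℕ} (hi : i ≤ N) (hj : j ≤ N)
    {z : ℂ} (hzi : z ∈ ball (v i) s) (hzj : z ∈ ball (v j) s) : i = j := by
  by_contra hne
  exact Set.disjoint_left.1 (h.disj i hi j hj hne) hzi hzj

theorem rad_succ (j : ℕ) : rad p q L t (j + 1) = 2 * L * rad p q L t j := by
  unfold rad; ring

/-- A neighbourhood of the `j`-th disk is mapped into the next disk. -/
theorem step_mem (h : LocalModel p q c R k N v s L φ) (ht : Admissible p q c N v s L φ t) {j : ℕ}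
    (hj : j ≤ N) {z w : ℂ}
    (hz : z ∈ ball (cent c φ j) (rad p q L t j + min t ((2 * t) ^ ((p : ℝ) / q))))
    (hw : w ∈ image p q c z) (hwl : w ∈ lev p q c R k) :
    w ∈ disk p q c φ L t ((j + 1) % (N + 1)) := by
  have hr := h.rad_zero_le ht.pos j
  have hrp := h.rad_pos ht.pos j
  have hL := h.one_le
  -- The `2` in `(2 * L) ^ j` pays for doubling the `j`-th disk before applying an `L`-Lipschitz
  -- branch. The `2` in `2 * t` pays for enlarging by `t` the last disk, which lies in the `t`-disk
  -- about `0`.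
  rcases hj.lt_or_eq with hj' | rfl
  · rw [Nat.mod_eq_of_lt (by omega)]
    have hz2 : z ∈ ball (cent c φ j) (2 * rad p q L t j) :=
      ball_subset_ball (by linarith [min_le_right t ((2 * t) ^ ((p : ℝ) / q))]) hz
    have hzs := ht.subset j hj hz2
    rw [h.uniq j hj' z hzs w hw hwl, disk, cent, rad_succ, mem_closedBall, dist_eq_norm]
    refine (h.lip j hj' z hzs _ (ht.subset j hj (mem_ball_self (by linarith)))).trans ?_
    rw [mem_ball, dist_eq_norm] at hz2
    nlinarith
  · rw [Nat.mod_self, disk, cent, mem_closedBall, dist_eq_norm, norm_sub_of_mem_image h.hq hw, rad,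
      pow_zero, one_mul]
    rw [mem_ball, dist_eq_norm] at hz
    have h1 := norm_sub_norm_le z (cent c φ j)
    have h2 := ht.le
    refine Real.rpow_le_rpow (norm_nonneg _) ?_ (by positivity)
    linarith [min_le_left t ((2 * t) ^ ((p : ℝ) / q))]

theorem step_mem' (h : LocalModel p q c R k N v s L φ) (ht : Admissible p q c N v s L φ t) {j : ℕ}
    (hj : j ≤ N) {z w : ℂ} (hz : z ∈ disk p q c φ L t j)
    (hw : w ∈ image p q c z) (hwl : w ∈ lev p q c R k) :
    w ∈ disk p q c φ L t ((j + 1) % (N + 1)) := by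
  have := ht.pos
  refine h.step_mem ht hj (closedBall_subset_ball ?_ hz) hw hwl
  have : 0 < min t ((2 * t) ^ ((p : ℝ) / q)) := by positivity
  linarith

/-- Every point near the `j`-th disk has an image in the next disk. -/
theorem exists_step (h : LocalModel p q c R k N v s L φ) (ht : Admissible p q c N v s L φ t) {j : ℕ}
    (hj : j ≤ N) {z : ℂ}
    (hz : z ∈ ball (cent c φ j) (rad p q L t j + min t ((2 * t) ^ ((p : ℝ) / q)))) :
    ∃ w ∈ image p q c z, w ∈ trap p q c φ N L t := by
  have hr := h.rad_zero_le ht.pos j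
  have hrp := h.rad_pos ht.pos j
  have hL := h.one_le
  rcases hj.lt_or_eq with hj' | rfl
  · refine ⟨φ j z, h.mem j hj' z, mem_trap.2 ⟨j + 1, hj', ?_⟩⟩
    have hz2 : z ∈ ball (cent c φ j) (2 * rad p q L t j) :=
      ball_subset_ball (by linarith [min_le_right t ((2 * t) ^ ((p : ℝ) / q))]) hz
    have hzs := ht.subset j hj hz2
    rw [disk, cent, rad_succ, mem_closedBall, dist_eq_norm]
    refine (h.lip j hj' z hzs _ (ht.subset j hj (mem_ball_self (by linarith)))).trans ?_
    rw [mem_ball, dist_eq_norm] at hz2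
    nlinarith
  · obtain ⟨w, hw⟩ := image_nonempty h.hq c z (p := p)
    refine ⟨w, hw, mem_trap.2 ⟨0, Nat.zero_le _, ?_⟩⟩
    rw [disk, cent, mem_closedBall, dist_eq_norm, norm_sub_of_mem_image h.hq hw, rad,
      pow_zero, one_mul]
    rw [mem_ball, dist_eq_norm] at hz
    have h1 := norm_sub_norm_le z (cent c φ j)
    have h2 := ht.le
    refine Real.rpow_le_rpow (norm_nonneg _) ?_ (by positivity)
    linarith [min_le_left t ((2 * t) ^ ((p : ℝ) / q))]

theorem exists_step' (h : LocalModel p q c R k N v s L φ) (ht : Admissible p q c N v s L φ t)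
    {z : ℂ} (hz : z ∈ trap p q c φ N L t) : ∃ w ∈ image p q c z, w ∈ trap p q c φ N L t := by
  obtain ⟨j, hj, hzj⟩ := mem_trap.1 hz
  have := ht.pos
  refine h.exists_step ht hj (closedBall_subset_ball ?_ hzj)
  have : 0 < min t ((2 * t) ^ ((p : ℝ) / q)) := by positivity
  linarith

theorem trap_subset (h : LocalModel p q c R k N v s L φ) (ht : Admissible p q c N v s L φ t) :
    trap p q c φ N L t ⊆ filledJulia p q c :=
  subset_filledJulia (isBounded_trap _ _ _ _ _ _ _) fun _ hx => h.exists_step' ht hx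

theorem mem_filledJulia_of_image {p q : ℕ} {c z w : ℂ} (hw : w ∈ image p q c z)
    (hwK : w ∈ filledJulia p q c) : z ∈ filledJulia p q c := by
  obtain ⟨u, rfl, hu, hb⟩ := hwK
  refine ⟨fun i => Nat.casesOn i z u, rfl, fun i => ?_,
    (hb.union (Bornology.isBounded_singleton (x := z))).subset ?_⟩
  · cases i with
    | zero => exact hw
    | succ i => exact hu i
  · rintro _ ⟨i, rfl⟩
    cases i with
    | zero => exact Or.inr rfl
    | succ i => exact Or.inl ⟨i, rfl⟩

theorem critical_value_mem (h : LocalModel p q c R k N v s L φ)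
    (ht : Admissible p q c N v s L φ t) : c ∈ trap p q c φ N L t :=
  mem_trap.2 ⟨0, Nat.zero_le _, mem_closedBall_self (h.rad_pos ht.pos 0).le⟩

/-- The trap lies in the filled Julia set and contains `c`, so all levels contain `c` and are
connected. Slightly larger disks are still disjoint and inside level `k`, so removing the trap keeps
level `k` connected. -/
theorem isTrap (h : LocalModel p q c R k N v s L φ) (ht : Admissible p q c N v s L φ t) :
    IsTrap p q c R k (trap p q c φ N L t) (min t ((2 * t) ^ ((p : ℝ) / q))) := by
  have htp := ht.pos
  have hη : 0 < min t ((2 * t) ^ ((p : ℝ) / q)) := by positivity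
  have hcK := h.trap_subset ht (h.critical_value_mem ht)
  refine ⟨isClosed_trap _ _ _ _ _ _ _, fun hc => hc.2 (h.critical_value_mem ht), hη, ?_, ?_⟩
  · intro z hz w hw hwl
    obtain ⟨y, hy, hzy⟩ := mem_thickening_iff.1 hz
    obtain ⟨j, hj, hyj⟩ := mem_trap.1 hy
    refine mem_trap.2 ⟨_, Nat.lt_succ_iff.1 (Nat.mod_lt _ N.succ_pos),
      h.step_mem ht hj ?_ hw hwl⟩
    rw [disk, mem_closedBall] at hyj
    rw [mem_ball]
    linarith [dist_triangle z y (cent c φ j)]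
  · refine IsPreconnected.diff_iUnion_closedBall (isPreconnected_lev h.hq (by have := h.hpq; omega)
      fun j _ => filledJulia_subset_lev h.hq h.esc j hcK) _ hη
      (fun j _ => (h.rad_pos htp j).le) (fun j hj z hz => ?_) (fun i hi j hj hne => ?_)
    · have hj' : j ≤ N := by simpa [Nat.lt_succ_iff] using hj
      obtain ⟨w, hw, hwt⟩ := h.exists_step ht hj' hz
      exact filledJulia_subset_lev h.hq h.esc k
        (mem_filledJulia_of_image hw (h.trap_subset ht hwt))
    · have hsub : ∀ j ≤ N, ball (cent c φ j) (rad p q L t j + min t ((2 * t) ^ ((p : ℝ) / q))) ⊆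
          ball (v j) s := fun j hj => (ball_subset_ball (by
            linarith [min_le_right t ((2 * t) ^ ((p : ℝ) / q)), h.rad_zero_le htp j])).trans
              (ht.subset j hj)
      have hi' : i ≤ N := by simpa [Nat.lt_succ_iff] using hi
      have hj' : j ≤ N := by simpa [Nat.lt_succ_iff] using hj
      exact (h.disj i hi' j hj' hne).mono (hsub i hi') (hsub j hj')

theorem orbit_mem_disk (h : LocalModel p q c R k N v s L φ) (ht : Admissible p q c N v s L φ t)
    {z : ℕ → ℂ} (hz : IsForwardOrbit (image p q c) z) (hl : ∀ i, z i ∈ lev p q c R k) {i j : ℕ}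
    (hj : j ≤ N) (hi : z i ∈ disk p q c φ L t j) (m : ℕ) :
    z (i + m) ∈ disk p q c φ L t ((j + m) % (N + 1)) := by
  induction m with
  | zero => simpa [Nat.mod_eq_of_lt (Nat.lt_succ_iff.2 hj)] using hi
  | succ m ih =>
    have := h.step_mem' ht (Nat.lt_succ_iff.1 (Nat.mod_lt _ N.succ_pos)) ih (hz _) (hl _)
    rwa [Nat.mod_add_mod] at this

theorem exists_mem_last (h : LocalModel p q c R k N v s L φ) (ht : Admissible p q c N v s L φ t)
    {z : ℕ → ℂ} (hz : IsForwardOrbit (image p q c) z) (hl : ∀ i, z i ∈ lev p q c R k)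
    (h0 : z 0 ∈ trap p q c φ N L t) : ∃ i, z i ∈ disk p q c φ L t N := by
  obtain ⟨j, hj, hzj⟩ := mem_trap.1 h0
  refine ⟨0 + (N - j), ?_⟩
  have := h.orbit_mem_disk ht hz hl hj hzj (N - j)
  rwa [Nat.add_sub_cancel' hj, Nat.mod_eq_of_lt (Nat.lt_succ_self _)] at this

/-- The first return to the last disk. -/
theorem norm_return_sub_le (h : LocalModel p q c R k N v s L φ)
    (ht : Admissible p q c N v s L φ t) {z : ℕ → ℂ} (hz : IsForwardOrbit (image p q c) z)
    (hl : ∀ i, z i ∈ lev p q c R k) {i : ℕ} (hi : z i ∈ disk p q c φ L t N) {j : ℕ} (hj : j ≤ N) :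
    ‖z (i + 1 + j) - cent c φ j‖ ≤ L ^ j * ‖z i‖ ^ ((p : ℝ) / q) := by
  induction j with
  | zero =>
    rw [cent, pow_zero, one_mul]
    exact (norm_sub_of_mem_image h.hq (hz i)).le
  | succ j ih =>
    have hL := h.one_le
    have h1 := ih (by omega)
    have h2 := h.orbit_mem_disk ht hz hl le_rfl hi (1 + j)
    rw [show N + (1 + j) = j + (N + 1) by ring, Nat.add_mod_right, Nat.mod_eq_of_lt (by omega),
      ← add_assoc] at h2
    have hs := h.disk_subset ht (j := j) (by omega)
    rw [show i + 1 + (j + 1) = i + 1 + j + 1 by ring,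
      h.uniq j (by omega) _ (hs h2) _ (hz _) (hl _), cent]
    refine (h.lip j (by omega) _ (hs h2) _ (hs (mem_closedBall_self (h.rad_pos ht.pos j).le))).trans ?_
    rw [pow_succ']
    calc _ ≤ L * (L ^ j * ‖z i‖ ^ ((p : ℝ) / q)) := by gcongr
      _ = _ := by ring

/-- A return to the last disk differs from `cent c φ N` by at most `L ^ N * ‖z‖ ^ β`. This is
superlinear in `‖z‖`, and `rad p q L t N ≤ t` bounds it by `‖z‖ / 2` on the `t`-disk. Iterated
returns thus come down to size about `2 * ‖cent c φ N‖`. -/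
theorem norm_return_le (h : LocalModel p q c R k N v s L φ)
    (ht : Admissible p q c N v s L φ t) {z : ℕ → ℂ} (hz : IsForwardOrbit (image p q c) z)
    (hl : ∀ i, z i ∈ lev p q c R k) {i : ℕ} (hi : z i ∈ disk p q c φ L t N) :
    ‖z (i + 1 + N)‖ ≤ ‖cent c φ N‖ + ‖z i‖ / 2 := by
  have hL := h.one_le
  have htp := ht.pos
  have hb := ratio_gt_one h.hq h.hpq
  have h1 := h.norm_return_sub_le ht hz hl hi le_rfl
  have h2 := norm_sub_norm_le (z (i + 1 + N)) (cent c φ N)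
  have h3 : ‖z i‖ ≤ t := disk_last_subset ht hi
  have h4 : L ^ N * ‖z i‖ ^ ((p : ℝ) / q) ≤ ‖z i‖ / 2 := by
    have e1 : rad p q L t N ≤ t := by linarith [ht.le, norm_nonneg (cent c φ N)]
    have e2 : ‖z i‖ ^ ((p : ℝ) / q) ≤ t ^ ((p : ℝ) / q) * (‖z i‖ / t) := by
      have e3 : (‖z i‖ / t) ^ ((p : ℝ) / q) ≤ ‖z i‖ / t :=
        Real.rpow_le_self_of_le_one (by positivity) ((div_le_one htp).2 h3) hb.le
      calc ‖z i‖ ^ ((p : ℝ) / q) = (t * (‖z i‖ / t)) ^ ((p : ℝ) / q) := by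
            rw [mul_div_cancel₀ _ htp.ne']
        _ = t ^ ((p : ℝ) / q) * (‖z i‖ / t) ^ ((p : ℝ) / q) :=
            Real.mul_rpow htp.le (by positivity)
        _ ≤ _ := by gcongr
    have e4 : 2 * (L ^ N * t ^ ((p : ℝ) / q)) ≤ t := by
      refine le_trans ?_ e1
      rw [rad, mul_pow, Real.mul_rpow zero_le_two htp.le]
      have e5 : (2 : ℝ) ≤ 2 ^ ((p : ℝ) / q) := by
        have := Real.rpow_le_rpow_of_exponent_le (x := 2) one_le_two hb.le
        rwa [Real.rpow_one] at this
      have e6 : (1 : ℝ) ≤ 2 ^ N := one_le_pow₀ one_le_two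
      calc 2 * (L ^ N * t ^ ((p : ℝ) / q)) = 1 * L ^ N * (2 * t ^ ((p : ℝ) / q)) := by ring
        _ ≤ _ := by gcongr
    calc L ^ N * ‖z i‖ ^ ((p : ℝ) / q) ≤ L ^ N * (t ^ ((p : ℝ) / q) * (‖z i‖ / t)) := by gcongr
      _ = (2 * (L ^ N * t ^ ((p : ℝ) / q))) * (‖z i‖ / t) / 2 := by ring
      _ ≤ t * (‖z i‖ / t) / 2 := by gcongr
      _ = ‖z i‖ / 2 := by rw [mul_div_cancel₀ _ htp.ne']
  linarith

/-- Orbits in a large trap enter every smaller trap. -/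
theorem exists_mem_smaller (h : LocalModel p q c R k N v s L φ)
    (ht : Admissible p q c N v s L φ t) {t' : ℝ} (ht' : Admissible p q c N v s L φ t')
    (hb : 2 * ‖cent c φ N‖ < t') {z : ℕ → ℂ} (hz : IsForwardOrbit (image p q c) z)
    (hl : ∀ i, z i ∈ lev p q c R k) (h0 : z 0 ∈ trap p q c φ N L t) :
    ∃ i, z i ∈ trap p q c φ N L t' := by
  obtain ⟨i, hi⟩ := h.exists_mem_last ht hz hl h0
  have hmem : ∀ m, z (i + m * (N + 1)) ∈ disk p q c φ L t N := fun m => by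
    have := h.orbit_mem_disk ht hz hl le_rfl hi (m * (N + 1))
    rwa [Nat.add_mul_mod_self_right, Nat.mod_eq_of_lt (Nat.lt_succ_self _)] at this
  have hle : ∀ m, ‖z (i + m * (N + 1))‖ ≤ 2 * ‖cent c φ N‖ + t * (1 / 2) ^ m := by
    intro m
    induction m with
    | zero => simpa using (disk_last_subset ht hi).trans (by linarith [norm_nonneg (cent c φ N)])
    | succ m ih =>
      have := h.norm_return_le ht hz hl (hmem m)
      rw [show i + (m + 1) * (N + 1) = i + m * (N + 1) + 1 + N by ring, pow_succ]
      linarith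
  have hlim : Tendsto (fun m : ℕ => 2 * ‖cent c φ N‖ + t * (1 / 2) ^ m) atTop
      (𝓝 (2 * ‖cent c φ N‖ + t * 0)) :=
    ((tendsto_pow_atTop_nhds_zero_of_lt_one (by norm_num) (by norm_num)).const_mul t).const_add _
  rw [mul_zero, add_zero] at hlim
  obtain ⟨m, hm⟩ := (hlim.eventually (gt_mem_nhds hb)).exists
  refine ⟨i + m * (N + 1) + 1, mem_trap.2 ⟨0, Nat.zero_le _, ?_⟩⟩
  have htp := ht'.pos
  rw [disk, cent, mem_closedBall, dist_eq_norm, norm_sub_of_mem_image h.hq (hz _), rad, pow_zero,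
    one_mul]
  exact Real.rpow_le_rpow (norm_nonneg _) (by linarith [hle m]) (by positivity)

end LocalModel

/-! ### The contracting density and the superattracting case -/

/-- A locally constant density on the disks of radius `s` about the points `v j`. -/
noncomputable def density (N : ℕ) (v : ℕ → ℂ) (s L : ℝ) (z : ℂ) : ℝ :=
  ∑ j ∈ Finset.range (N + 1), (ball (v j) s).indicator (fun _ => (2 * L)⁻¹ ^ j) z

theorem dualJulia_subset_filledJulia {p q : ℕ} (hq : 0 < q) (hpq : q < p) (c : ℂ) :
    dualJulia p q c ⊆ filledJulia p q c := by
  refine closure_minimal ?_ (isClosed_filledJulia hq hpq c)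
  rintro x ⟨n, z, μ, hz, -, -, i, rfl⟩
  exact mem_filledJulia_of_orbit hz.1 hz.isBounded i

namespace LocalModel

variable {p q : ℕ} {c : ℂ} {R : ℝ} {k N : ℕ} {v : ℕ → ℂ} {s L t : ℝ} {φ : ℕ → ℂ → ℂ}

theorem density_eq (h : LocalModel p q c R k N v s L φ) {j : ℕ} (hj : j ≤ N) {z : ℂ}
    (hz : z ∈ ball (v j) s) : density N v s L z = (2 * L)⁻¹ ^ j := by
  rw [density, Finset.sum_eq_single j]
  · rw [indicator_of_mem hz]
  · intro i hi hne
    refine indicator_of_notMem (fun hzi => hne (h.index_eq ?_ hj hzi hz)) _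
    simpa [Nat.lt_succ_iff] using hi
  · intro hj'
    exact absurd (Finset.mem_range.2 (Nat.lt_succ_iff.2 hj)) hj'

/-- From one disk to the next the density drops by `2 * L`, while the derivative is at most `L`.
From the last disk back to the first the density jumps up to `1`, and the small derivative near `0`,
given by `hd`, compensates. -/
theorem density_step (h : LocalModel p q c R k N v s L φ) (ht : Admissible p q c N v s L φ t)
    (hd : ∀ z, ‖z‖ ≤ t → dil p q z ≤ 1 / 2 * (2 * L)⁻¹ ^ N) {z w : ℂ}
    (hz : z ∈ trap p q c φ N L t) (hw : w ∈ image p q c z) (hwl : w ∈ lev p q c R k) :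
    density N v s L w * dil p q z ≤ 1 / 2 * density N v s L z := by
  obtain ⟨j, hj, hzj⟩ := mem_trap.1 hz
  have hL := h.one_le
  have hwj := h.step_mem' ht hj hzj hw hwl
  have hj' : (j + 1) % (N + 1) ≤ N := Nat.lt_succ_iff.1 (Nat.mod_lt _ N.succ_pos)
  rw [h.density_eq hj (h.disk_subset ht hj hzj), h.density_eq hj' (h.disk_subset ht hj' hwj)]
  rcases hj.lt_or_eq with hlt | rfl
  · rw [Nat.mod_eq_of_lt (by omega), pow_succ]
    have := h.dil_le j hlt z (h.disk_subset ht hj hzj)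
    calc (2 * L)⁻¹ ^ j * (2 * L)⁻¹ * dil p q z ≤ (2 * L)⁻¹ ^ j * (2 * L)⁻¹ * L := by gcongr
      _ = 1 / 2 * (2 * L)⁻¹ ^ j := by field_simp
  · rw [Nat.mod_self, pow_zero, one_mul]
    exact hd z (disk_last_subset ht hzj)

theorem density_pos (h : LocalModel p q c R k N v s L φ) {j : ℕ} (hj : j ≤ N) {z : ℂ}
    (hz : z ∈ ball (v j) s) : 0 < density N v s L z := by
  have hL := h.one_le
  rw [h.density_eq hj hz]
  positivity

theorem supportsAttractingMetric (h : LocalModel p q c R k N v s L φ)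
    (ht : Admissible p q c N v s L φ t)
    (hd : ∀ z, ‖z‖ ≤ t → dil p q z ≤ 1 / 2 * (2 * L)⁻¹ ^ N) : SupportsAttractingMetric p q c := by
  have hsub := (h.isTrap ht).dualJulia_subset h.hq h.hpq h.esc
  have hex : ∀ z ∈ ⋃ j ∈ Finset.range (N + 1), ball (v j) s, ∃ j ≤ N, z ∈ ball (v j) s := by
    intro z hz
    simpa [Nat.lt_succ_iff] using hz
  have hV : trap p q c φ N L t ⊆ ⋃ j ∈ Finset.range (N + 1), ball (v j) s := by
    intro z hz
    obtain ⟨j, hj, hzj⟩ := mem_trap.1 hz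
    exact mem_biUnion (Finset.mem_coe.2 (Finset.mem_range.2 (Nat.lt_succ_iff.2 hj)))
      (h.disk_subset ht hj hzj)
  refine ⟨⋃ j ∈ Finset.range (N + 1), ball (v j) s, density N v s L,
    isOpen_biUnion fun _ _ => isOpen_ball, hsub.trans hV, ?_, ?_, 1 / 2, by norm_num, ?_⟩
  · intro z hz
    obtain ⟨j, hj, hzj⟩ := hex z hz
    refine ContDiffAt.contDiffWithinAt ?_
    refine (contDiffAt_const (c := (2 * L)⁻¹ ^ j)).congr_of_eventuallyEq ?_
    filter_upwards [isOpen_ball.mem_nhds hzj] with y hy using h.density_eq hj hy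
  · intro z hz
    obtain ⟨j, hj, hzj⟩ := hex z hz
    exact h.density_pos hj hzj
  · intro z hz U ψ ⟨hU, _, hdiff, _, hm⟩ hzU hψ
    obtain ⟨j, hj, hzj⟩ := hex z (hV (hsub hz))
    rw [norm_deriv_branch h.hq h.hpq hU hdiff hm hzU, div_le_iff₀ (h.density_pos hj hzj)]
    exact h.density_step ht hd (hsub hz) (hm z hzU) (filledJulia_subset_lev h.hq h.esc k
      (dualJulia_subset_filledJulia h.hq h.hpq c hψ))

/-- Cycles in the trap are attracting. -/
theorem prod_lt_one (h : LocalModel p q c R k N v s L φ) (ht : Admissible p q c N v s L φ t)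
    (hd : ∀ z, ‖z‖ ≤ t → dil p q z ≤ 1 / 2 * (2 * L)⁻¹ ^ N) {z : ℕ → ℂ} {n : ℕ}
    (hz : IsCycle p q c n z) (hzt : ∀ i, z i ∈ trap p q c φ N L t) :
    ∏ i ∈ Finset.range n, dil p q (z i) < 1 := by
  have hl := IsTrap.orbit_mem_lev h.hq h.esc hz.1 hz.isBounded k
  have key : ∀ n, density N v s L (z n) * ∏ i ∈ Finset.range n, dil p q (z i) ≤
      (1 / 2) ^ n * density N v s L (z 0) := by
    intro n
    induction n with
    | zero => simp
    | succ n ih =>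
      rw [Finset.prod_range_succ]
      have h1 := h.density_step ht hd (hzt n) (hz.1 n) (hl (n + 1))
      have h2 : 0 ≤ ∏ i ∈ Finset.range n, dil p q (z i) :=
        Finset.prod_nonneg fun _ _ => dil_nonneg _ _ _
      calc density N v s L (z (n + 1)) * ((∏ i ∈ Finset.range n, dil p q (z i)) * dil p q (z n))
          = (density N v s L (z (n + 1)) * dil p q (z n)) *
            ∏ i ∈ Finset.range n, dil p q (z i) := by ring
        _ ≤ (1 / 2 * density N v s L (z n)) * ∏ i ∈ Finset.range n, dil p q (z i) := by gcongr
        _ = 1 / 2 * (density N v s L (z n) * ∏ i ∈ Finset.range n, dil p q (z i)) := by ring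
        _ ≤ 1 / 2 * ((1 / 2) ^ n * density N v s L (z 0)) := by gcongr
        _ = _ := by ring
  have h1 := key n
  have h2 : z n = z 0 := by simpa using hz.2.2.1 0
  obtain ⟨j, hj, hzj⟩ := mem_trap.1 (hzt 0)
  have h3 := h.density_pos hj (h.disk_subset ht hj hzj)
  rw [h2, mul_comm] at h1
  refine (le_of_mul_le_mul_right h1 h3).trans_lt ?_
  exact pow_lt_one₀ (by norm_num) (by norm_num) hz.2.1.ne'

theorem admissible_mono (h : LocalModel p q c R k N v s L φ) (ht : Admissible p q c N v s L φ t)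
    {t' : ℝ} (h0 : 0 < t') (hle : t' ≤ t) (hb : ‖cent c φ N‖ + rad p q L t' N ≤ t') :
    Admissible p q c N v s L φ t' := by
  refine ⟨h0, hb, fun j hj => (ball_subset_ball ?_).trans (ht.subset j hj)⟩
  have hL := h.one_le
  unfold rad
  gcongr

theorem rad_mono (h : LocalModel p q c R k N v s L φ) (h0 : 0 < t) {i j : ℕ} (hij : i ≤ j) :
    rad p q L t i ≤ rad p q L t j := by
  have hL := h.one_le
  unfold rad
  gcongr
  linarith

theorem limit_mem_trap (h : LocalModel p q c R k N v s L φ)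
    (ht : Admissible p q c N v s L φ t) {t' : ℝ} (ht' : Admissible p q c N v s L φ t')
    (hb : 2 * ‖cent c φ N‖ < t') {z : ℕ → ℂ} (hz : IsForwardOrbit (image p q c) z)
    (hl : ∀ i, z i ∈ lev p q c R k) (h0 : z 0 ∈ trap p q c φ N L t) {m : ℕ → ℕ} {ζ : ℂ}
    (hm : StrictMono m) (hlim : Tendsto (fun i => z (m i)) atTop (𝓝 ζ)) :
    ζ ∈ trap p q c φ N L t' := by
  obtain ⟨i, hi⟩ := h.exists_mem_smaller ht ht' hb hz hl h0
  refine (isClosed_trap p q c φ N L t').mem_of_tendsto hlim ?_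
  filter_upwards [eventually_ge_atTop i] with j hj
  exact (h.isTrap ht').mem_of_orbit hz hl (hj.trans hm.le_apply) hi

/-- Cycles in the trap, and hence the dual Julia set, lie in every smaller trap. -/
theorem dualJulia_subset_smaller (h : LocalModel p q c R k N v s L φ)
    {t' : ℝ} (ht' : Admissible p q c N v s L φ t') :
    dualJulia p q c ⊆ trap p q c φ N L t' :=
  (h.isTrap ht').dualJulia_subset h.hq h.hpq h.esc

/-- The superattracting case. -/
theorem isHyperbolicOffCritical (h : LocalModel p q c R k N v s L φ)
    (ht : Admissible p q c N v s L φ t)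
    (hd : ∀ z, ‖z‖ ≤ t → dil p q z ≤ 1 / 2 * (2 * L)⁻¹ ^ N) (hb : cent c φ N = 0) :
    IsHyperbolicOffCritical p q c := by
  have hL := h.one_le
  have htp := ht.pos
  have hβ := ratio_gt_one h.hq h.hpq
  -- When `cent c φ N = 0`, the size condition reads `rad p q L t N ≤ t`. As `rad` scales like `t ^
  -- β` with `β > 1`, smaller sizes inherit it. The traps shrink to the cycle of `0`, which is the
  -- dual Julia set.
  have hadm : ∀ t', 0 < t' → t' ≤ t → Admissible p q c N v s L φ t' := by
    intro t' h0 hle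
    refine h.admissible_mono ht h0 hle ?_
    have h1 := ht.le
    rw [hb, norm_zero, zero_add] at h1 ⊢
    have h2 : (t' / t) ^ ((p : ℝ) / q) ≤ t' / t :=
      Real.rpow_le_self_of_le_one (by positivity) ((div_le_one htp).2 hle) hβ.le
    have h3 : rad p q L t' N = rad p q L t N * (t' / t) ^ ((p : ℝ) / q) := by
      rw [rad, rad, mul_assoc, ← Real.mul_rpow (by positivity) (by positivity)]
      congr 2
      field_simp
    rw [h3]
    calc _ ≤ t * (t' / t) := by
          have := h.rad_pos htp N
          gcongr
      _ = t' := by field_simp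
  have hV : ∀ x j, j ≤ N → x ∈ disk p q c φ L t j → (∀ t', 0 < t' → t' ≤ t →
      x ∈ trap p q c φ N L t') → x = cent c φ j := by
    intro x j hj hxj hx
    have h1 : ∀ᶠ t' in 𝓝[>] (0 : ℝ), ‖x - cent c φ j‖ ≤ rad p q L t' j := by
      filter_upwards [Ioc_mem_nhdsGT htp] with t' ht'
      obtain ⟨i, hi, hxi⟩ := mem_trap.1 (hx t' ht'.1 ht'.2)
      have := h.index_eq hj hi (h.disk_subset ht hj hxj)
        (h.disk_subset (hadm t' ht'.1 ht'.2) hi hxi)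
      subst this
      rwa [disk, mem_closedBall, dist_eq_norm] at hxi
    have h2 : Tendsto (fun t' => rad p q L t' j) (𝓝[>] 0) (𝓝 (rad p q L 0 j)) := by
      have : Continuous fun t' : ℝ => rad p q L t' j := by
        unfold rad
        exact continuous_const.mul ((continuous_const.mul continuous_id).rpow_const
          fun _ => Or.inr (by positivity))
      exact (this.tendsto 0).mono_left nhdsWithin_le_nhds
    have h3 := ge_of_tendsto h2 h1
    rw [rad, mul_zero, Real.zero_rpow (by positivity), mul_zero] at h3
    exact sub_eq_zero.1 (norm_le_zero_iff.1 h3)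
  have hself : ∀ j, cent c φ j ∈ disk p q c φ L t j := fun j =>
    mem_closedBall_self (h.rad_pos htp j).le
  have hVd : ∀ j ≤ N, cent c φ j ∈ dualJulia p q c := by
    set u : ℕ → ℂ := fun i => cent c φ (i % (N + 1)) with hu
    have huo : IsForwardOrbit (image p q c) u := by
      intro i
      have hlt : i % (N + 1) < N + 1 := Nat.mod_lt i N.succ_pos
      simp only [hu]
      rw [← Nat.mod_add_mod]
      rcases (Nat.lt_succ_iff.1 hlt).lt_or_eq with h1 | h1
      · rw [Nat.mod_eq_of_lt (a := i % (N + 1) + 1) (by omega)]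
        exact h.mem _ h1 _
      · rw [h1, Nat.mod_self, hb]
        change (c - c) ^ q = 0 ^ p
        have := h.hq
        have := h.hpq
        rw [sub_self, zero_pow (by omega), zero_pow (by omega)]
    have hup : Function.Periodic u (N + 1) := fun i => by simp [hu]
    obtain ⟨n, hn⟩ := exists_isCycle huo N.succ_pos hup
    intro j hj
    rw [dualJulia_eq h.hq h.hpq]
    refine subset_closure ⟨n, u, hn, h.prod_lt_one ht hd hn fun i => ?_, j, ?_⟩
    · exact mem_trap.2 ⟨_, Nat.lt_succ_iff.1 (Nat.mod_lt _ N.succ_pos), hself _⟩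
    · simp [hu, Nat.mod_eq_of_lt (Nat.lt_succ_iff.2 hj)]
  have hVmem : ∀ x, (∀ t', 0 < t' → t' ≤ t → x ∈ trap p q c φ N L t') →
      x ∈ dualJulia p q c := by
    intro x hx
    obtain ⟨j, hj, hxj⟩ := mem_trap.1 (hx t htp le_rfl)
    rw [hV x j hj hxj hx]
    exact hVd j hj
  refine ⟨fun z hz w hw => ?_, h.supportsAttractingMetric ht hd,
    (h.isTrap ht).basin_eq h.hq h.hpq h.esc (fun z hz hl h0 m ζ hm hlim => ?_)
      fun n z hz hzt => (h.prod_lt_one ht hd hz hzt).le⟩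
  · refine hVmem w fun t' h0 hle => ?_
    have ht' := hadm t' h0 hle
    obtain ⟨j, hj, hzj⟩ := mem_trap.1 (h.dualJulia_subset_smaller ht' hz)
    exact mem_trap.2 ⟨_, Nat.lt_succ_iff.1 (Nat.mod_lt _ N.succ_pos),
      h.step_mem' ht' hj hzj hw.1 (filledJulia_subset_lev h.hq h.esc k hw.2)⟩
  · exact hVmem ζ fun t' ht0 hle =>
      h.limit_mem_trap ht (hadm t' ht0 hle) (by simpa [hb] using ht0) hz hl h0 hm hlim

end LocalModel

/-! ### The attracting case: a system of contractions -/

theorem IsForwardOrbit.concat {F : ℂ → Set ℂ} {y z : ℕ → ℂ} (hy : IsForwardOrbit F y)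
    (hz : IsForwardOrbit F z) {m : ℕ} (h : z 0 ∈ F (y m)) :
    IsForwardOrbit F (fun i => if i ≤ m then y i else z (i - (m + 1))) := by
  intro i
  simp only
  rcases lt_trichotomy i m with hi | rfl | hi
  · rw [if_pos (by omega), if_pos (by omega)]
    exact hy i
  · rw [if_neg (Nat.not_succ_le_self i), if_pos le_rfl, Nat.sub_self]
    exact h
  · rw [if_neg (by omega), if_neg (by omega), show i + 1 - (m + 1) = i - (m + 1) + 1 by omega]
    exact hz _

namespace LocalModel

variable {p q : ℕ} {c : ℂ} {R : ℝ} {k N : ℕ} {v : ℕ → ℂ} {s L t : ℝ} {φ : ℕ → ℂ → ℂ}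

/-- One step of an orbit in the trap extends to a contracting map between disks. -/
theorem exists_contraction (h : LocalModel p q c R k N v s L φ)
    (ht : Admissible p q c N v s L φ t)
    (hd : ∀ z, ‖z‖ ≤ t → dil p q z ≤ 1 / 2 * (2 * L)⁻¹ ^ N)
    (hrad : 4 * rad p q L t N ≤ ‖cent c φ N‖) {j : ℕ} (hj : j ≤ N) {x w : ℂ}
    (hx : x ∈ disk p q c φ L t j) (hw : w ∈ image p q c x) (hwl : w ∈ lev p q c R k) :
    ∃ g : ℂ → ℂ, g x = w ∧
      (∀ y ∈ disk p q c φ L t j, g y ∈ image p q c y ∧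
        g y ∈ disk p q c φ L t ((j + 1) % (N + 1))) ∧
      ∀ y ∈ disk p q c φ L t j, ∀ y' ∈ disk p q c φ L t j,
        (2 * L)⁻¹ ^ ((j + 1) % (N + 1)) * ‖g y - g y'‖ ≤ 1 / 2 * ((2 * L)⁻¹ ^ j * ‖y - y'‖) := by
  have hL := h.one_le
  have htp := ht.pos
  have hr := h.rad_pos htp j
  rcases hj.lt_or_eq with hlt | rfl
  · rw [Nat.mod_eq_of_lt (by omega)]
    have hs := h.disk_subset ht hj
    refine ⟨φ j, (h.uniq j hlt x (hs hx) w hw hwl).symm, fun y hy => ⟨h.mem j hlt y, ?_⟩,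
      fun y hy y' hy' => ?_⟩
    · rw [disk, cent, rad_succ, mem_closedBall, dist_eq_norm]
      refine (h.lip j hlt y (hs hy) _ (hs (mem_closedBall_self hr.le))).trans ?_
      rw [disk, mem_closedBall, dist_eq_norm] at hy
      nlinarith
    · have := h.lip j hlt y (hs hy) y' (hs hy')
      calc (2 * L)⁻¹ ^ (j + 1) * ‖φ j y - φ j y'‖ ≤ (2 * L)⁻¹ ^ (j + 1) * (L * ‖y - y'‖) := by gcongr
        _ = 1 / 2 * ((2 * L)⁻¹ ^ j * ‖y - y'‖) := by rw [pow_succ]; field_simp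
  · rw [Nat.mod_self, pow_zero]
    have hxb : ∀ y ∈ disk p q c φ L t j, ‖cent c φ j‖ ≤ ‖y‖ + rad p q L t j ∧
        ‖y - cent c φ j‖ ≤ rad p q L t j := fun y hy => by
      rw [disk, mem_closedBall, dist_eq_norm] at hy
      exact ⟨by linarith [norm_sub_norm_le (cent c φ j) y, norm_sub_rev y (cent c φ j)], hy⟩
    have hx0 : x ≠ 0 := by
      rintro rfl
      have := (hxb 0 hx).1
      rw [norm_zero] at this
      linarith
    -- By `hrad` the diameter of the last disk is at most half of `‖cent c φ N‖`, whereas `‖x‖` is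
    -- at least three quarters of it. So the branch through `(x, w)` is defined on the whole disk.
    have hsub : disk p q c φ L t j ⊆ ball x ‖x‖ := fun y hy => by
      rw [mem_ball, dist_eq_norm]
      have h1 := hxb x hx
      have h2 := hxb y hy
      have h3 := norm_sub_le_norm_sub_add_norm_sub y (cent c φ j) x
      rw [norm_sub_rev (cent c φ j) x] at h3
      linarith
    have hm := branch_mem h.hq hx0 (u₀ := w - c) hw c
    have hdiff := differentiableOn_branch p q hx0 (w - c) c
    refine ⟨branch p q x (w - c) c, by rw [branch_self p q hx0]; ring, fun y hy => ⟨hm y, ?_⟩,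
      fun y hy y' hy' => ?_⟩
    · rw [disk, cent, mem_closedBall, dist_eq_norm, norm_sub_of_mem_image h.hq (hm y), rad,
        pow_zero, one_mul]
      have := disk_last_subset ht hy
      exact Real.rpow_le_rpow (norm_nonneg _) (by linarith) (by positivity)
    · rw [one_mul, ← mul_assoc]
      refine Convex.norm_image_sub_le_of_norm_deriv_le (s := disk p q c φ L t j)
        (fun y hy => hdiff.differentiableAt (isOpen_ball.mem_nhds (hsub hy))) (fun y hy => ?_)
        (convex_closedBall _ _) hy' hy
      rw [norm_deriv_branch h.hq h.hpq isOpen_ball hdiff (fun y _ => hm y) (hsub hy)]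
      exact hd y (disk_last_subset ht hy)

/-- Orbit segments in the trap extend to contracting maps between disks. -/
theorem exists_contraction_iterate (h : LocalModel p q c R k N v s L φ)
    (ht : Admissible p q c N v s L φ t)
    (hd : ∀ z, ‖z‖ ≤ t → dil p q z ≤ 1 / 2 * (2 * L)⁻¹ ^ N)
    (hrad : 4 * rad p q L t N ≤ ‖cent c φ N‖) {z : ℕ → ℂ} (hz : IsForwardOrbit (image p q c) z)
    (hl : ∀ i, z i ∈ lev p q c R k) (m : ℕ) {i j : ℕ} (hj : j ≤ N)
    (hi : z i ∈ disk p q c φ L t j) :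
    ∃ G : ℂ → ℂ, G (z i) = z (i + m) ∧
      (∀ y ∈ disk p q c φ L t j, Reach (image p q c) (trap p q c φ N L t) m y (G y) ∧
        G y ∈ disk p q c φ L t ((j + m) % (N + 1))) ∧
      ∀ y ∈ disk p q c φ L t j, ∀ y' ∈ disk p q c φ L t j,
        (2 * L)⁻¹ ^ ((j + m) % (N + 1)) * ‖G y - G y'‖ ≤
          (1 / 2) ^ m * ((2 * L)⁻¹ ^ j * ‖y - y'‖) := by
  induction m generalizing i j with
  | zero =>
    have hj0 : (j + 0) % (N + 1) = j := Nat.mod_eq_of_lt (Nat.lt_succ_iff.2 hj)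
    rw [hj0]
    exact ⟨id, rfl, fun y hy => ⟨⟨rfl, mem_trap.2 ⟨j, hj, hy⟩⟩, hy⟩, fun y _ y' _ => by simp⟩
  | succ m ih =>
    obtain ⟨g, hg, hgm, hgl⟩ := h.exists_contraction ht hd hrad hj hi (hz i) (hl _)
    have hj' : (j + 1) % (N + 1) ≤ N := Nat.lt_succ_iff.1 (Nat.mod_lt _ N.succ_pos)
    obtain ⟨G, hG, hGm, hGl⟩ := ih hj' (hg ▸ (hgm _ hi).2)
    rw [Nat.mod_add_mod, show j + 1 + m = j + (m + 1) by ring] at hGm hGl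
    refine ⟨G ∘ g, ?_, fun y hy => ⟨⟨mem_trap.2 ⟨j, hj, hy⟩, g y, (hgm y hy).1,
      (hGm _ (hgm y hy).2).1⟩, (hGm _ (hgm y hy).2).2⟩, fun y hy y' hy' => ?_⟩
    · rw [Function.comp_apply, hg, hG, add_right_comm, add_assoc]
    · refine (hGl _ (hgm y hy).2 _ (hgm y' hy').2).trans ?_
      rw [pow_succ ((1 : ℝ) / 2), mul_assoc]
      exact mul_le_mul_of_nonneg_left (hgl y hy y' hy') (by positivity)

/-- Orbits in the trap approach the dual Julia set at a uniform rate. -/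
theorem exists_dualJulia_near (h : LocalModel p q c R k N v s L φ)
    (ht : Admissible p q c N v s L φ t)
    (hd : ∀ z, ‖z‖ ≤ t → dil p q z ≤ 1 / 2 * (2 * L)⁻¹ ^ N)
    (hrad : 4 * rad p q L t N ≤ ‖cent c φ N‖) {z : ℕ → ℂ} (hz : IsForwardOrbit (image p q c) z)
    (hl : ∀ i, z i ∈ lev p q c R k) (h0 : z 0 ∈ trap p q c φ N L t) {l : ℕ} (hlN : N + 1 ≤ l) :
    ∃ u ∈ dualJulia p q c, ‖z l - u‖ ≤ (1 / 2) ^ (l / (N + 1)) * (2 * rad p q L t N) := by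
  have hL := h.one_le
  set M := l / (N + 1) with hM
  have hM1 : 0 < M := Nat.div_pos hlN N.succ_pos
  -- After the first `l % (N + 1)` steps, the remaining ones make `M` full rounds and extend to a
  -- contraction of one disk into itself. Its fixed point is an attracting periodic point close to
  -- `z l`.
  obtain ⟨j, hj, hzj⟩ := mem_trap.1
    ((h.isTrap ht).mem_of_orbit hz hl (Nat.zero_le (l % (N + 1))) h0)
  obtain ⟨G, hG, hGm, hGl⟩ := h.exists_contraction_iterate ht hd hrad hz hl (M * (N + 1)) hj hzj
  rw [Nat.add_mul_mod_self_right, Nat.mod_eq_of_lt (Nat.lt_succ_iff.2 hj)] at hGm hGl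
  rw [show l % (N + 1) + M * (N + 1) = l by rw [hM, mul_comm]; exact Nat.mod_add_div l (N + 1)] at hG
  have hcon : ∀ y ∈ disk p q c φ L t j, ∀ y' ∈ disk p q c φ L t j,
      ‖G y - G y'‖ ≤ (1 / 2) ^ (M * (N + 1)) * ‖y - y'‖ := fun y hy y' hy' => by
    have h1 : (0 : ℝ) < (2 * L)⁻¹ ^ j := by positivity
    refine le_of_mul_le_mul_left ?_ h1
    calc _ ≤ _ := hGl y hy y' hy'
      _ = _ := by ring
  obtain ⟨u, hu, hGu⟩ := exists_fixedPoint_of_contraction (h.rad_pos ht.pos j).le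
    (fun y hy => (hGm y hy).2) (fun y hy y' hy' => (hcon y hy y' hy').trans (by
      gcongr
      exact pow_le_of_le_one (by norm_num) (by norm_num) (by positivity)))
  have hreach := (hGm u hu).1
  rw [hGu] at hreach
  obtain ⟨x, hx0, hxF, hxP, hxt⟩ := hreach.exists_periodic (by positivity)
  obtain ⟨n, hn⟩ := exists_isCycle hxF (by positivity) hxP
  refine ⟨u, ?_, ?_⟩
  · rw [dualJulia_eq h.hq h.hpq]
    exact subset_closure ⟨n, x, hn, h.prod_lt_one ht hd hn hxt, 0, hx0⟩
  · have h1 := hcon _ hzj u hu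
    rw [hG, hGu] at h1
    have h2 : ‖z (l % (N + 1)) - u‖ ≤ 2 * rad p q L t N := by
      have h3 := norm_sub_le_norm_sub_add_norm_sub (z (l % (N + 1))) (cent c φ j) u
      have h4 := h.rad_mono ht.pos hj
      rw [disk, mem_closedBall, dist_eq_norm] at hzj
      rw [mem_closedBall, dist_comm, dist_eq_norm] at hu
      linarith
    refine h1.trans ?_
    have h3 : ((1 : ℝ) / 2) ^ (M * (N + 1)) ≤ (1 / 2) ^ M :=
      pow_le_pow_of_le_one (by norm_num) (by norm_num) (Nat.le_mul_of_pos_right M N.succ_pos)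
    gcongr

theorem tendsto_rate (N : ℕ) (D : ℝ) :
    Tendsto (fun l : ℕ => ((1 : ℝ) / 2) ^ (l / (N + 1)) * D) atTop (𝓝 0) := by
  have h1 : Tendsto (fun l : ℕ => l / (N + 1)) atTop atTop :=
    Nat.tendsto_div_const_atTop N.succ_ne_zero
  have h2 := (tendsto_pow_atTop_nhds_zero_of_lt_one (r := (1 : ℝ) / 2) (by norm_num)
    (by norm_num)).comp h1
  simpa using h2.mul_const D

/-- The attracting case. -/
theorem isHyperbolic (h : LocalModel p q c R k N v s L φ)
    (ht : Admissible p q c N v s L φ t)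
    (hd : ∀ z, ‖z‖ ≤ t → dil p q z ≤ 1 / 2 * (2 * L)⁻¹ ^ N) (hb : cent c φ N ≠ 0)
    (hle : 4 * ‖cent c φ N‖ ≤ t)
    (hrad : 4 * rad p q L (4 * ‖cent c φ N‖) N ≤ ‖cent c φ N‖) : IsHyperbolic p q c := by
  have hb' : 0 < ‖cent c φ N‖ := norm_pos_iff.2 hb
  -- Returns shrink to size about `2 * ‖cent c φ N‖`, so orbits enter the trap of size `t'`. By
  -- `hrad` its last disk has radius at most a quarter of `‖cent c φ N‖`, and misses `0`.
  set t' := 4 * ‖cent c φ N‖ with ht'def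
  have ht' : Admissible p q c N v s L φ t' :=
    h.admissible_mono ht (by positivity) hle (by linarith)
  have hd' : ∀ z, ‖z‖ ≤ t' → dil p q z ≤ 1 / 2 * (2 * L)⁻¹ ^ N :=
    fun z hz => hd z (hz.trans hle)
  have hdual := h.dualJulia_subset_smaller ht'
  have hKl : ∀ {x}, x ∈ filledJulia p q c → x ∈ lev p q c R k := fun hx =>
    filledJulia_subset_lev h.hq h.esc k hx
  refine ⟨⟨fun h0 => ?_, fun z hz w hw => ?_, h.supportsAttractingMetric ht hd⟩,
    (h.isTrap ht).basin_eq h.hq h.hpq h.esc (fun z hz hl h0 m ζ hm hlim => ?_)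
      fun n z hz hzt => (h.prod_lt_one ht hd hz hzt).le⟩
  · obtain ⟨j, hj, hj0⟩ := mem_trap.1 (hdual h0)
    have h1 := h.disk_subset ht' hj hj0
    have hs : 0 < s := dist_nonneg.trans_lt h1
    have h2 : (0 : ℂ) ∈ ball (v N) s := by rw [h.last]; exact mem_ball_self hs
    obtain rfl := h.index_eq hj le_rfl h1 h2
    rw [disk, mem_closedBall, dist_eq_norm, zero_sub, norm_neg] at hj0
    linarith
  · obtain ⟨j, hj, hzj⟩ := mem_trap.1 (hdual hz)
    obtain ⟨g, hg, hgm, hgl⟩ := h.exists_contraction ht' hd' hrad hj hzj hw.1 (hKl hw.2)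
    have hL := h.one_le
    -- Going round the cycle `m` times and then stepping to `g (x i)` is an orbit in the trap that
    -- arrives at `g (x i)` arbitrarily late. Its arrival point is therefore as close to the dual
    -- Julia set as desired.
    have key : ∀ n x, IsCycle p q c n x → ∏ i ∈ Finset.range n, dil p q (x i) < 1 →
        ∀ i, x i ∈ disk p q c φ L t' j → g (x i) ∈ dualJulia p q c := by
      intro n x hx hx1 i hi
      have hxt := (h.isTrap ht').cycle_subset h.hq h.hpq h.esc hx hx1
      have hgt : g (x i) ∈ trap p q c φ N L t' :=
        mem_trap.2 ⟨_, Nat.lt_succ_iff.1 (Nat.mod_lt _ N.succ_pos), (hgm _ hi).2⟩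
      obtain ⟨y, hy0, hy, hyt⟩ := exists_orbit_of_invariant (fun x hx => h.exists_step' ht' hx) hgt
      have hper : ∀ m : ℕ, x (i + m * n) = x i := fun m => by
        simpa using hx.2.2.1.nat_mul m i
      have hnear : ∀ m : ℕ, N + 1 ≤ i + m * n + 1 → ∃ u ∈ dualJulia p q c,
          ‖g (x i) - u‖ ≤ (1 / 2) ^ ((i + m * n + 1) / (N + 1)) * (2 * rad p q L t' N) := by
        intro m hm
        have hmem : y 0 ∈ image p q c (x (i + m * n)) := by
          rw [hy0, hper]
          exact (hgm _ hi).1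
        have ho := hx.1.concat hy hmem
        have hA : ∀ l, (if l ≤ i + m * n then x l else y (l - (i + m * n + 1))) ∈
            trap p q c φ N L t' := fun l => by
          split_ifs
          · exact hxt l
          · exact hyt _
        obtain ⟨u, hu, hul⟩ := h.exists_dualJulia_near ht' hd' hrad ho
          (fun l => hKl (h.trap_subset ht' (hA l))) (hA 0) hm
        refine ⟨u, hu, ?_⟩
        rwa [if_neg (by omega), Nat.sub_self, hy0] at hul
      refine isClosed_closure.closure_subset (Metric.mem_closure_iff.2 fun ε hε => ?_)
      have hmt : Tendsto (fun m : ℕ => i + m * n + 1) atTop atTop :=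
        tendsto_atTop_mono (fun m => by
          have := Nat.le_mul_of_pos_right m hx.2.1
          change m ≤ i + m * n + 1
          omega) tendsto_id
      obtain ⟨m, hm1, hm2⟩ := ((hmt.eventually_ge_atTop (N + 1)).and
        (((tendsto_rate N (2 * rad p q L t' N)).comp hmt).eventually (gt_mem_nhds hε))).exists
      obtain ⟨u, hu, hul⟩ := hnear m hm1
      exact ⟨u, hu, by rw [dist_eq_norm]; exact hul.trans_lt hm2⟩
    rw [← hg]
    refine isClosed_closure.closure_subset (Metric.mem_closure_iff.2 fun ε hε => ?_)
    obtain ⟨δ, hδ, hδs⟩ := Metric.isOpen_iff.1 isOpen_ball z (h.disk_subset ht' hj hzj)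
    rw [dualJulia_eq h.hq h.hpq] at hz
    set K := (2 * L)⁻¹ ^ ((j + 1) % (N + 1)) with hK
    have hK0 : 0 < K := by positivity
    -- The bound `δ` puts the cycle point in the same disk as `z`, and the factor `K` absorbs the
    -- weight of the density at the image.
    obtain ⟨_, ⟨n, x, hx, hx1, i, rfl⟩, hxz⟩ := Metric.mem_closure_iff.1 hz
      (min δ (K * ε)) (by positivity)
    have hxt := (h.isTrap ht').cycle_subset h.hq h.hpq h.esc hx hx1 i
    obtain ⟨j', hj', hxj⟩ := mem_trap.1 hxt
    have hxs : x i ∈ ball (v j) s := hδs (by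
      rw [mem_ball, dist_comm]; exact hxz.trans_le (min_le_left _ _))
    obtain rfl := h.index_eq hj' hj (h.disk_subset ht' hj' hxj) hxs
    refine ⟨g (x i), key n x hx hx1 i hxj, ?_⟩
    have h1 := hgl z hzj _ hxj
    have h2 : (2 * L)⁻¹ ^ j' ≤ 1 := pow_le_one₀ (by positivity) (inv_le_one_of_one_le₀ (by linarith))
    rw [dist_eq_norm] at hxz ⊢
    refine lt_of_mul_lt_mul_left ?_ hK0.le
    calc K * ‖g z - g (x i)‖ ≤ 1 / 2 * ((2 * L)⁻¹ ^ j' * ‖z - x i‖) := h1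
      _ ≤ 1 * (1 * ‖z - x i‖) := by gcongr; norm_num
      _ < K * ε := by rw [one_mul, one_mul]; exact hxz.trans_le (min_le_right _ _)
  · obtain ⟨i, hi⟩ := h.exists_mem_smaller ht ht' (by linarith) hz hl h0
    refine isClosed_closure.closure_subset (Metric.mem_closure_iff.2 fun ε hε => ?_)
    have hmt : Tendsto (fun l => m l - i) atTop atTop :=
      (tendsto_sub_atTop_nat i).comp hm.tendsto_atTop
    obtain ⟨l, hl1, hl2, hl3⟩ := ((hmt.eventually_ge_atTop (N + 1)).and
      ((((tendsto_rate N (2 * rad p q L t' N)).comp hmt).eventually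
        (gt_mem_nhds (half_pos hε))).and (hlim (ball_mem_nhds ζ (half_pos hε))))).exists
    obtain ⟨u, hu, hul⟩ := h.exists_dualJulia_near ht' hd' hrad
      (z := fun l => z (l + i)) (fun l => by simpa [add_right_comm] using hz (l + i))
      (fun l => hl _) (by simpa using hi) hl1
    refine ⟨u, hu, ?_⟩
    rw [show m l - i + i = m l by omega, ← dist_eq_norm] at hul
    have hl3' : dist (z (m l)) ζ < ε / 2 := hl3
    have := dist_triangle_left ζ u (z (m l))
    have hl2' := hul.trans_lt hl2
    linarith

end LocalModel

/-! ### Perturbation of simple centers -/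

theorem eq_of_mem_image_zero {p q : ℕ} (hq : 0 < q) (hp : 0 < p) {c w : ℂ}
    (h : w ∈ image p q c 0) : w = c := by
  have h1 : (w - c) ^ q = 0 ^ p := h
  rwa [zero_pow hp.ne', pow_eq_zero_iff hq.ne', sub_eq_zero] at h1

theorem self_mem_image_zero {p q : ℕ} (hq : 0 < q) (hp : 0 < p) (c : ℂ) : c ∈ image p q c 0 := by
  change (c - c) ^ q = 0 ^ p
  rw [sub_self, zero_pow hq.ne', zero_pow hp.ne']

/-- The critical value of a simple center runs through a cycle `v 0, …, v N = 0`, along which the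
restricted multifunction is single-valued. -/
theorem IsSimpleCenter.exists_cycle {p q : ℕ} (hq : 0 < q) (hp : 0 < p) {a : ℂ}
    (h : IsSimpleCenter p q a) :
    ∃ (N : ℕ) (v : ℕ → ℂ), v 0 = a ∧ v N = 0 ∧ (∀ j < N, v j ≠ 0) ∧
      (∀ j, v (j + 1) ∈ image p q a (v j)) ∧ (∀ i ≤ N, ∀ j ≤ N, v i = v j → i = j) ∧
      ∀ j, ∀ w ∈ image p q a (v j), w ∈ filledJulia p q a → w = v (j + 1) := by
  classical
  obtain ⟨⟨n, hn, hit⟩, o, ⟨ho0, ho⟩, huniq⟩ := h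
  have hon : o n = 0 := by
    have := ho.mem_iter n 0
    rw [ho0, hit, zero_add] at this
    exact this
  have hsingle : ∀ i, ∀ w ∈ image p q a (o i), w ∈ filledJulia p q a → w = o (i + 1) := by
    intro i w hw hwK
    obtain ⟨u, rfl, hu, hb⟩ := hwK
    have hur : IsForwardOrbit (restr p q a) u := fun l =>
      ⟨hu l, mem_filledJulia_of_orbit hu hb (l + 1)⟩
    -- A second image in the filled Julia set would give a second orbit of `0`: follow `o` up to
    -- time `i`, then switch.
    have hcon := ho.concat hur (m := i) ⟨hw, mem_filledJulia_of_orbit hu hb 0⟩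
    have := huniq _ ⟨by simpa using ho0, hcon⟩
    have h1 := congrFun this (i + 1)
    rw [if_neg (Nat.not_succ_le_self i), Nat.sub_self] at h1
    exact h1
  have hex : ∃ n, 0 < n ∧ o n = 0 := ⟨n, hn, hon⟩
  obtain ⟨N, hN⟩ := Nat.exists_eq_succ_of_ne_zero (Nat.find_spec hex).1.ne'
  have hmin : ∀ m, 0 < m → m < N + 1 → o m ≠ 0 := fun m h0 hm h1 =>
    Nat.find_min hex (hN ▸ hm) ⟨h0, h1⟩
  have hNz : o (N + 1) = 0 := by
    have := (Nat.find_spec hex).2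
    rwa [hN] at this
  have hshift : ∀ i j l, o i = o j → o (i + l) = o (j + l) := by
    intro i j l hij
    induction l with
    | zero => exact hij
    | succ l ih =>
      refine hsingle (j + l) _ ?_ (ho (i + l)).2
      rw [← ih]
      exact (ho (i + l)).1
  -- A repetition would bring the orbit to `0` before its first return at time `N + 1`.
  have hlt : ∀ i j, i < j → j ≤ N → o (i + 1) ≠ o (j + 1) := by
    intro i j hij hj he
    have := hshift _ _ (N - j) he
    rw [show j + 1 + (N - j) = N + 1 by omega, hNz] at this
    exact hmin _ (by omega) (by omega) this
  refine ⟨N, fun j => o (j + 1), ?_, hNz, fun j hj => hmin _ (by omega) (by omega),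
    fun j => (ho (j + 1)).1, fun i hi j hj he => ?_, fun j => hsingle (j + 1)⟩
  · have := (ho 0).1
    rw [ho0] at this
    exact eq_of_mem_image_zero hq hp this
  · rcases lt_trichotomy i j with h1 | h1 | h1
    · exact absurd he (hlt i j h1 hj)
    · exact h1
    · exact absurd he.symm (hlt j i h1 hi)

/-- Near an isolated image in the filled Julia set the multifunction has a single branch. -/
theorem eventually_eq_branch {p q : ℕ} (hq : 0 < q) {a v₀ v₁ : ℂ} (hv₀ : v₀ ≠ 0)
    (hv₁ : v₁ ∈ image p q a v₀) {R : ℝ} {k : ℕ}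
    (hk : ∀ w ∈ image p q a v₀, w ≠ v₁ → (a, w) ∉ clev p q R k) :
    ∀ᶠ x : ℂ × ℂ in 𝓝 (a, v₀), ∀ w ∈ image p q x.1 x.2, (x.1, w) ∈ clev p q R k →
      w = branch p q v₀ (v₁ - a) x.1 x.2 := by
  have hu : (v₁ - a) ^ q = v₀ ^ p := hv₁
  have hu0 : v₁ - a ≠ 0 := by
    intro h0
    rw [h0, zero_pow hq.ne'] at hu
    exact pow_ne_zero p hv₀ hu.symm
  have hfin : {θ : ℂ | θ ^ q = 1 ∧ θ ≠ 1}.Finite := by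
    refine (image_finite p q hq 0 1).subset fun θ hθ => ?_
    change (θ - 0) ^ q = 1 ^ p
    rw [sub_zero, one_pow]
    exact hθ.1
  have hcont : ContinuousAt (fun x : ℂ × ℂ => (x.2 / v₀) ^ ((p : ℂ) / q)) (a, v₀) := by
    refine ContinuousAt.cpow (by fun_prop) continuousAt_const ?_
    simp [div_self hv₀]
  -- The other images are obtained from the branch by a root of unity `θ ≠ 1`. At `(a, v₀)` they
  -- miss the closed set `clev`, hence also nearby.
  have hev : ∀ θ ∈ {θ : ℂ | θ ^ q = 1 ∧ θ ≠ 1}, ∀ᶠ x : ℂ × ℂ in 𝓝 (a, v₀),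
      (x.1, x.1 + θ * ((v₁ - a) * (x.2 / v₀) ^ ((p : ℂ) / q))) ∉ clev p q R k := by
    rintro θ ⟨hθ, hθ1⟩
    have hc : ContinuousAt (fun x : ℂ × ℂ =>
        (x.1, x.1 + θ * ((v₁ - a) * (x.2 / v₀) ^ ((p : ℂ) / q)))) (a, v₀) :=
      continuousAt_fst.prodMk (continuousAt_fst.add
        (continuousAt_const.mul (continuousAt_const.mul hcont)))
    refine hc.eventually ((isClosed_clev p q R k).isOpen_compl.mem_nhds ?_)
    simp only [div_self hv₀, Complex.one_cpow, mul_one]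
    refine hk _ ?_ fun he => hθ1 ?_
    · change (a + θ * (v₁ - a) - a) ^ q = v₀ ^ p
      rw [add_sub_cancel_left, mul_pow, hθ, one_mul, hu]
    · have h1 : (θ - 1) * (v₁ - a) = 0 := by linear_combination he
      exact sub_eq_zero.1 ((mul_eq_zero.1 h1).resolve_right hu0)
  have hne : ∀ᶠ x : ℂ × ℂ in 𝓝 (a, v₀), (x.2 / v₀) ^ ((p : ℂ) / q) ≠ 0 := by
    refine hcont.eventually_ne ?_
    simp [div_self hv₀]
  filter_upwards [(Filter.eventually_all_finite hfin).2 hev, hne] with x hx hx0 w hw hwk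
  have hb := branch_mem (z₀ := v₀) hq hv₀ hu x.1 x.2
  have hw' : (w - x.1) ^ q = x.2 ^ p := hw
  have hb' : (branch p q v₀ (v₁ - a) x.1 x.2 - x.1) ^ q = x.2 ^ p := hb
  set y := (v₁ - a) * (x.2 / v₀) ^ ((p : ℂ) / q) with hy
  have hbr : branch p q v₀ (v₁ - a) x.1 x.2 = x.1 + y := rfl
  have hy0 : y ≠ 0 := mul_ne_zero hu0 hx0
  rw [hbr, add_sub_cancel_left] at hb'
  have hθ : ((w - x.1) / y) ^ q = 1 := by
    rw [div_pow, hw', hb', div_self]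
    rw [← hb']
    exact pow_ne_zero _ hy0
  rw [hbr]
  by_cases h1 : (w - x.1) / y = 1
  · rw [div_eq_one_iff_eq hy0] at h1
    rw [← h1]
    ring
  · have := hx _ ⟨hθ, h1⟩
    rw [div_mul_cancel₀ _ hy0, add_sub_cancel] at this
    exact absurd hwk this

/-- The points `v j` have finitely many images outside the filled Julia set, so one level discards
them all, and `eventually_eq_branch` carries this over to nearby parameters. The cycle of the center
thus serves as a fixed skeleton for all of them. -/
theorem exists_localModel {p q : ℕ} (hq : 0 < q) (hpq : q < p) {a : ℂ} {N : ℕ} {v : ℕ → ℂ}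
    (hN : v N = 0) (hne : ∀ j < N, v j ≠ 0)
    (hmem : ∀ j, v (j + 1) ∈ image p q a (v j)) (hinj : ∀ i ≤ N, ∀ j ≤ N, v i = v j → i = j)
    (huniq : ∀ j, ∀ w ∈ image p q a (v j), w ∈ filledJulia p q a → w = v (j + 1)) :
    ∃ (R : ℝ) (k : ℕ) (s L : ℝ), 0 < s ∧ ∀ c ∈ ball a s, LocalModel p q c R k N v s L
      (fun j => branch p q (v j) (v (j + 1) - a) c) := by
  obtain ⟨R, hR⟩ := exists_uniform_escapeRadius hq hpq (‖a‖ + 1)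
  have hRa := hR a (by linarith)
  have hW : (⋃ j ∈ Finset.range N, image p q a (v j)).Finite :=
    (Finset.range N).finite_toSet.biUnion fun j _ => image_finite p q hq a (v j)
  have hk1 : ∀ w : ℂ, ∃ k, w ∉ filledJulia p q a → w ∉ lev p q a R k := fun w => by
    by_cases hw : w ∈ filledJulia p q a
    · exact ⟨0, fun h => absurd hw h⟩
    · obtain ⟨k, hk⟩ := exists_notMem_lev hq hRa hw
      exact ⟨k, fun _ => hk⟩
  choose κ hκ using hk1
  obtain ⟨k₀, hk₀⟩ := (hW.image κ).bddAbove
  -- The extra `1` is the loss in `clev_succ_subset_lev`.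
  have hk : ∀ j < N, ∀ w ∈ image p q a (v j), w ≠ v (j + 1) → (a, w) ∉ clev p q R (k₀ + 1) := by
    intro j hj w hw hwv hwc
    refine hκ w (fun hwK => hwv (huniq j w hw hwK)) (lev_antitone hRa ?_
      (clev_succ_subset_lev hRa hwc))
    exact hk₀ ⟨w, mem_biUnion (Finset.mem_coe.2 (Finset.mem_range.2 hj)) hw, rfl⟩
  set β : ℝ := (p : ℝ) / q with hβ
  have hβ1 : 1 < β := ratio_gt_one hq hpq
  set S := ∑ j ∈ Finset.range (N + 1), ‖v j‖
  have hS : ∀ j ≤ N, ‖v j‖ ≤ S := fun j hj =>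
    Finset.single_le_sum (f := fun j => ‖v j‖) (fun _ _ => norm_nonneg _)
      (Finset.mem_range.2 (Nat.lt_succ_iff.2 hj))
  have hS0 : 0 ≤ S := Finset.sum_nonneg fun _ _ => norm_nonneg _
  have e1 : ∀ᶠ s in 𝓝[>] (0 : ℝ), ∀ j ∈ Iio N, s < ‖v j‖ :=
    (eventually_all_finite (finite_Iio N)).2 fun j hj =>
      eventually_nhdsWithin_of_eventually_nhds (gt_mem_nhds (norm_pos_iff.2 (hne j hj)))
  have e2 : ∀ᶠ s in 𝓝[>] (0 : ℝ), ∀ i ∈ Iic N, ∀ j ∈ Iic N, i ≠ j →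
      Disjoint (ball (v i) s) (ball (v j) s) := by
    refine (eventually_all_finite (finite_Iic N)).2 fun i hi =>
      (eventually_all_finite (finite_Iic N)).2 fun j hj => ?_
    by_cases hij : i = j
    · exact Eventually.of_forall fun s h => absurd hij h
    · have hd : 0 < dist (v i) (v j) / 2 :=
        half_pos (dist_pos.2 fun he => hij (hinj i hi j hj he))
      filter_upwards [eventually_nhdsWithin_of_eventually_nhds (gt_mem_nhds hd)] with s hs _
      exact ball_disjoint_ball (by linarith)
  have e3 : ∀ᶠ s in 𝓝[>] (0 : ℝ), ∀ j ∈ Iio N, ∀ c ∈ ball a s, ∀ z ∈ ball (v j) s,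
      ∀ w ∈ image p q c z, (c, w) ∈ clev p q R (k₀ + 1) →
        w = branch p q (v j) (v (j + 1) - a) c z := by
    refine (eventually_all_finite (finite_Iio N)).2 fun j hj => ?_
    obtain ⟨ε, hε, hb⟩ := Metric.eventually_nhds_iff_ball.1
      (eventually_eq_branch hq (hne j hj) (hmem j) (hk j hj))
    filter_upwards [eventually_nhdsWithin_of_eventually_nhds (gt_mem_nhds hε)] with s hs c hc z hz
    refine hb (c, z) ?_
    rw [← ball_prod_same]
    exact ⟨ball_subset_ball hs.le hc, ball_subset_ball hs.le hz⟩
  have e4 : ∀ᶠ s in 𝓝[>] (0 : ℝ), s < 1 :=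
    eventually_nhdsWithin_of_eventually_nhds (gt_mem_nhds one_pos)
  obtain ⟨s, h1, h2, h3, h4, h0⟩ := (e1.and (e2.and (e3.and (e4.and
    (eventually_mem_nhdsWithin (a := (0 : ℝ)) (s := Ioi 0)))))).exists
  -- On these disks `‖z‖ ≤ 2 * S`, since `s < ‖v j‖ ≤ S`. The summand `1` only ensures that the
  -- bound `L` is at least `1`.
  have hdil : ∀ j < N, ∀ z ∈ ball (v j) s, dil p q z ≤ 1 + β * (2 * S) ^ (β - 1) := by
    intro j hj z hz
    rw [mem_ball, dist_eq_norm] at hz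
    have h5 : ‖z‖ ≤ 2 * S := by
      have := norm_sub_norm_le z (v j)
      linarith [hS j hj.le, h1 j hj]
    have h6 : ‖z‖ ^ (β - 1) ≤ (2 * S) ^ (β - 1) :=
      Real.rpow_le_rpow (norm_nonneg _) h5 (by linarith)
    unfold dil
    nlinarith
  refine ⟨R, k₀ + 1, s, 1 + β * (2 * S) ^ (β - 1), h0, fun c hc => ?_⟩
  have hcn : ‖c‖ ≤ ‖a‖ + 1 := by
    rw [mem_ball, dist_eq_norm] at hc
    linarith [norm_sub_norm_le c a]
  have hRc := hR c hcn
  have hsub : ∀ j < N, ball (v j) s ⊆ ball (v j) ‖v j‖ := fun j hj =>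
    ball_subset_ball (h1 j hj).le
  refine ⟨hq, hpq, hRc, ?_, hN, fun i hi j hj => h2 i hi j hj, fun j hj x hx y hy => ?_,
    fun j hj z hz w hw hwl => h3 j hj c hc z hz w hw (lev_subset_clev hRc hwl),
    fun j hj z => branch_mem hq (hne j hj) (hmem j) c z, hdil⟩
  · have : 0 ≤ β * (2 * S) ^ (β - 1) := by positivity
    linarith
  · have hd := differentiableOn_branch p q (hne j hj) (v (j + 1) - a) c
    refine Convex.norm_image_sub_le_of_norm_deriv_le (s := ball (v j) s)
      (fun y hy => hd.differentiableAt (isOpen_ball.mem_nhds (hsub j hj hy))) (fun y hy => ?_)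
      (convex_ball _ _) hy hx
    rw [norm_deriv_branch hq hpq isOpen_ball hd
      (fun z _ => branch_mem hq (hne j hj) (hmem j) c z) (hsub j hj hy)]
    exact hdil j hj y hy

theorem cent_self_and_analyticAt {p q : ℕ} {a : ℂ} {N : ℕ} {v : ℕ → ℂ} (h0 : v 0 = a)
    (hne : ∀ j < N, v j ≠ 0) {j : ℕ} (hj : j ≤ N) :
    cent a (fun j => branch p q (v j) (v (j + 1) - a) a) j = v j ∧
      AnalyticAt ℂ (fun c => cent c (fun j => branch p q (v j) (v (j + 1) - a) c) j) a := by
  induction j with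
  | zero => exact ⟨h0.symm, analyticAt_id⟩
  | succ j ih =>
    obtain ⟨h1, h2⟩ := ih (by omega)
    have hv := hne j hj
    refine ⟨?_, ?_⟩
    · rw [cent, h1, branch_self p q hv]
      ring
    · change AnalyticAt ℂ (fun c => c + (v (j + 1) - a) *
        (cent c (fun j => branch p q (v j) (v (j + 1) - a) c) j / v j) ^ ((p : ℂ) / q)) a
      refine analyticAt_id.add (analyticAt_const.mul ((h2.div analyticAt_const hv).cpow
        analyticAt_const ?_))
      rw [Pi.div_apply, h1, div_self hv]
      exact Complex.one_mem_slitPlane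

/-- The zeros of this analytic function are isolated unless it vanishes near `a`. In that case `0`
would return to itself after `N + 1` steps for all nearby parameters, against `exists_not_periodic`.
-/
theorem eventually_cent_ne_zero {p q : ℕ} (hq : 0 < q) (hpq : q < p) {a : ℂ} {N : ℕ} {v : ℕ → ℂ}
    (h0 : v 0 = a) (hne : ∀ j < N, v j ≠ 0) (hmem : ∀ j, v (j + 1) ∈ image p q a (v j)) :
    ∀ᶠ c in 𝓝[≠] a, cent c (fun j => branch p q (v j) (v (j + 1) - a) c) N ≠ 0 := by
  have hp : 0 < p := by omega
  have hana := (cent_self_and_analyticAt (p := p) (q := q) h0 hne le_rfl).2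
  refine hana.eventually_eq_zero_or_eventually_ne_zero.resolve_left fun hz => ?_
  obtain ⟨ε, hε, hb⟩ := Metric.eventually_nhds_iff_ball.1 hz
  obtain ⟨c, hc, hper⟩ := exists_not_periodic hq hpq N.succ_pos a hε
  refine hper (fun i => Nat.casesOn i 0 (cent c (fun j => branch p q (v j) (v (j + 1) - a) c))) rfl
    (fun i hi => ?_) (hb c hc)
  cases i with
  | zero => exact self_mem_image_zero hq hp c
  | succ j => exact branch_mem hq (hne j (by omega)) (hmem j) c _

/-- The exponent `β > 1` makes `rad` small compared with `t`. The filter includes `t = 0` because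
`t` will be a multiple of `‖cent c φ N‖`, which vanishes at the center. -/
theorem eventually_rad_le {p q : ℕ} (hq : 0 < q) (hpq : q < p) (L : ℝ) (N : ℕ) {ε : ℝ}
    (hε : 0 < ε) : ∀ᶠ t in 𝓝[≥] (0 : ℝ), rad p q L t N ≤ ε * t := by
  have hβ := ratio_gt_one hq hpq
  have hc : Continuous fun t : ℝ => (2 * L) ^ N * 2 * (2 * t) ^ ((p : ℝ) / q - 1) :=
    continuous_const.mul ((continuous_const.mul continuous_id).rpow_const
      fun _ => Or.inr (by linarith))
  have h0 := hc.tendsto 0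
  simp only [mul_zero, Real.zero_rpow (by linarith : (p : ℝ) / q - 1 ≠ 0)] at h0
  filter_upwards [eventually_nhdsWithin_of_eventually_nhds (h0.eventually (gt_mem_nhds hε)),
    eventually_mem_nhdsWithin] with t ht ht0
  have ht0' : 0 ≤ t := ht0
  have h1 : (2 * t) ^ ((p : ℝ) / q) = (2 * t) ^ ((p : ℝ) / q - 1) * (2 * t) := by
    rcases ht0'.eq_or_lt with rfl | hpos
    · rw [mul_zero, Real.zero_rpow (by linarith), mul_zero]
    · rw [← Real.rpow_add_one (by positivity), sub_add_cancel]
  rw [rad, h1]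
  calc (2 * L) ^ N * ((2 * t) ^ ((p : ℝ) / q - 1) * (2 * t))
      = ((2 * L) ^ N * 2 * (2 * t) ^ ((p : ℝ) / q - 1)) * t := by ring
    _ ≤ ε * t := by gcongr

theorem eventually_dil_le {p q : ℕ} (hq : 0 < q) (hpq : q < p) {ε : ℝ}
    (hε : 0 < ε) : ∀ᶠ t in 𝓝[≥] (0 : ℝ), ∀ z, ‖z‖ ≤ t → dil p q z ≤ ε := by
  have hβ := ratio_gt_one hq hpq
  have hc : Continuous fun t : ℝ => (p : ℝ) / q * t ^ ((p : ℝ) / q - 1) :=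
    continuous_const.mul (continuous_id.rpow_const fun _ => Or.inr (by linarith))
  have h0 := hc.tendsto 0
  simp only [Real.zero_rpow (by linarith : (p : ℝ) / q - 1 ≠ 0), mul_zero] at h0
  filter_upwards [eventually_nhdsWithin_of_eventually_nhds (h0.eventually (gt_mem_nhds hε))]
    with t ht z hz
  refine le_trans ?_ ht.le
  unfold dil
  gcongr

theorem hyperbolic_near_simpleCenter {p q : ℕ} (hq : 0 < q) (hpq : q < p) {a : ℂ}
    (h : IsSimpleCenter p q a) :
    (∀ᶠ c in 𝓝[≠] a, IsHyperbolic p q c) ∧ IsHyperbolicOffCritical p q a := by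
  have hp : 0 < p := by omega
  obtain ⟨N, v, h0, hN, hne, hmem, hinj, huniq⟩ := h.exists_cycle hq hp
  obtain ⟨R, k, s, L, hs, hmod⟩ := exists_localModel hq hpq hN hne hmem hinj huniq
  set φ : ℂ → ℕ → ℂ → ℂ := fun c j => branch p q (v j) (v (j + 1) - a) c with hφ
  have hLa := (hmod a (mem_ball_self hs)).one_le
  have hcent : ∀ j ≤ N, cent a (φ a) j = v j := fun j hj => (cent_self_and_analyticAt h0 hne hj).1
  have hcont : ∀ j ≤ N, ContinuousAt (fun c => cent c (φ c) j) a := fun j hj =>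
    (cent_self_and_analyticAt h0 hne hj).2.continuousAt
  have hgt : 𝓝[>] (0 : ℝ) ≤ 𝓝[≥] 0 := nhdsWithin_mono _ Ioi_subset_Ici_self
  -- With `rad p q L t N ≤ t / 2`, the end of the critical orbit may move by `t / 2`. The doubled
  -- disks have radius at most `t < s / 2`, so their centres may move by `s / 2`.
  obtain ⟨t, hrad, hd, hts, ht0⟩ := (((eventually_rad_le hq hpq L N one_half_pos).filter_mono hgt).and
    (((eventually_dil_le hq hpq (ε := 1 / 2 * (2 * L)⁻¹ ^ N) (by positivity)).filter_mono hgt).and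
    ((eventually_nhdsWithin_of_eventually_nhds (gt_mem_nhds (half_pos hs))).and
    (eventually_mem_nhdsWithin (a := (0 : ℝ)) (s := Ioi 0))))).exists
  have ht0' : 0 < t := ht0
  have hb : Tendsto (fun c => ‖cent c (φ c) N‖) (𝓝 a) (𝓝[≥] 0) := by
    refine tendsto_nhdsWithin_iff.2 ⟨?_, Eventually.of_forall fun c => norm_nonneg _⟩
    have := (hcont N le_rfl).norm.tendsto
    rwa [hcent N le_rfl, hN, norm_zero] at this
  have hadm : ∀ᶠ c in 𝓝 a, LocalModel p q c R k N v s L (φ c) ∧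
      Admissible p q c N v s L (φ c) t := by
    have e1 : ∀ᶠ c in 𝓝 a, ∀ j ∈ Iic N, dist (cent c (φ c) j) (v j) < s / 2 :=
      (eventually_all_finite (finite_Iic N)).2 fun j hj => by
        have := (hcont j hj).tendsto
        rw [hcent j hj] at this
        exact this (ball_mem_nhds _ (half_pos hs))
    have e2 : ∀ᶠ c in 𝓝 a, ‖cent c (φ c) N‖ < t / 2 :=
      (hb.mono_right nhdsWithin_le_nhds).eventually (gt_mem_nhds (half_pos ht0'))
    filter_upwards [ball_mem_nhds a hs, e1, e2] with c hc h1 h2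
    have hm := hmod c hc
    refine ⟨hm, ht0', by linarith, fun j hj y hy => ?_⟩
    have h3 := hm.rad_mono ht0' hj
    have h4 := h1 j hj
    rw [mem_ball] at hy ⊢
    linarith [dist_triangle y (cent c (φ c) j) (v j)]
  refine ⟨?_, ?_⟩
  · have h4 : Tendsto (fun x : ℝ => 4 * x) (𝓝[≥] 0) (𝓝[≥] 0) := by
      refine tendsto_nhdsWithin_iff.2 ⟨?_, ?_⟩
      · have : Tendsto (fun x : ℝ => 4 * x) (𝓝 0) (𝓝 (4 * 0)) := (continuous_const_mul 4).tendsto 0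
        rw [mul_zero] at this
        exact this.mono_left nhdsWithin_le_nhds
      · filter_upwards [eventually_mem_nhdsWithin] with x hx
        have : (0 : ℝ) ≤ x := hx
        exact mul_nonneg (by norm_num) this
    -- For the size `4 * ‖cent c φ N‖`, the ratio `1 / 16` bounds the radius by a quarter of `‖cent
    -- c φ N‖`.
    have e1 := (h4.comp hb).eventually
      (eventually_rad_le hq hpq L N (ε := 1 / 16) (by norm_num))
    have e2 := ((h4.comp hb).mono_right nhdsWithin_le_nhds).eventually (gt_mem_nhds ht0')
    filter_upwards [eventually_cent_ne_zero hq hpq h0 hne hmem,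
      eventually_nhdsWithin_of_eventually_nhds e1, eventually_nhdsWithin_of_eventually_nhds e2,
      eventually_nhdsWithin_of_eventually_nhds hadm] with c hc h1 h2 h3
    simp only [Function.comp_apply] at h1 h2
    exact h3.1.isHyperbolic h3.2 hd hc h2.le (by linarith)
  · obtain ⟨h1, h2⟩ := hadm.self_of_nhds
    exact h1.isHyperbolicOffCritical h2 hd (by rw [hcent N le_rfl, hN])

end PowerCorr

theorem mainTheorem8 (p q : ℕ) (hq : 0 < q) (hpq : q < p) :
    (∀ c : ℂ, c ∉ PowerCorr.M0 p q → PowerCorr.IsHyperbolic p q c) ∧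
    (∀ a : ℂ, PowerCorr.IsSimpleCenter p q a →
      (∀ᶠ c in nhdsWithin a {a}ᶜ, PowerCorr.IsHyperbolic p q c) ∧
      PowerCorr.IsHyperbolicOffCritical p q a) :=
  ⟨fun _ hc => PowerCorr.isHyperbolic_of_notMem_M0 hq hpq hc,
    fun _ ha => PowerCorr.hyperbolic_near_simpleCenter hq hpq ha⟩
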